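/- **Setting.** Let $\Omega\subset\mathbb R^3$ be a bounded domain with boundary $\Gamma$ of class $C^1$, $\Omega$ lying locally on one side of $\Gamma$. Let $\mathcal T_h$ be a finite mesh of non-degenerate closed tetrahedra, two of which always intersect exactly in the convex hull of their common vertices. Let $h_T$ be the diameter of $T\in\mathcal T_h$, $h=\max_T h_T$, $\Omega_h$ the interior of $\bigcup_{T\in\mathcal T_h}T$ and $\Gamma_h=\partial\Omega_h$. Assume that - all mesh vertices belong to $\overline\Omega$, and those lying on $\Gamma_h$ lie on $\Gamma$; - the mesh is shape regular with parameter $\sigma$: every $T$ contains a ball of diameter at least $h_T/\sigma$; - every element has at most either one face or one edge contained in $\Gamma_h$ (if it has a face in $\Gamma_h$, its only edges in $\Gamma_h$ are those of this face). With every mesh edge $e\subset\Gamma_h$ associate a plane $\delta_e$ (the plane of the skin) containing $e$ that is close to the bisector of the faces of $\Gamma_h$ meeting at $e$: for any two distinct mesh faces $F,F'\subset\Gamma_h$ containing $e$, the angle between $\delta_e$ and the plane through $e$ that bisects the angle formed by $F$ and $F'$ is at most $\theta$, where $\theta\in[0,\pi/2)$ is fixed ($\theta=0$ being the exact bisector).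 For a mesh face $F\subset\Gamma_h$ let $P_F$ be a nearest (to the centroid of $F$) intersection with $\Gamma$ of the perpendicular to $F$ through its centroid. For a mesh edge $e\subset\Gamma_h$ with mid-point $M_e$ let $Q_e$ be a nearest (to $M_e$) intersection with $\Gamma$ of the perpendicular to $e$ in $\delta_e$ through $M_e$. For a polynomial $v$ of degree at most two, a face $F$, and an edge $e$ with end-points $A_e,B_e$ and mid-point $M_e$, let $\mu_F(v)$ be the value of $v$ at the centroid of $F$ and $\nu_e(v)=0.4\,v(M_e)+0.3\,[v(A_e)+v(B_e)]$. For $F,e\subset\Gamma_h$ let $\tilde\mu_F(v)=v(P_F)$ and $\tilde\nu_e(v)=0.4\,v(Q_e)+0.3\,[v(A_e)+v(B_e)]$. Let $V_h^*$ be the space of functions on $\Omega_h$ whose restriction to each $T\in\mathcal T_h$ is a polynomial of degree at most two, such that $\mu_F(v_{|T})$ (resp. $\nu_e(v_{|T})$) is the same for all elements $T$ sharing the face $F\not\subset\Gamma_h$ (resp. the edge $e\not\subset\Gamma_h$), and $\mu_F(v_{|T})=0$, $\nu_e(v_{|T})=0$ for all faces $F$ and edges $e$ of $T$ contained in $\Gamma_h$.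 Let $W_h^*$ be defined in the same way, except that for the faces $F$ and edges $e$ of $T$ contained in $\Gamma_h$ the conditions are $\tilde\mu_F(w_{|T})=0$ and $\tilde\nu_e(w_{|T})=0$, the polynomial $w_{|T}$ being also evaluated at $P_F$ and $Q_e$ when these points lie outside $T$. For $f\in L^2(\Omega)$, extended by zero outside $\Omega$, let $$a_h^*(w,v)=\sum_{T\in\mathcal T_h}\int_T \nabla w_{|T}\cdot\nabla v_{|T}\,dx,\qquad L_h(v)=\int_{\Omega_h} f\,v\,dx .$$ **Proposition.** For every such $\Omega$, every $\sigma$ and every $\theta\in[0,\pi/2)$ there is $h_0>0$, depending only on $\Omega,\sigma,\theta$, such that for every mesh and every choice of planes $\delta_e$ as above with $h\le h_0$, nodes $P_F$ and $Q_e$ as above exist for all mesh faces $F$ and edges $e$ contained in $\Gamma_h$ and, for every choice of them and every $f\in L^2(\Omega)$, the problem $$\text{find } u_h^*\in W_h^* \text{ such that } a_h^*(u_h^*,v)=L_h(v)\quad\forall v\in V_h^*$$ has exactly one solution. -/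

import Mathlib

open MeasureTheory

noncomputable section

/-- Three-dimensional Euclidean space. -/
abbrev E3 : Type := EuclideanSpace ℝ (Fin 3)

/-- `Ω` is a bounded domain of `ℝ³` whose boundary is a `C¹` surface, with `Ω` on one side of it:
near each boundary point `Ω` is the set where some `C¹` function with non-vanishing differential
at that point is negative. -/
structure IsC1Domain (Ω : Set E3) : Prop where
  isOpen : IsOpen Ω
  isConnected : IsConnected Ω
  isBounded : Bornology.IsBounded Ω
  boundary : ∀ x ∈ frontier Ω, ∃ (U : Set E3) (φ : E3 → ℝ), IsOpen U ∧ x ∈ U ∧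
    ContDiffOn ℝ 1 φ U ∧ fderiv ℝ φ x ≠ 0 ∧ Ω ∩ U = {y | y ∈ U ∧ φ y < 0}

/-- Real polynomials of total degree at most two in three variables. -/
abbrev P2 : Type := MvPolynomial.restrictTotalDegree (Fin 3) ℝ 2

/-- The value of a polynomial at a point. -/
def P2.val (p : P2) (x : E3) : ℝ := MvPolynomial.eval (fun i => x i) p.1

@[simp] lemma P2.val_zero (x : E3) : P2.val 0 x = 0 := by simp [P2.val]

@[simp] lemma P2.val_add (p q : P2) (x : E3) : (p + q).val x = p.val x + q.val x := by
  simp [P2.val]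

@[simp] lemma P2.val_smul (c : ℝ) (p : P2) (x : E3) : (c • p).val x = c * p.val x := by
  simp [P2.val, MvPolynomial.smul_eval]

/-- `0.4 p(Q) + 0.3 (p(A) + p(B))` for an edge `e` with end-points `A`, `B`. -/
def P2.edgeMean (p : P2) (e : Finset E3) (Q : E3) : ℝ :=
  (2 / 5) * p.val Q + (3 / 10) * ∑ A ∈ e, p.val A

@[simp] lemma P2.edgeMean_zero (e : Finset E3) (Q : E3) : P2.edgeMean 0 e Q = 0 := by
  simp [P2.edgeMean]

@[simp] lemma P2.edgeMean_add (p q : P2) (e : Finset E3) (Q : E3) :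
    (p + q).edgeMean e Q = p.edgeMean e Q + q.edgeMean e Q := by
  simp only [P2.edgeMean, P2.val_add, Finset.sum_add_distrib]; ring

@[simp] lemma P2.edgeMean_smul (c : ℝ) (p : P2) (e : Finset E3) (Q : E3) :
    (c • p).edgeMean e Q = c * p.edgeMean e Q := by
  simp only [P2.edgeMean, P2.val_smul, ← Finset.mul_sum]; ring

/-- The degree of freedom `μ_F`: the value at the centroid of the face `F`. -/
def P2.mu (p : P2) (F : Finset E3) : ℝ := p.val (F.centroid ℝ id)

/-- The degree of freedom `ν_e`: the weighted mean of the values at the mid-point and at the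
end-points of the edge `e`. -/
def P2.nu (p : P2) (e : Finset E3) : ℝ := p.edgeMean e (e.centroid ℝ id)

/-- A finite mesh of non-degenerate tetrahedra, each given by its set of four vertices. Two
tetrahedra intersect exactly in the convex hull of their common vertices (a common face, edge or
vertex, or nothing). -/
structure TetMesh where
  elems : Finset (Finset E3)
  card_eq : ∀ T ∈ elems, T.card = 4
  indep : ∀ T ∈ elems, AffineIndependent ℝ ((↑) : T → E3)
  compat : ∀ T ∈ elems, ∀ T' ∈ elems,
    convexHull ℝ (T : Set E3) ∩ convexHull ℝ (T' : Set E3) =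
      convexHull ℝ ((T : Set E3) ∩ (T' : Set E3))

namespace TetMesh

variable (M : TetMesh)

/-- The open polyhedron `Ω_h`, the interior of the union of the closed tetrahedra. -/
def polyhedron : Set E3 := interior (⋃ T ∈ M.elems, convexHull ℝ (T : Set E3))

/-- The boundary `Γ_h` of the polyhedron. -/
def bdry : Set E3 := frontier M.polyhedron

/-- `F` is a face of an element of the mesh. -/
def IsFace (F : Finset E3) : Prop := F.card = 3 ∧ ∃ T ∈ M.elems, F ⊆ T

/-- `e` is an edge of an element of the mesh. -/
def IsEdge (e : Finset E3) : Prop := e.card = 2 ∧ ∃ T ∈ M.elems, e ⊆ T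

/-- `F` is a face of the mesh contained in `Γ_h`. -/
def IsBdryFace (F : Finset E3) : Prop := M.IsFace F ∧ convexHull ℝ (F : Set E3) ⊆ M.bdry

/-- `e` is an edge of the mesh contained in `Γ_h`. -/
def IsBdryEdge (e : Finset E3) : Prop := M.IsEdge e ∧ convexHull ℝ (e : Set E3) ⊆ M.bdry

/-- The mesh size `h`, the largest diameter of an element. -/
def meshSize : ℝ := ⨆ T : M.elems, Metric.diam (convexHull ℝ (T.1 : Set E3))

/-- Shape regularity with parameter `σ`: each element contains a ball whose diameter is at least
`1 / σ` times the diameter of the element. -/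
def ShapeRegular (σ : ℝ) : Prop :=
  ∀ T ∈ M.elems, ∃ (c : E3) (r : ℝ), 0 < r ∧ Metric.closedBall c r ⊆ convexHull ℝ (T : Set E3) ∧
    Metric.diam (convexHull ℝ (T : Set E3)) ≤ σ * (2 * r)

/-- The mesh fits `Ω`: its vertices belong to the closure of `Ω`, and those that lie on `Γ_h` lie on
the boundary of `Ω`. -/
def Fits (Ω : Set E3) : Prop :=
  (∀ T ∈ M.elems, ∀ x ∈ T, x ∈ closure Ω) ∧
  (∀ T ∈ M.elems, ∀ x ∈ T, x ∈ M.bdry → x ∈ frontier Ω)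

/-- Every element has at most either one face or one edge contained in `Γ_h`: if it has a face in
`Γ_h`, its only edges in `Γ_h` are those of that face (hence that face is its only one);
otherwise it has at most one edge in `Γ_h`. -/
def AtMostOneFaceOrEdge : Prop :=
  ∀ T ∈ M.elems,
    (∀ F ⊆ T, M.IsBdryFace F → ∀ e ⊆ T, M.IsBdryEdge e → e ⊆ F) ∧
    ((∀ F ⊆ T, ¬ M.IsBdryFace F) →
      ∀ e ⊆ T, ∀ e' ⊆ T, M.IsBdryEdge e → M.IsBdryEdge e' → e = e')

end TetMesh

/-- `p` is the unit vector in the plane of the triangle `F` that is orthogonal to the edge `e` of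
`F` and points from `e` into `F`. -/
def IsConormal (e F : Finset E3) (p : E3) : Prop :=
  p ∈ vectorSpan ℝ (F : Set E3) ∧ ‖p‖ = 1 ∧ (∀ a ∈ e, ∀ b ∈ e, inner ℝ (a - b) p = 0) ∧
    ∀ c ∈ F, c ∉ e → ∀ a ∈ e, 0 < inner ℝ (c - a) p

namespace TetMesh

variable (M : TetMesh)

/-- `n e` is a normal vector of the plane of the skin attached to the edge `e ⊆ Γ_h`. That plane
contains `e`, and makes an angle of at most `θ` with the plane bisecting the faces `F`, `F'` in
`Γ_h` that meet at `e`, whose normal is the difference of the conormals of `F` and `F'`. -/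
def IsSkinFamily (θ : ℝ) (n : Finset E3 → E3) : Prop :=
  ∀ e, M.IsBdryEdge e → n e ≠ 0 ∧ (∀ a ∈ e, ∀ b ∈ e, inner ℝ (a - b) (n e) = 0) ∧
    ∀ F F', M.IsBdryFace F → M.IsBdryFace F' → e ⊆ F → e ⊆ F' → F ≠ F' →
      ∀ p p', IsConormal e F p → IsConormal e F' p' →
        Real.cos θ * (‖n e‖ * ‖p - p'‖) ≤ |inner ℝ (n e) (p - p')|

end TetMesh

/-- The line perpendicular to the plane of the triangle `F` through the centroid of `F`. -/
def faceLine (F : Finset E3) : Set E3 :=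
  {x | ∀ a ∈ F, ∀ b ∈ F, inner ℝ (a - b) (x - F.centroid ℝ id) = 0}

/-- The line perpendicular to the edge `e` through its mid-point, in the plane with normal `n`. -/
def edgeLine (e : Finset E3) (n : E3) : Set E3 :=
  {x | (∀ a ∈ e, ∀ b ∈ e, inner ℝ (a - b) (x - e.centroid ℝ id) = 0) ∧
    inner ℝ n (x - e.centroid ℝ id) = 0}

/-- `P` is a point of `S` nearest to `c`. -/
def IsNearest (S : Set E3) (c P : E3) : Prop := P ∈ S ∧ ∀ Q ∈ S, dist c P ≤ dist c Q

namespace TetMesh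

variable (M : TetMesh)

/-- `P` and `Q` assign to the faces and to the edges in `Γ_h` their nodes on `Γ`: nearest
intersections with `Γ` of the perpendicular through the centroid, respectively of the perpendicular
through the mid-point in the plane of the skin. -/
def IsNodes (Γ : Set E3) (n P Q : Finset E3 → E3) : Prop :=
  (∀ F, M.IsBdryFace F → IsNearest (Γ ∩ faceLine F) (F.centroid ℝ id) (P F)) ∧
  (∀ e, M.IsBdryEdge e → IsNearest (Γ ∩ edgeLine e (n e)) (e.centroid ℝ id) (Q e))

/-- Piecewise quadratic functions: one polynomial for each element, without any matching condition
(the polynomial of an element is also evaluated at nodes on `Γ` outside that element). -/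
abbrev Broken : Type := M.elems → P2

/-- The degrees of freedom at faces and edges not contained in `Γ_h` are single-valued. -/
def InnerMatch (v : M.Broken) : Prop :=
  (∀ F, M.IsFace F → ¬ M.IsBdryFace F →
    ∀ T T' : M.elems, F ⊆ T.1 → F ⊆ T'.1 → (v T).mu F = (v T').mu F) ∧
  (∀ e, M.IsEdge e → ¬ M.IsBdryEdge e →
    ∀ T T' : M.elems, e ⊆ T.1 → e ⊆ T'.1 → (v T).nu e = (v T').nu e)

/-- The space of piecewise quadratic functions with single-valued inner degrees of freedom, whose
value at the node `P F` and weighted edge mean with node `Q e` vanish for the faces `F` and the edges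
`e` contained in `Γ_h`. -/
def spaceWithNodes (P Q : Finset E3 → E3) : Submodule ℝ M.Broken where
  carrier := {w | M.InnerMatch w ∧
    (∀ F, M.IsBdryFace F → ∀ T : M.elems, F ⊆ T.1 → (w T).val (P F) = 0) ∧
    (∀ e, M.IsBdryEdge e → ∀ T : M.elems, e ⊆ T.1 → (w T).edgeMean e (Q e) = 0)}
  zero_mem' := by simp [InnerMatch, P2.mu, P2.nu]
  add_mem' := by
    rintro v w ⟨⟨a1, a2⟩, a3, a4⟩ ⟨⟨b1, b2⟩, b3, b4⟩
    refine ⟨⟨fun F hF hb T T' h h' => ?_, fun e he hb T T' h h' => ?_⟩,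
      fun F hF T h => ?_, fun e he T h => ?_⟩
    · have := a1 F hF hb T T' h h'
      have := b1 F hF hb T T' h h'
      simp_all [P2.mu]
    · have := a2 e he hb T T' h h'
      have := b2 e he hb T T' h h'
      simp_all [P2.nu]
    · simp [a3 F hF T h, b3 F hF T h]
    · simp [a4 e he T h, b4 e he T h]
  smul_mem' := by
    rintro c v ⟨⟨a1, a2⟩, a3, a4⟩
    refine ⟨⟨fun F hF hb T T' h h' => ?_, fun e he hb T T' h h' => ?_⟩,
      fun F hF T h => ?_, fun e he T h => ?_⟩
    · have := a1 F hF hb T T' h h'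
      simp_all [P2.mu]
    · have := a2 e he hb T T' h h'
      simp_all [P2.nu]
    · simp [a3 F hF T h]
    · simp [a4 e he T h]

/-- The test space `V*_h`: the nodes are the centroids of faces and the mid-points of edges, that is,
`μ_F` and `ν_e` vanish for the faces and edges contained in `Γ_h`. -/
def testSpace : Submodule ℝ M.Broken :=
  M.spaceWithNodes (fun F => F.centroid ℝ id) (fun e => e.centroid ℝ id)

/-- The trial space `W*_h`: the nodes of the faces and edges in `Γ_h` are the given points of `Γ`. -/
abbrev trialSpace (P Q : Finset E3 → E3) : Submodule ℝ M.Broken := M.spaceWithNodes P Q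

/-- The bilinear form `∫_{Ω_h} grad_h w · grad_h v`, as a sum over the elements. -/
def form (w v : M.Broken) : ℝ :=
  ∑ T : M.elems, ∫ x in convexHull ℝ (T.1 : Set E3),
    inner ℝ (gradient (w T).val x) (gradient (v T).val x)

/-- The linear form `∫_{Ω_h} f v`, as a sum over the elements, with `f` extended by zero outside
`Ω`. -/
def load (Ω : Set E3) (f : E3 → ℝ) (v : M.Broken) : ℝ :=
  ∑ T : M.elems, ∫ x in convexHull ℝ (T.1 : Set E3), Ω.indicator f x * (v T).val x

end TetMesh

end

/-! Trial and test functions differ only in where the boundary degrees of freedom are sampled. On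
each element add to `w` the quadratic whose degrees of freedom are the defects of `w`: sampled at
the nodes on Γ, minus sampled at centroids and mid-points. The resulting map Φ (elementwise
`transfer`) turns perturbed degrees of freedom of `w` into plain ones of Φw, so w lies in the trial
space exactly when Φw lies in the test space. Solvability follows once a(w, Φw) > 0 for every
nonzero trial function w, because the form pulled back to the test space is then nondegenerate in
finite dimension (`existsUnique_solution`).

Positivity is local. If the nodes are within a small multiple of the element size from centroids and
mid-points, the defects are small compared with the largest vertex gradient of `w`, and shape
regularity makes the added quadratic a small perturbation in gradient (`IsBary.coercive`). Hence
a(w, Φw) = 0 forces `w` to be constant on each element. The elements carrying one nonzero constant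
would form a bounded family, which has a face lying in only one of its members (`exists_unshared`).
Matching across inner faces puts that face on Γ_h, where the node condition makes the constant zero
(`eq_zero_of_const`).

It remains to place the nodes close by. A C¹ boundary satisfies a cone condition with arbitrarily
small opening η and uniform radius (`IsC1Domain.exists_isConeDir`), so a short line transversal to
the tangent plane must cross Γ (`IsConeDir.exists_mem_frontier`). A boundary face has its vertices
on Γ, hence is almost tangent, and shape regularity makes its normal transversal.

For an edge, one needs two boundary faces meeting there; they exist by a parity count
(`exists_two_bdryFaces`). Their conormals are both almost tangent, and they are not close to each
other, since otherwise the two elements, both on the inner side of Γ, would overlap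
(`conormals_apart`). So their difference is a reliable almost tangent vector, and the skin plane,
whose normal makes an angle at most θ with it, contains a perpendicular to the edge that is
transversal to Γ (`cos_div_four_le`). -/

noncomputable section

/-! ### Barycentric coordinates of a tetrahedron -/

/-- `l a` is the barycentric coordinate, with gradient `g a`, of the vertex `a` of `T`. -/
structure IsBary (T : Finset E3) (l : E3 → E3 → ℝ) (g : E3 → E3) : Prop where
  sub : ∀ a x y, l a x - l a y = inner ℝ (g a) (x - y)
  self : ∀ a ∈ T, l a a = 1
  ne : ∀ a ∈ T, ∀ b ∈ T, b ≠ a → l a b = 0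
  sum_eq : ∀ x, ∑ a ∈ T, l a x = 1
  sum_smul : ∀ x, ∑ a ∈ T, l a x • a = x

theorem exists_isBary {T : Finset E3} (hc : T.card = 4)
    (hi : AffineIndependent ℝ ((↑) : T → E3)) : ∃ l g, IsBary T l g := by
  classical
  have htop : affineSpan ℝ (Set.range ((↑) : T → E3)) = ⊤ := by
    rw [hi.affineSpan_eq_top_iff_card_eq_finrank_add_one]
    simp [hc]
  let b : AffineBasis T ℝ E3 := ⟨_, hi, htop⟩
  have hb : ∀ i : T, b i = (i : E3) := fun i => rfl
  -- Outside `T` both default to 0, which keeps the field `sub` valid for every `a`.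
  let l : E3 → E3 → ℝ := fun a x => if h : a ∈ T then b.coord ⟨a, h⟩ x else 0
  let g : E3 → E3 := fun a => if h : a ∈ T then
    (InnerProductSpace.toDual ℝ E3).symm (LinearMap.toContinuousLinearMap (b.coord ⟨a, h⟩).linear)
    else 0
  refine ⟨l, g, ⟨?_, ?_, ?_, ?_, ?_⟩⟩
  · intro a x y
    by_cases h : a ∈ T
    · simp only [l, g, h, dif_pos, InnerProductSpace.toDual_symm_apply]
      exact ((b.coord ⟨a, h⟩).linearMap_vsub x y).symm
    · simp [l, g, h]
  · intro a h
    simp only [l, h, dif_pos]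
    exact b.coord_apply_eq ⟨a, h⟩
  · intro a ha c hc hne
    have := b.coord_apply_ne (i := ⟨a, ha⟩) (j := ⟨c, hc⟩) (by simpa [Subtype.ext_iff] using hne.symm)
    simp only [l, ha, dif_pos]
    exact this
  · intro x
    rw [← Finset.sum_coe_sort, ← b.sum_coord_apply_eq_one x]
    exact Finset.sum_congr rfl fun i _ => by simp [l]
  · intro x
    rw [← Finset.sum_coe_sort]
    conv_rhs => rw [← b.linear_combination_coord_eq_self x]
    exact Finset.sum_congr rfl fun i _ => by simp [l, hb]

namespace IsBary

variable {T : Finset E3} {l : E3 → E3 → ℝ} {g : E3 → E3}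

theorem eq_add (h : IsBary T l g) (a x y : E3) : l a x = l a y + inner ℝ (g a) (x - y) := by
  linarith [h.sub a x y]

theorem continuous (h : IsBary T l g) (a : E3) : Continuous (l a) := by
  have : l a = fun x => l a 0 + inner ℝ (g a) (x - 0) := funext fun x => h.eq_add a x 0
  rw [this]; fun_prop

theorem hasFDerivAt (h : IsBary T l g) (a x : E3) : HasFDerivAt (l a) (innerSL ℝ (g a)) x := by
  have : l a = fun x => l a 0 + innerSL ℝ (g a) x := funext fun x => by
    simpa using h.eq_add a x 0
  rw [this]
  exact (innerSL ℝ (g a)).hasFDerivAt.const_add _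

theorem sum_weights (h : IsBary T l g) (a : E3) {S : Finset E3} {w : E3 → ℝ}
    (hw : ∑ y ∈ S, w y = 1) : l a (∑ y ∈ S, w y • y) = ∑ y ∈ S, w y * l a y := by
  have e : ∀ y, l a y = l a 0 + inner ℝ (g a) y := fun y => by simpa using h.eq_add a y 0
  have e2 : ∀ y ∈ S, w y * l a y = w y * l a 0 + w y * inner ℝ (g a) y := fun y _ => by
    rw [e y, mul_add]
  rw [Finset.sum_congr rfl e2, e, inner_sum, Finset.sum_add_distrib, ← Finset.sum_mul, hw]
  simp [inner_smul_right]

theorem sum_weights_eq (h : IsBary T l g) {a : E3} (ha : a ∈ T) {S : Finset E3} (hS : S ⊆ T)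
    {w : E3 → ℝ} (hw : ∑ y ∈ S, w y = 1) [Decidable (a ∈ S)] :
    l a (∑ y ∈ S, w y • y) = if a ∈ S then w a else 0 := by
  rw [h.sum_weights a hw]
  split_ifs with haS
  · rw [Finset.sum_eq_single_of_mem a haS, h.self a ha, mul_one]
    intro b hb hne
    rw [h.ne a ha b (hS hb) hne, mul_zero]
  · refine Finset.sum_eq_zero fun b hb => ?_
    rw [h.ne a ha b (hS hb) (fun e => haS (e ▸ hb)), mul_zero]

theorem mem_hull_iff (h : IsBary T l g) {S : Finset E3} (hS : S ⊆ T) {x : E3} :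
    x ∈ convexHull ℝ (S : Set E3) ↔ (∀ a ∈ S, 0 ≤ l a x) ∧ ∀ a ∈ T, a ∉ S → l a x = 0 := by
  classical
  constructor
  · rw [Finset.mem_convexHull']
    rintro ⟨w, hw0, hw1, rfl⟩
    refine ⟨fun a ha => ?_, fun a ha haS => ?_⟩
    · rw [h.sum_weights_eq (hS ha) hS hw1, if_pos ha]; exact hw0 a ha
    · rw [h.sum_weights_eq ha hS hw1, if_neg haS]
  · rintro ⟨h0, h1⟩
    rw [Finset.mem_convexHull']
    refine ⟨fun a => l a x, h0, ?_, ?_⟩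
    · rw [← h.sum_eq x]
      exact Finset.sum_subset hS fun a ha haS => h1 a ha haS
    · conv_rhs => rw [← h.sum_smul x]
      exact Finset.sum_subset hS fun a ha haS => by simp [h1 a ha haS]

theorem mem_hull (h : IsBary T l g) {x : E3} :
    x ∈ convexHull ℝ (T : Set E3) ↔ ∀ a ∈ T, 0 ≤ l a x := by
  rw [h.mem_hull_iff (Finset.Subset.refl T)]
  exact ⟨fun h => h.1, fun h => ⟨h, fun a ha hn => absurd ha hn⟩⟩

theorem le_one (h : IsBary T l g) {x : E3} (hx : x ∈ convexHull ℝ (T : Set E3)) {a : E3}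
    (ha : a ∈ T) : l a x ≤ 1 := by
  rw [← h.sum_eq x]
  exact Finset.single_le_sum (f := fun a => l a x) (fun b hb => h.mem_hull.1 hx b hb) ha

theorem centroid (h : IsBary T l g) {S : Finset E3} (hS : S ⊆ T) (hne : S.Nonempty) {a : E3}
    (ha : a ∈ T) [Decidable (a ∈ S)] :
    l a (S.centroid ℝ id) = if a ∈ S then (S.card : ℝ)⁻¹ else 0 := by
  have hw := S.sum_centroidWeights_eq_one_of_nonempty ℝ hne
  have : S.centroid ℝ id = ∑ y ∈ S, (S.centroidWeights ℝ) y • y := by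
    rw [Finset.centroid_def, Finset.affineCombination_eq_linear_combination _ _ _ hw]
    simp
  rw [this, h.sum_weights_eq ha hS hw, Finset.centroidWeights_apply]

theorem grad_sum (h : IsBary T l g) (u : E3) : ∑ a ∈ T, inner ℝ (g a) u = 0 := by
  have h1 := h.sum_eq u
  have h0 := h.sum_eq 0
  have : ∀ a, inner ℝ (g a) u = l a u - l a 0 := fun a => by rw [h.sub]; simp
  simp_rw [this, Finset.sum_sub_distrib, h1, h0, sub_self]

theorem vector_eq (h : IsBary T l g) (u b : E3) :
    u = ∑ a ∈ T, (inner ℝ (g a) u : ℝ) • (a - b) := by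
  have h1 := h.sum_smul u
  have h0 := h.sum_smul 0
  have : ∀ a, inner ℝ (g a) u = l a u - l a 0 := fun a => by rw [h.sub]; simp
  simp_rw [smul_sub, Finset.sum_sub_distrib, ← Finset.sum_smul, h.grad_sum u]
  simp_rw [this, sub_smul, Finset.sum_sub_distrib, h1, h0]
  simp

theorem affine_eq (h : IsBary T l g) (A : E3 →ᵃ[ℝ] E3) (x : E3) :
    A x = ∑ a ∈ T, l a x • A a := by
  have e : ∀ y, A y = A.linear y + A 0 := fun y => by
    simpa using A.map_vadd 0 y
  have e2 : ∀ y ∈ T, l y x • A y = A.linear (l y x • y) + l y x • A 0 := fun y _ => by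
    rw [e y, smul_add, map_smul]
  rw [Finset.sum_congr rfl e2, Finset.sum_add_distrib, ← Finset.sum_smul, h.sum_eq, one_smul,
    ← map_sum, h.sum_smul, ← e]

theorem mem_interior (h : IsBary T l g) {x : E3} (hx : ∀ a ∈ T, 0 < l a x) :
    x ∈ interior (convexHull ℝ (T : Set E3)) := by
  have hopen : IsOpen (⋂ a ∈ T, {y | 0 < l a y}) :=
    isOpen_biInter_finset fun a _ => isOpen_lt continuous_const (h.continuous a)
  refine _root_.mem_interior.2 ⟨_, ?_, hopen, by simpa using hx⟩
  intro y hy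
  rw [h.mem_hull]
  intro a ha
  exact (Set.mem_iInter₂.1 hy a ha).le

/-- From a point with `l a x ≤ 0`, a small move against `g a` makes the coordinate negative and so
leaves the hull. -/
theorem pos_of_mem_interior (h : IsBary T l g) {x : E3}
    (hx : x ∈ interior (convexHull ℝ (T : Set E3))) {a : E3} (ha : a ∈ T) (hg : g a ≠ 0) :
    0 < l a x := by
  by_contra hcon
  have hnn : (convexHull ℝ (T : Set E3)) ∈ nhds x := mem_interior_iff_mem_nhds.1 hx
  have hcont : Filter.Tendsto (fun t : ℝ => x - t • g a) (nhdsWithin 0 (Set.Ioi 0)) (nhds x) := by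
    have : Continuous (fun t : ℝ => x - t • g a) := by fun_prop
    have := this.tendsto 0
    simp only [zero_smul, sub_zero] at this
    exact this.mono_left nhdsWithin_le_nhds
  obtain ⟨t, ht, ht0⟩ := ((hcont.eventually hnn).and self_mem_nhdsWithin).exists
  have h1 := h.mem_hull.1 ht a ha
  rw [h.eq_add a _ x] at h1
  have : inner ℝ (g a) (x - t • g a - x) = - (t * ‖g a‖ ^ 2) := by
    simp [inner_neg_right, inner_smul_right]
  rw [this] at h1
  have : 0 < t * ‖g a‖ ^ 2 := mul_pos ht0 (by positivity)
  linarith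

theorem inner_sub (h : IsBary T l g) {a b c : E3} : inner ℝ (g a) (b - c) = l a b - l a c :=
  (h.sub a b c).symm

theorem grad_ne_zero (h : IsBary T l g) (hcard : 1 < T.card) {a : E3} (ha : a ∈ T) : g a ≠ 0 := by
  obtain ⟨b, hb, hne⟩ := Finset.exists_mem_ne hcard a
  intro h0
  have := h.inner_sub (a := a) (b := a) (c := b)
  rw [h.self a ha, h.ne a ha b hb hne, h0] at this
  simp at this

/-- A ball in the hull bounds the gradients of the barycentric coordinates. -/
theorem norm_grad_le (h : IsBary T l g) {a : E3} (ha : a ∈ T) {c : E3} {r : ℝ} (hr : 0 < r)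
    (hball : Metric.closedBall c r ⊆ convexHull ℝ (T : Set E3)) : ‖g a‖ * (2 * r) ≤ 1 := by
  by_cases h0 : g a = 0
  · simp [h0]
  have hn : 0 < ‖g a‖ := norm_pos_iff.2 h0
  set u : E3 := (r / ‖g a‖) • g a with hu
  have hun : ‖u‖ = r := by rw [hu, norm_smul, Real.norm_of_nonneg (by positivity)]; field_simp
  -- Across the diameter of the ball along `g a` the coordinate grows by `2 * r * ‖g a‖`, yet it
  -- stays in [0, 1].
  have m1 : c + u ∈ convexHull ℝ (T : Set E3) := hball (by simp [hun])
  have m2 : c - u ∈ convexHull ℝ (T : Set E3) := hball (by simp [hun])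
  have h1 := h.le_one m1 ha
  have h2 := h.mem_hull.1 m2 a ha
  have h3 := h.sub a (c + u) (c - u)
  have : c + u - (c - u) = (2 * (r / ‖g a‖)) • g a := by rw [mul_smul, ← hu]; module
  rw [this, inner_smul_right, real_inner_self_eq_norm_sq] at h3
  have : 2 * (r / ‖g a‖) * ‖g a‖ ^ 2 = ‖g a‖ * (2 * r) := by field_simp
  linarith

end IsBary

theorem Finset.exists_apex {F T : Finset E3} (hF : F ⊆ T) (h3 : F.card = 3) (h4 : T.card = 4) :
    ∃ d, d ∉ F ∧ insert d F = T := by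
  obtain ⟨d, hd, h⟩ := Finset.exists_eq_insert_iff.2 ⟨hF, by omega⟩
  exact ⟨d, hd, h⟩

namespace IsBary

variable {T T' : Finset E3} {l l' : E3 → E3 → ℝ} {g g' : E3 → E3}

theorem centroid_pos (h : IsBary T l g) {S : Finset E3} (hS : S ⊆ T) {a : E3} (ha : a ∈ S) :
    0 < l a (S.centroid ℝ id) := by
  classical
  rw [h.centroid hS ⟨a, ha⟩ (hS ha), if_pos ha]
  have : 0 < S.card := Finset.card_pos.2 ⟨a, ha⟩
  positivity

theorem centroid_mem (h : IsBary T l g) {S : Finset E3} (hS : S ⊆ T) (hne : S.Nonempty) :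
    S.centroid ℝ id ∈ convexHull ℝ (S : Set E3) := by
  classical
  rw [h.mem_hull_iff hS]
  exact ⟨fun a ha => (h.centroid_pos hS ha).le, fun a ha hn => by
    rw [h.centroid hS hne ha, if_neg hn]⟩

/-- Both apex coordinates are affine and vanish on the plane of `F`, so they are proportional; the
factor is read off at `d'`. -/
theorem apex_rel (h : IsBary T l g) (h' : IsBary T' l' g') {F : Finset E3} {d d' : E3}
    (hd : d ∉ F) (hT : insert d F = T) (hd' : d' ∉ F) (hT' : insert d' F = T') (w : E3) :
    l d w = l' d' w * l d d' := by
  have hdT : d ∈ T := hT ▸ Finset.mem_insert_self d F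
  conv_lhs => rw [← h'.sum_smul w]
  rw [h.sum_weights d (h'.sum_eq w), ← hT', Finset.sum_insert hd']
  rw [Finset.sum_eq_zero, add_zero]
  intro a ha
  rw [h.ne d hdT a (hT ▸ Finset.mem_insert_of_mem ha) (fun e => hd (e ▸ ha)), mul_zero]

theorem face_coord_eq (h : IsBary T l g) (h' : IsBary T' l' g') {F : Finset E3} (hF : F ⊆ T)
    (hF' : F ⊆ T') {x : E3} (hx : x ∈ convexHull ℝ (F : Set E3)) {a : E3} (ha : a ∈ F) :
    l' a x = l a x := by
  classical
  rw [Finset.mem_convexHull'] at hx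
  obtain ⟨w, _, hw1, rfl⟩ := hx
  rw [h.sum_weights_eq (hF ha) hF hw1, h'.sum_weights_eq (hF' ha) hF' hw1]

theorem line (h : IsBary T l g) (a x y : E3) (t : ℝ) :
    l a (x + t • (y - x)) = (1 - t) * l a x + t * l a y := by
  have h1 := h.sub a (x + t • (y - x)) x
  have h2 := h.sub a y x
  rw [add_sub_cancel_left, inner_smul_right] at h1
  rw [← h2] at h1
  linarith

theorem interior_nonempty (h : IsBary T l g) : (interior (convexHull ℝ (T : Set E3))).Nonempty :=
  ⟨_, h.mem_interior fun _ ha => h.centroid_pos (Finset.Subset.refl T) ha⟩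

theorem closure_interior (h : IsBary T l g) :
    closure (interior (convexHull ℝ (T : Set E3))) = convexHull ℝ (T : Set E3) := by
  rw [(convex_convexHull ℝ _).closure_interior_eq_closure_of_nonempty_interior h.interior_nonempty]
  exact (T.finite_toSet.isCompact_convexHull (𝕜 := ℝ)).isClosed.closure_eq

end IsBary

theorem Finset.isClosed_hull (S : Finset E3) : IsClosed (convexHull ℝ (S : Set E3)) :=
  (S.finite_toSet.isCompact_convexHull (𝕜 := ℝ)).isClosed

/-! ### Combinatorics of the mesh: shared faces and the boundary -/

namespace TetMesh

variable {M : TetMesh}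

theorem exists_bary {T : Finset E3} (hT : T ∈ M.elems) : ∃ l g, IsBary T l g :=
  exists_isBary (M.card_eq T hT) (M.indep T hT)

/-- By `compat` the point lies in the hull of `T ∩ T'`, where the coordinates of all other vertices
of `T` vanish. -/
theorem subset_of_mem_relint {T T' : Finset E3} (hT : T ∈ M.elems) (hT' : T' ∈ M.elems)
    {l g} (h : IsBary T l g) {S : Finset E3} (hS : S ⊆ T) {x : E3}
    (hx : x ∈ convexHull ℝ (T : Set E3)) (hpos : ∀ a ∈ S, 0 < l a x)
    (hx' : x ∈ convexHull ℝ (T' : Set E3)) : S ⊆ T' := by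
  classical
  have hm : x ∈ convexHull ℝ ((T ∩ T' : Finset E3) : Set E3) := by
    rw [Finset.coe_inter, ← M.compat T hT T' hT']; exact ⟨hx, hx'⟩
  rw [h.mem_hull_iff Finset.inter_subset_left] at hm
  intro a ha
  by_contra hn
  have := hm.2 a (hS ha) (fun hh => hn (Finset.mem_inter.1 hh).2)
  linarith [hpos a ha]

theorem eq_of_overlap {T T' : Finset E3} (hT : T ∈ M.elems) (hT' : T' ∈ M.elems)
    {l g} (h : IsBary T l g) {x : E3} (hpos : ∀ a ∈ T, 0 < l a x)
    (hx' : x ∈ convexHull ℝ (T' : Set E3)) : T = T' := by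
  refine Finset.eq_of_subset_of_card_le (subset_of_mem_relint hT hT' h (Finset.Subset.refl T)
    (h.mem_hull.2 fun a ha => (hpos a ha).le) hpos hx') ?_
  rw [M.card_eq T hT, M.card_eq T' hT']

/-- Two elements with a common face lie on opposite sides of it. -/
theorem opposite {T T' : Finset E3} (hT : T ∈ M.elems) (hT' : T' ∈ M.elems) (hne : T ≠ T')
    {l g} (h : IsBary T l g) {F : Finset E3} {d d' : E3} (h3 : F.card = 3) (hd : d ∉ F)
    (hdT : insert d F = T) (hd' : d' ∉ F) (hdT' : insert d' F = T') : l d d' < 0 := by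
  classical
  by_contra! hcon
  obtain ⟨l', g', h'⟩ := exists_bary hT'
  have hF : F ⊆ T := hdT ▸ Finset.subset_insert d F
  have hF' : F ⊆ T' := hdT' ▸ Finset.subset_insert d' F
  have hFne : F.Nonempty := Finset.card_pos.1 (by omega)
  have hdm : d ∈ T := hdT ▸ Finset.mem_insert_self d F
  have hdm' : d' ∈ T' := hdT' ▸ Finset.mem_insert_self d' F
  set G := F.centroid ℝ id with hG
  -- If `d'` were not strictly beyond `F`, a short step from the centroid of `F` towards `d'` would
  -- stay in both elements. By `compat` the point reached has no `d'` component, although that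
  -- component is `s > 0`.
  have hev : ∀ᶠ s : ℝ in nhdsWithin 0 (Set.Ioi 0),
      (∀ a ∈ F, 0 < l a (G + s • (d' - G))) ∧ s < 1 := by
    refine Filter.Eventually.and ?_ ?_
    · rw [Filter.eventually_all_finset]
      intro a ha
      have hcont : Continuous fun s : ℝ => l a (G + s • (d' - G)) := by
        have := h.continuous a
        fun_prop
      have := hcont.tendsto 0
      simp only [zero_smul, add_zero] at this
      exact (this.mono_left nhdsWithin_le_nhds).eventually (lt_mem_nhds (h.centroid_pos hF ha))
    · exact nhdsWithin_le_nhds (gt_mem_nhds one_pos)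
  obtain ⟨s, ⟨hs, hs1⟩, hs0⟩ := (hev.and self_mem_nhdsWithin).exists
  have hs0 : 0 < s := hs0
  set x := G + s • (d' - G) with hx
  have hxT : x ∈ convexHull ℝ (T : Set E3) := by
    rw [h.mem_hull]
    intro a ha
    rw [← hdT, Finset.mem_insert] at ha
    rcases ha with rfl | ha
    · rw [hx, h.line, hG, h.centroid hF hFne hdm, if_neg hd]
      positivity
    · exact (hs a ha).le
  have hl'd : l' d' x = s := by
    rw [hx, h'.line, hG, h'.centroid hF' hFne hdm', if_neg hd', h'.self d' hdm']; ring
  have hxT' : x ∈ convexHull ℝ (T' : Set E3) := by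
    rw [h'.mem_hull]
    intro a ha
    rw [← hdT', Finset.mem_insert] at ha
    rcases ha with rfl | ha
    · rw [hl'd]; exact hs0.le
    · rw [hx, h'.line, h'.ne a (hF' ha) d' hdm' (fun e => hd' (e ▸ ha))]
      have := (h'.centroid_pos hF' ha).le
      have : 0 ≤ 1 - s := by linarith
      positivity
  have hm : x ∈ convexHull ℝ ((T' ∩ T : Finset E3) : Set E3) := by
    rw [Finset.coe_inter, ← M.compat T' hT' T hT]; exact ⟨hxT', hxT⟩
  rw [h'.mem_hull_iff Finset.inter_subset_left] at hm
  have : d' ∉ T' ∩ T := by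
    intro hh
    apply hne
    have hsub : T' ⊆ T := by
      rw [← hdT']
      exact Finset.insert_subset (Finset.mem_inter.1 hh).2 hF
    exact (Finset.eq_of_subset_of_card_le hsub (by rw [M.card_eq T hT, M.card_eq T' hT'])).symm
  linarith [hm.2 d' hdm' this]

/-- Near `z` the coordinates of the vertices of `F` stay positive in both elements, and the two apex
coordinates have opposite signs by `apex_rel` and `opposite`; so each nearby point is in one of the
two. -/
theorem mem_interior_of_shared {T T' : Finset E3} (hT : T ∈ M.elems) (hT' : T' ∈ M.elems)
    (hne : T ≠ T') {l g} (h : IsBary T l g) {F : Finset E3} (h3 : F.card = 3)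
    (hF : F ⊆ T) (hF' : F ⊆ T') {z : E3} (hz : z ∈ convexHull ℝ (F : Set E3))
    (hpos : ∀ a ∈ F, 0 < l a z) :
    z ∈ interior (convexHull ℝ (T : Set E3) ∪ convexHull ℝ (T' : Set E3)) := by
  obtain ⟨l', g', h'⟩ := exists_bary hT'
  obtain ⟨d, hd, hdT⟩ := Finset.exists_apex hF h3 (M.card_eq T hT)
  obtain ⟨d', hd', hdT'⟩ := Finset.exists_apex hF' h3 (M.card_eq T' hT')
  have hopp := opposite hT hT' hne h h3 hd hdT hd' hdT'
  rw [mem_interior_iff_mem_nhds]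
  have e1 : ∀ᶠ w in nhds z, ∀ a ∈ F, 0 < l a w :=
    (Filter.eventually_all_finset F).2 fun a ha =>
      (h.continuous a).continuousAt.eventually (lt_mem_nhds (hpos a ha))
  have e2 : ∀ᶠ w in nhds z, ∀ a ∈ F, 0 < l' a w :=
    (Filter.eventually_all_finset F).2 fun a ha =>
      (h'.continuous a).continuousAt.eventually (lt_mem_nhds (by
        rw [h.face_coord_eq h' hF hF' hz ha]; exact hpos a ha))
  filter_upwards [e1, e2] with w hw hw'
  rcases le_or_gt 0 (l d w) with hl | hl
  · left
    rw [h.mem_hull, ← hdT]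
    intro a ha
    rcases Finset.mem_insert.1 ha with rfl | ha
    exacts [hl, (hw a ha).le]
  · right
    rw [h'.mem_hull, ← hdT']
    intro a ha
    rcases Finset.mem_insert.1 ha with rfl | ha
    · have := h.apex_rel h' hd hdT hd' hdT' w
      by_contra! hc
      have := mul_nonneg_of_nonpos_of_nonpos hc.le hopp.le
      linarith
    · exact (hw' a ha).le

/-- If, inside an open convex set `B`, each face of a family of elements is shared by two of
them, and `B` meets the interior of one of them, then the family covers `B`. -/
theorem cover_of_shared {B : Set E3} (hBo : IsOpen B) (hBc : Convex ℝ B) {E : Finset (Finset E3)}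
    (hE : E ⊆ M.elems) {T₀ : Finset E3} (hT₀ : T₀ ∈ E) {x₀ : E3} (hx₀B : x₀ ∈ B)
    (hx₀ : x₀ ∈ interior (convexHull ℝ (T₀ : Set E3)))
    (hsh : ∀ T ∈ E, ∀ F ⊆ T, F.card = 3 → (convexHull ℝ (F : Set E3) ∩ B).Nonempty →
      ∃ T' ∈ E, T' ≠ T ∧ F ⊆ T') : B ⊆ ⋃ T ∈ E, convexHull ℝ (T : Set E3) := by
  classical
  set U : Set E3 := ⋃ T ∈ E, convexHull ℝ (T : Set E3) with hU
  have hUc : IsClosed U := isClosed_biUnion_finset fun T _ => T.isClosed_hull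
  have hTU : ∀ T ∈ E, convexHull ℝ (T : Set E3) ⊆ U := fun T hT =>
    Set.subset_biUnion_of_mem (u := fun T : Finset E3 => convexHull ℝ (T : Set E3)) hT
  by_contra hnot
  obtain ⟨y₁, hy₁B, hy₁U⟩ := Set.not_subset.1 hnot
  have hVo : IsOpen (B ∩ Uᶜ) := hBo.inter hUc.isOpen_compl
  -- The target of the segment from `x₀` is chosen off the finitely many affine spans of `x₀` and an
  -- edge, a null set. The segment then meets no edge, except possibly at `x₀` itself.
  set edges : Finset (Finset E3) := E.biUnion fun T => T.powersetCard 2 with hedges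
  set N : Set E3 := ⋃ e ∈ edges, (affineSpan ℝ ((insert x₀ e : Finset E3) : Set E3) : Set E3)
  have hN : volume N = 0 := by
    refine (measure_biUnion_null_iff edges.countable_toSet).2 fun e he => ?_
    refine Measure.addHaar_affineSubspace volume _ fun htop => ?_
    obtain ⟨T, _, heT⟩ := Finset.mem_biUnion.1 he
    have hcard : e.card = 2 := (Finset.mem_powersetCard.1 heT).2
    have h1 : (insert x₀ e).card ≤ 3 := (Finset.card_insert_le _ _).trans (by omega)
    have h2 := finrank_vectorSpan_image_finset_le ℝ (id : E3 → E3) (insert x₀ e)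
      (n := (insert x₀ e).card - 1)
      (by have : 0 < (insert x₀ e).card := Finset.card_pos.2 ⟨x₀, by simp⟩
          omega)
    rw [Finset.image_id, ← direction_affineSpan, htop, AffineSubspace.direction_top,
      finrank_top] at h2
    simp at h2
    omega
  have hpos : 0 < volume (B ∩ Uᶜ) := hVo.measure_pos volume ⟨y₁, hy₁B, hy₁U⟩
  obtain ⟨y, ⟨hyB, hyU⟩, hyN⟩ : ∃ y ∈ B ∩ Uᶜ, y ∉ N := by
    by_contra! hall
    exact absurd (measure_mono_null hall hN) hpos.ne'
  -- A point of the segment in `U` is inside an element or in the relative interior of a shared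
  -- face, hence interior to `U`. So `U` is open and closed along the segment, which is connected.
  have key : ∀ z ∈ segment ℝ x₀ y, z ∈ U → z ∈ interior U := by
    intro z hz hzU
    have hzB : z ∈ B := hBc.segment_subset hx₀B hyB hz
    by_cases hzx : z = x₀
    · rw [hzx]; exact interior_mono (hTU T₀ hT₀) hx₀
    obtain ⟨T, hT, hzT⟩ := Set.mem_iUnion₂.1 hzU
    obtain ⟨l, g, h⟩ := exists_bary (hE hT)
    have hnn := h.mem_hull.1 hzT
    have hedge : ∀ e ⊆ T, e.card = 2 → z ∉ convexHull ℝ (e : Set E3) := by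
      intro e heT hc hze
      apply hyN
      refine Set.mem_iUnion₂.2 ⟨e, Finset.mem_biUnion.2
        ⟨T, hT, Finset.mem_powersetCard.2 ⟨heT, hc⟩⟩, ?_⟩
      have hz1 : z ∈ affineSpan ℝ ((insert x₀ e : Finset E3) : Set E3) :=
        affineSpan_mono ℝ (by simp) (convexHull_subset_affineSpan _ hze)
      have hx1 : x₀ ∈ affineSpan ℝ ((insert x₀ e : Finset E3) : Set E3) :=
        subset_affineSpan ℝ _ (by simp)
      rw [segment_eq_image'] at hz
      obtain ⟨t, _, htz⟩ := hz
      have ht : t ≠ 0 := by rintro rfl; apply hzx; simpa using htz.symm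
      have : y = AffineMap.lineMap x₀ z t⁻¹ := by
        rw [AffineMap.lineMap_apply, ← htz]
        simp [smul_smul, ht]
      rw [this]
      exact AffineMap.lineMap_mem _ hx1 hz1
    by_cases hall : ∀ a ∈ T, 0 < l a z
    · exact interior_mono (hTU T hT) (h.mem_interior hall)
    push Not at hall
    obtain ⟨d, hdT, hd0⟩ := hall
    have hd0 : l d z = 0 := le_antisymm hd0 (hnn d hdT)
    have h3 : (T.erase d).card = 3 := by
      rw [Finset.card_erase_of_mem hdT, M.card_eq T (hE hT)]
    have hposF : ∀ a ∈ T.erase d, 0 < l a z := by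
      intro a ha
      refine lt_of_le_of_ne (hnn a (Finset.mem_of_mem_erase ha)) fun h0 => ?_
      refine hedge ((T.erase d).erase a)
        ((Finset.erase_subset _ _).trans (Finset.erase_subset _ _))
        (by rw [Finset.card_erase_of_mem ha, h3]) ?_
      rw [h.mem_hull_iff ((Finset.erase_subset _ _).trans (Finset.erase_subset _ _))]
      refine ⟨fun b hb => hnn b (Finset.mem_of_mem_erase (Finset.mem_of_mem_erase hb)),
        fun b hb hbn => ?_⟩
      by_cases hba : b = a
      · rw [hba, ← h0]
      by_cases hbd : b = d
      · rw [hbd, hd0]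
      exact absurd (Finset.mem_erase.2 ⟨hba, Finset.mem_erase.2 ⟨hbd, hb⟩⟩) hbn
    have hzF : z ∈ convexHull ℝ ((T.erase d : Finset E3) : Set E3) := by
      rw [h.mem_hull_iff (Finset.erase_subset _ _)]
      refine ⟨fun a ha => (hposF a ha).le, fun b hb hbn => ?_⟩
      have : b = d := by
        by_contra hbd
        exact hbn (Finset.mem_erase.2 ⟨hbd, hb⟩)
      rw [this, hd0]
    obtain ⟨T', hT', hne, hF'⟩ := hsh T hT _ (Finset.erase_subset d T) h3 ⟨z, hzF, hzB⟩
    exact interior_mono (Set.union_subset (hTU T hT) (hTU T' hT'))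
      (mem_interior_of_shared (hE hT) (hE hT') hne.symm h h3 (Finset.erase_subset d T) hF' hzF
        hposF)
  have hconn : IsPreconnected (segment ℝ x₀ y) := (convex_segment x₀ y).isPreconnected
  obtain ⟨z, _, hz1, hz2⟩ := hconn (interior U) Uᶜ isOpen_interior hUc.isOpen_compl
    (fun z hz => by
      by_cases hzU : z ∈ U
      exacts [Or.inl (key z hz hzU), Or.inr hzU])
    ⟨x₀, left_mem_segment ℝ _ _, interior_mono (hTU T₀ hT₀) hx₀⟩
    ⟨y, right_mem_segment ℝ _ _, hyU⟩
  exact hz2 (interior_subset hz1)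

/-- A face that belongs to a single element lies on the boundary. -/
theorem isBdryFace_of_unshared {T F : Finset E3} (hT : T ∈ M.elems) (hF : F ⊆ T)
    (h3 : F.card = 3) (huniq : ∀ T' ∈ M.elems, F ⊆ T' → T' = T) : M.IsBdryFace F := by
  classical
  refine ⟨⟨h3, T, hT, hF⟩, ?_⟩
  obtain ⟨l, g, h⟩ := exists_bary hT
  obtain ⟨d, hd, hdT⟩ := Finset.exists_apex hF h3 (M.card_eq T hT)
  have hdm : d ∈ T := hdT ▸ Finset.mem_insert_self d F
  have hFne : F.Nonempty := Finset.card_pos.1 (by omega)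
  -- Near a relative interior point of `F` only `T` is present. Were the point interior to the
  -- union, it would be interior to `T`, where the apex coordinate is positive.
  have key : ∀ x ∈ convexHull ℝ (F : Set E3), (∀ a ∈ F, 0 < l a x) → x ∈ M.bdry := by
    intro x hx hpos
    have hxT : x ∈ convexHull ℝ (T : Set E3) := convexHull_mono (by exact_mod_cast hF) hx
    rw [bdry, polyhedron, frontier, Set.mem_sdiff, interior_interior]
    constructor
    · rw [← h.closure_interior] at hxT
      refine closure_mono (interior_mono ?_) hxT
      exact Set.subset_biUnion_of_mem (u := fun T : Finset E3 => convexHull ℝ (T : Set E3)) hT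
    · intro hxi
      have hcl : IsClosed (⋃ T' ∈ M.elems.erase T, convexHull ℝ (T' : Set E3)) :=
        isClosed_biUnion_finset fun T _ => T.isClosed_hull
      have hxn : x ∉ ⋃ T' ∈ M.elems.erase T, convexHull ℝ (T' : Set E3) := by
        intro hm
        obtain ⟨T', hT', hxT'⟩ := Set.mem_iUnion₂.1 hm
        have hT'' := Finset.mem_erase.1 hT'
        exact hT''.1 (huniq T' hT''.2 (subset_of_mem_relint hT hT''.2 h hF hxT hpos hxT'))
      have hxint : x ∈ interior (convexHull ℝ (T : Set E3)) := by
        rw [mem_interior_iff_mem_nhds] at hxi ⊢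
        filter_upwards [hxi, hcl.isOpen_compl.mem_nhds hxn] with w hw hwn
        obtain ⟨T', hT', hwT'⟩ := Set.mem_iUnion₂.1 hw
        by_cases hTT : T' = T
        · exact hTT ▸ hwT'
        · exact absurd (Set.mem_iUnion₂.2 ⟨T', Finset.mem_erase.2 ⟨hTT, hT'⟩, hwT'⟩) hwn
      have h1 := h.pos_of_mem_interior hxint hdm
        (h.grad_ne_zero (by rw [M.card_eq T hT]; omega) hdm)
      rw [((h.mem_hull_iff hF).1 hx).2 d hdm hd] at h1
      exact lt_irrefl _ h1
  intro x hx
  -- The other points of the face are limits of relative interior ones, and the boundary is closed.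
  set G := F.centroid ℝ id with hG
  have hGF : G ∈ convexHull ℝ (F : Set E3) := h.centroid_mem hF hFne
  have hcl : IsClosed M.bdry := isClosed_frontier
  have htend : Filter.Tendsto (fun t : ℝ => x + t • (G - x)) (nhdsWithin 0 (Set.Ioi 0))
      (nhds x) := by
    have : Continuous (fun t : ℝ => x + t • (G - x)) := by fun_prop
    have := this.tendsto 0
    simp only [zero_smul, add_zero] at this
    exact this.mono_left nhdsWithin_le_nhds
  refine hcl.mem_of_tendsto htend ?_
  filter_upwards [self_mem_nhdsWithin, nhdsWithin_le_nhds (gt_mem_nhds one_pos)] with t ht0 ht1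
  have ht0 : 0 < t := ht0
  refine key _ ((convex_convexHull ℝ (F : Set E3)).add_smul_sub_mem hx hGF ⟨ht0.le, ht1.le⟩)
    fun a ha => ?_
  rw [h.line]
  have h1 := h.centroid_pos hF ha
  have h2 := ((h.mem_hull_iff hF).1 hx).1 a ha
  have h4 : 0 ≤ 1 - t := by linarith
  have : 0 < t * l a G := mul_pos ht0 h1
  have := mul_nonneg h4 h2
  linarith

/-- At most two elements share a face. -/
theorem face_shared_le_two {T₁ T₂ T₃ F : Finset E3} (h1 : T₁ ∈ M.elems) (h2 : T₂ ∈ M.elems)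
    (h3 : T₃ ∈ M.elems) (h12 : T₁ ≠ T₂) (h13 : T₁ ≠ T₃) (h23 : T₂ ≠ T₃) (hF : F.card = 3)
    (hF1 : F ⊆ T₁) (hF2 : F ⊆ T₂) (hF3 : F ⊆ T₃) : False := by
  obtain ⟨l, g, h⟩ := exists_bary h1
  obtain ⟨l', g', h'⟩ := exists_bary h2
  obtain ⟨d, hd, hdT⟩ := Finset.exists_apex hF1 hF (M.card_eq _ h1)
  obtain ⟨d', hd', hdT'⟩ := Finset.exists_apex hF2 hF (M.card_eq _ h2)
  obtain ⟨d₃, hd₃, hdT₃⟩ := Finset.exists_apex hF3 hF (M.card_eq _ h3)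
  have a1 := opposite h1 h2 h12 h hF hd hdT hd' hdT'
  have a2 := opposite h1 h3 h13 h hF hd hdT hd₃ hdT₃
  have a3 := opposite h2 h3 h23 h' hF hd' hdT' hd₃ hdT₃
  -- The plane of `F` has only two sides: `d₃` beyond `F` as seen from `d'`, and `d'` as seen from
  -- `d`, puts `d₃` on the side of `d`.
  rw [h.apex_rel h' hd hdT hd' hdT' d₃] at a2
  linarith [mul_pos_of_neg_of_neg a3 a1]

end TetMesh

namespace TetMesh

variable {M : TetMesh}

/-- A nonempty family of elements has a face belonging to only one element of the family. -/
theorem exists_unshared {E : Finset (Finset E3)} (hE : E ⊆ M.elems) (hne : E.Nonempty) :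
    ∃ T ∈ E, ∃ F ⊆ T, F.card = 3 ∧ ∀ T' ∈ E, F ⊆ T' → T' = T := by
  by_contra! hcon
  obtain ⟨T₀, hT₀⟩ := hne
  obtain ⟨l, g, h⟩ := exists_bary (hE hT₀)
  obtain ⟨x₀, hx₀⟩ := h.interior_nonempty
  -- If every face were shared within the family, its union would be the whole space, which is not
  -- compact.
  have hcov := cover_of_shared (M := M) isOpen_univ convex_univ hE hT₀ (Set.mem_univ x₀) hx₀
    (fun T hT F hF h3 _ => by
      obtain ⟨T', hT', hFT', hne⟩ := hcon T hT F hF h3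
      exact ⟨T', hT', hne, hFT'⟩)
  have hb : IsCompact (⋃ T ∈ E, convexHull ℝ (T : Set E3)) :=
    E.isCompact_biUnion fun T _ => T.finite_toSet.isCompact_convexHull (𝕜 := ℝ)
  exact noncompact_univ E3 (by rwa [Set.univ_subset_iff.1 hcov] at hb)

/-- An edge on the boundary belongs to a boundary face that lies in a single element. -/
theorem exists_unshared_at_edge {e : Finset E3} (he : M.IsBdryEdge e) :
    ∃ T ∈ M.elems, ∃ c ∈ T, e ⊆ T ∧ c ∉ e ∧ ∀ T' ∈ M.elems, insert c e ⊆ T' → T' = T := by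
  classical
  obtain ⟨⟨he2, T₀, hT₀, heT₀⟩, hbd⟩ := he
  by_contra! hcon
  have hene : e.Nonempty := Finset.card_pos.1 (by omega)
  set m := e.centroid ℝ id with hm
  set E := M.elems.filter (e ⊆ ·) with hE
  have hEM : E ⊆ M.elems := Finset.filter_subset _ _
  -- Hulls of vertex sets not containing `e` avoid the mid-point `m`, hence a ball around it. In
  -- this ball only faces through `e` matter; if all were shared, the elements around `e` would fill
  -- the ball and `m` would be interior.
  set bad : Finset (Finset E3) := (M.elems.biUnion Finset.powerset).filter (¬ e ⊆ ·) with hbad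
  have hcl : IsClosed (⋃ S ∈ bad, convexHull ℝ (S : Set E3)) :=
    isClosed_biUnion_finset fun S _ => S.isClosed_hull
  have hmbad : m ∉ ⋃ S ∈ bad, convexHull ℝ (S : Set E3) := by
    intro hmem
    obtain ⟨S, hS, hmS⟩ := Set.mem_iUnion₂.1 hmem
    obtain ⟨hS1, hS2⟩ := Finset.mem_filter.1 hS
    obtain ⟨T, hT, hST⟩ := Finset.mem_biUnion.1 hS1
    rw [Finset.mem_powerset] at hST
    obtain ⟨l₀, g₀, h₀⟩ := exists_bary hT₀
    obtain ⟨l, g, h⟩ := exists_bary hT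
    have hme : m ∈ convexHull ℝ (e : Set E3) := h₀.centroid_mem heT₀ hene
    have heT : e ⊆ T := subset_of_mem_relint hT₀ hT h₀ heT₀
      (convexHull_mono (by exact_mod_cast heT₀) hme) (fun a ha => h₀.centroid_pos heT₀ ha)
      (convexHull_mono (by exact_mod_cast hST) hmS)
    apply hS2
    intro a ha
    by_contra haS
    have := ((h.mem_hull_iff hST).1 hmS).2 a (heT ha) haS
    linarith [h.centroid_pos heT ha]
  obtain ⟨r, hr, hball⟩ := Metric.isOpen_iff.1 hcl.isOpen_compl m hmbad
  obtain ⟨l₀, g₀, h₀⟩ := exists_bary hT₀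
  have hme : m ∈ convexHull ℝ (e : Set E3) := h₀.centroid_mem heT₀ hene
  have hmT₀ : m ∈ convexHull ℝ (T₀ : Set E3) := convexHull_mono (by exact_mod_cast heT₀) hme
  rw [← h₀.closure_interior] at hmT₀
  obtain ⟨x₀, hx₀, hdist⟩ := Metric.mem_closure_iff.1 hmT₀ r hr
  have hcov := cover_of_shared (M := M) (B := Metric.ball m r) Metric.isOpen_ball
    (convex_ball m r) hEM (Finset.mem_filter.2 ⟨hT₀, heT₀⟩)
    (by rw [Metric.mem_ball, dist_comm]; exact hdist) hx₀
    (fun T hT F hF h3 hFB => by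
      obtain ⟨hTM, heT⟩ := Finset.mem_filter.1 hT
      have heF : e ⊆ F := by
        by_contra hn
        obtain ⟨z, hzF, hzB⟩ := hFB
        refine hball hzB (Set.mem_iUnion₂.2 ⟨F, Finset.mem_filter.2
          ⟨Finset.mem_biUnion.2 ⟨T, hTM, Finset.mem_powerset.2 hF⟩, hn⟩, hzF⟩)
      obtain ⟨c, hc, hcF⟩ := Finset.exists_eq_insert_iff.2 ⟨heF, by omega⟩
      obtain ⟨T', hT', hcT', hne⟩ := hcon T hTM c (hF (hcF ▸ Finset.mem_insert_self c e)) heT hc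
      rw [hcF] at hcT'
      exact ⟨T', Finset.mem_filter.2 ⟨hT', heF.trans hcT'⟩, hne, hcT'⟩)
  have hint : m ∈ interior (⋃ T ∈ M.elems, convexHull ℝ (T : Set E3)) := by
    rw [mem_interior_iff_mem_nhds]
    filter_upwards [Metric.ball_mem_nhds m hr] with w hw
    obtain ⟨T, hT, hwT⟩ := Set.mem_iUnion₂.1 (hcov hw)
    exact Set.mem_iUnion₂.2 ⟨T, hEM hT, hwT⟩
  have := hbd hme
  rw [bdry, polyhedron, frontier, Set.mem_sdiff, interior_interior] at this
  exact this.2 hint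

/-- An edge on the boundary belongs to two different boundary faces. -/
theorem exists_two_bdryFaces {e : Finset E3} (he : M.IsBdryEdge e) :
    ∃ F F', M.IsBdryFace F ∧ M.IsBdryFace F' ∧ e ⊆ F ∧ e ⊆ F' ∧ F ≠ F' := by
  classical
  obtain ⟨T, hT, c, hcT, heT, hce, huniq⟩ := exists_unshared_at_edge he
  have he2 : e.card = 2 := he.1.1
  set E := M.elems.filter (e ⊆ ·) with hE
  have hTE : T ∈ E := Finset.mem_filter.2 ⟨hT, heT⟩
  set V := E.biUnion (fun T => T \ e) with hV
  have hcV : c ∈ V := Finset.mem_biUnion.2 ⟨T, hTE, Finset.mem_sdiff.2 ⟨hcT, hce⟩⟩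
  -- Parity: each element around `e` has two vertices off `e`, so the incidences number an even
  -- total. Each face `insert a e` counts once or twice, so exactly one simple face is impossible.
  have hcount := Finset.sum_card_bipartiteAbove_eq_sum_card_bipartiteBelow
    (s := E) (t := V) (fun (T : Finset E3) (c : E3) => c ∈ T)
  have habove : ∀ T' ∈ E, (V.bipartiteAbove (fun (T : Finset E3) (c : E3) => c ∈ T) T').card
      = 2 := by
    intro T' hT'
    have heq : V.bipartiteAbove (fun (T : Finset E3) (c : E3) => c ∈ T) T' = T' \ e := by
      ext a
      simp only [Finset.bipartiteAbove, Finset.mem_filter, Finset.mem_sdiff, hV,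
        Finset.mem_biUnion]
      constructor
      · rintro ⟨⟨T'', _, _, h2⟩, h3⟩; exact ⟨h3, h2⟩
      · rintro ⟨h1, h2⟩; exact ⟨⟨T', hT', h1, h2⟩, h1⟩
    obtain ⟨h1, h2⟩ := Finset.mem_filter.1 hT'
    rw [heq, Finset.card_sdiff_of_subset h2, M.card_eq T' h1, he2]
  rw [Finset.sum_congr rfl habove, Finset.sum_const, smul_eq_mul] at hcount
  set n : E3 → ℕ := fun a => (E.bipartiteBelow (fun (T : Finset E3) (c : E3) => c ∈ T) a).card
    with hn
  have hmem : ∀ a T', T' ∈ E.bipartiteBelow (fun (T : Finset E3) (c : E3) => c ∈ T) a ↔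
      (T' ∈ M.elems ∧ e ⊆ T') ∧ a ∈ T' := by
    intro a T'
    simp [Finset.bipartiteBelow, hE]
  have hnc : n c = 1 := by
    refine Finset.card_eq_one.2 ⟨T, ?_⟩
    ext T'
    rw [hmem, Finset.mem_singleton]
    constructor
    · rintro ⟨⟨h1, h2⟩, h3⟩
      exact huniq T' h1 (Finset.insert_subset h3 h2)
    · rintro rfl; exact ⟨⟨hT, heT⟩, hcT⟩
  have hVe : ∀ a ∈ V, a ∉ e := fun a ha => by
    obtain ⟨T', _, h⟩ := Finset.mem_biUnion.1 ha
    exact (Finset.mem_sdiff.1 h).2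
  have hle : ∀ a ∈ V, n a ≤ 2 := by
    intro a ha
    by_contra! hgt
    obtain ⟨T₁, h1, T₂, h2, T₃, h3, h12, h13, h23⟩ := Finset.two_lt_card.1 hgt
    rw [hmem] at h1 h2 h3
    exact face_shared_le_two (F := insert a e) h1.1.1 h2.1.1 h3.1.1 h12 h13 h23
      (by rw [Finset.card_insert_of_notMem (hVe a ha), he2])
      (Finset.insert_subset h1.2 h1.1.2) (Finset.insert_subset h2.2 h2.1.2)
      (Finset.insert_subset h3.2 h3.1.2)
  have hpos : ∀ a ∈ V, 1 ≤ n a := by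
    intro a ha
    obtain ⟨T', hT', h⟩ := Finset.mem_biUnion.1 ha
    exact Finset.card_pos.2 ⟨T', (hmem a T').2
      ⟨Finset.mem_filter.1 hT', (Finset.mem_sdiff.1 h).1⟩⟩
  obtain ⟨c', hc'V, hc'ne, hc'1⟩ : ∃ c' ∈ V, c' ≠ c ∧ n c' = 1 := by
    by_contra! hall
    have h2 : ∀ a ∈ V.erase c, n a = 2 := fun a ha => by
      obtain ⟨h1, h2⟩ := Finset.mem_erase.1 ha
      have := hall a h2 h1
      have := hle a h2
      have := hpos a h2
      omega
    have hs := Finset.add_sum_erase V n hcV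
    rw [Finset.sum_congr rfl h2, Finset.sum_const, smul_eq_mul, hnc] at hs
    have : E.card * 2 = ∑ a ∈ V, n a := hcount
    omega
  obtain ⟨T', hT'⟩ := Finset.card_eq_one.1 hc'1
  have hT'm := (hmem c' T').1 (hT' ▸ Finset.mem_singleton_self T')
  refine ⟨insert c e, insert c' e, isBdryFace_of_unshared hT (Finset.insert_subset hcT heT)
      (by rw [Finset.card_insert_of_notMem hce, he2]) huniq,
    isBdryFace_of_unshared hT'm.1.1 (Finset.insert_subset hT'm.2 hT'm.1.2)
      (by rw [Finset.card_insert_of_notMem (hVe c' hc'V), he2]) ?_,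
    Finset.subset_insert _ _, Finset.subset_insert _ _, ?_⟩
  · intro T'' hT'' hsub
    have : T'' ∈ E.bipartiteBelow (fun (T : Finset E3) (c : E3) => c ∈ T) c' :=
      (hmem c' T'').2 ⟨⟨hT'', (Finset.subset_insert _ _).trans hsub⟩,
        hsub (Finset.mem_insert_self _ _)⟩
    rw [hT'] at this
    exact Finset.mem_singleton.1 this
  · intro heq
    have : c' ∈ insert c e := heq ▸ Finset.mem_insert_self c' e
    rcases Finset.mem_insert.1 this with h | h
    exacts [hc'ne h, hVe c' hc'V h]

end TetMesh

/-! ### Uniform cone condition at a C¹ boundary -/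

/-- Near the boundary point `x`, the set `Ω` is separated from the complement of its closure by
the cone of directions almost orthogonal to the unit vector `ν`. -/
structure IsConeDir (Ω : Set E3) (η r : ℝ) (x ν : E3) : Prop where
  norm_eq : ‖ν‖ = 1
  outside : ∀ y, dist y x < r → η * ‖y - x‖ < inner ℝ ν (y - x) → y ∉ closure Ω
  inside : ∀ y, dist y x < r → inner ℝ ν (y - x) < -(η * ‖y - x‖) → y ∈ Ω

theorem IsC1Domain.isCompact_frontier {Ω : Set E3} (hΩ : IsC1Domain Ω) :
    IsCompact (frontier Ω) :=
  Metric.isCompact_of_isClosed_isBounded isClosed_frontier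
    (hΩ.isBounded.closure.subset frontier_subset_closure)

/-- Strict differentiability at `x₀` controls `φ y - φ x` for both points near `x₀`, with error `η *
‖G‖ * ‖y - x‖`, where `G` is the gradient at `x₀`. So the one normal `G / ‖G‖` serves all boundary
points nearby, and a Lebesgue number makes the radius uniform. -/
theorem IsC1Domain.exists_isConeDir {Ω : Set E3} (hΩ : IsC1Domain Ω) {η : ℝ} (hη : 0 < η) :
    ∃ r > 0, ∀ x ∈ frontier Ω, ∃ ν, IsConeDir Ω η r x ν := by
  have hloc : ∀ x₀ : frontier Ω, ∃ (ρ : ℝ) (ν : E3), 0 < ρ ∧ ‖ν‖ = 1 ∧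
      ∀ x ∈ frontier Ω, dist x (x₀ : E3) < ρ → ∀ y, dist y (x₀ : E3) < ρ →
        (η * ‖y - x‖ < inner ℝ ν (y - x) → y ∉ closure Ω) ∧
        (inner ℝ ν (y - x) < -(η * ‖y - x‖) → y ∈ Ω) := by
    rintro ⟨x₀, hx₀⟩
    obtain ⟨U, φ, hU, hxU, hφ, hne, hΩU⟩ := hΩ.boundary x₀ hx₀
    have hsd : HasStrictFDerivAt φ (fderiv ℝ φ x₀) x₀ :=
      (hφ.contDiffAt (hU.mem_nhds hxU)).hasStrictFDerivAt (by norm_num)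
    set G : E3 := (InnerProductSpace.toDual ℝ E3).symm (fderiv ℝ φ x₀) with hG
    have hGapp : ∀ v, fderiv ℝ φ x₀ v = inner ℝ G v := fun v => by
      rw [hG, InnerProductSpace.toDual_symm_apply]
    have hG0 : 0 < ‖G‖ := by
      rw [hG, LinearIsometryEquiv.norm_map]; exact norm_pos_iff.2 hne
    have hbd := hsd.isLittleO.def (mul_pos hη hG0)
    obtain ⟨ρ, hρ, hball⟩ := Metric.eventually_nhds_iff_ball.1
      (hbd.and ((hU.prod hU).mem_nhds (show (x₀, x₀) ∈ U ×ˢ U from ⟨hxU, hxU⟩)))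
    have hmem : ∀ y, dist y x₀ < ρ → y ∈ U := fun y hy =>
      ((hball (y, x₀) (by
        rw [Metric.mem_ball, Prod.dist_eq]; exact max_lt hy (by simpa using hρ))).2).1
    have hcont : ∀ y ∈ U, ContinuousAt φ y := fun y hy =>
      hφ.continuousOn.continuousAt (hU.mem_nhds hy)
    refine ⟨ρ, ‖G‖⁻¹ • G, hρ, by rw [norm_smul, norm_inv, norm_norm, inv_mul_cancel₀ hG0.ne'], ?_⟩
    intro x hx hxρ y hyρ
    have hφx : φ x = 0 := by
      have hxU' := hmem x hxρ
      apply le_antisymm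
      · by_contra! hpos
        have hev : ∀ᶠ z in nhds x, 0 < φ z ∧ z ∈ U :=
          ((hcont x hxU').eventually (lt_mem_nhds hpos)).and (hU.mem_nhds hxU')
        obtain ⟨z, ⟨hz1, hz2⟩, hz3⟩ :=
          mem_closure_iff_nhds.1 (frontier_subset_closure hx) _ hev
        have : z ∈ Ω ∩ U := ⟨hz3, hz2⟩
        rw [hΩU] at this
        exact absurd this.2 (not_lt.2 hz1.le)
      · by_contra! hneg
        have : x ∈ Ω ∩ U := by rw [hΩU]; exact ⟨hxU', hneg⟩
        rw [hΩ.isOpen.frontier_eq] at hx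
        exact hx.2 this.1
    have hy := (hball (y, x) (by rw [Metric.mem_ball, Prod.dist_eq]; exact max_lt hyρ hxρ)).1
    simp only [hφx, sub_zero, hGapp] at hy
    rw [Real.norm_eq_abs, abs_le] at hy
    have hin : inner ℝ (‖G‖⁻¹ • G) (y - x) = ‖G‖⁻¹ * inner ℝ G (y - x) := by
      rw [real_inner_smul_left]
    rw [hin]
    have hyU := hmem y hyρ
    constructor
    · intro hlt hcl
      rw [inv_mul_eq_div, lt_div_iff₀ hG0] at hlt
      have hpos : 0 < φ y := by nlinarith [hy.1]
      have hev : ∀ᶠ z in nhds y, 0 < φ z ∧ z ∈ U :=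
        ((hcont y hyU).eventually (lt_mem_nhds hpos)).and (hU.mem_nhds hyU)
      obtain ⟨z, ⟨hz1, hz2⟩, hz3⟩ := mem_closure_iff_nhds.1 hcl _ hev
      have : z ∈ Ω ∩ U := ⟨hz3, hz2⟩
      rw [hΩU] at this
      exact absurd this.2 (not_lt.2 hz1.le)
    · intro hlt
      rw [inv_mul_eq_div, div_lt_iff₀ hG0] at hlt
      have hneg : φ y < 0 := by nlinarith [hy.2]
      have : y ∈ Ω ∩ U := by rw [hΩU]; exact ⟨hyU, hneg⟩
      exact this.1
  choose ρ ν hρ hν hprop using hloc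
  obtain ⟨δ, hδ, hcov⟩ := lebesgue_number_lemma_of_metric 
    (c := fun i : frontier Ω => Metric.ball (i : E3) (ρ i))
    hΩ.isCompact_frontier (fun i => Metric.isOpen_ball)
    (fun x hx => Set.mem_iUnion.2 ⟨⟨x, hx⟩, Metric.mem_ball_self (hρ _)⟩)
  refine ⟨δ, hδ, fun x hx => ?_⟩
  obtain ⟨i, hi⟩ := hcov x hx
  have hxi : dist x (i : E3) < ρ i := hi (Metric.mem_ball_self hδ)
  exact ⟨ν i, hν i, fun y hy => (hprop i x hx hxi y (hi hy)).1,
    fun y hy => (hprop i x hx hxi y (hi hy)).2⟩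

namespace IsConeDir

variable {Ω : Set E3} {η r : ℝ} {x ν : E3}

theorem abs_inner_le (h : IsConeDir Ω η r x ν) (hΩ : IsOpen Ω) {y : E3} (hy : y ∈ frontier Ω)
    (hr : dist y x < r) : |inner ℝ ν (y - x)| ≤ η * ‖y - x‖ := by
  rw [abs_le]
  constructor
  · by_contra! hlt
    rw [hΩ.frontier_eq] at hy
    exact hy.2 (h.inside y hr hlt)
  · by_contra! hlt
    exact h.outside y hr hlt (frontier_subset_closure hy)

theorem inner_le (h : IsConeDir Ω η r x ν) {y : E3} (hy : y ∈ closure Ω)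
    (hr : dist y x < r) : inner ℝ ν (y - x) ≤ η * ‖y - x‖ := by
  by_contra! hlt
  exact h.outside y hr hlt hy

/-- At `± ε L` along `d` the gain `c ε L` beats `3 η L`: one `η L` for the height of `G`, and `2 η
L` for the cone at distance at most `2 L`. One end is outside and the other inside, so the segment
crosses the boundary. -/
theorem exists_mem_frontier_of_le (h : IsConeDir Ω η r x ν) (hΩ : IsOpen Ω) (hη : 0 ≤ η)
    {G d : E3} {L ε c : ℝ} (hd : ‖d‖ = 1) (hL : 0 < L) (hGx : ‖G - x‖ ≤ L)
    (hG : |inner ℝ ν (G - x)| ≤ η * L) (hε : 0 < ε) (hε1 : ε ≤ 1) (hLr : 2 * L < r)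
    (hc : c ≤ inner ℝ ν d) (hηc : 3 * η < c * ε) :
    ∃ s : ℝ, |s| ≤ ε * L ∧ G + s • d ∈ frontier Ω := by
  have hεL : 0 < ε * L := mul_pos hε hL
  have hnorm : ∀ s : ℝ, |s| ≤ ε * L → ‖G + s • d - x‖ ≤ 2 * L := by
    intro s hs
    have : G + s • d - x = (G - x) + s • d := by abel
    rw [this]
    have h1 := norm_add_le (G - x) (s • d)
    rw [norm_smul, hd, mul_one, Real.norm_eq_abs] at h1
    nlinarith
  have hinn : ∀ s : ℝ, inner ℝ ν (G + s • d - x) = inner ℝ ν (G - x) + s * inner ℝ ν d := by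
    intro s
    have : G + s • d - x = (G - x) + s • d := by abel
    rw [this, inner_add_right, inner_smul_right]
  rw [abs_le] at hG
  have hmul : 3 * η * L < inner ℝ ν d * (ε * L) := by
    have h1 : 3 * η * L < c * ε * L := mul_lt_mul_of_pos_right hηc hL
    have h2 : c * (ε * L) ≤ inner ℝ ν d * (ε * L) := mul_le_mul_of_nonneg_right hc hεL.le
    linarith
  have hp : G + (ε * L) • d ∉ closure Ω := by
    have hn := hnorm (ε * L) (by rw [abs_of_pos hεL])
    refine h.outside _ (by rw [dist_eq_norm]; linarith) ?_
    rw [hinn]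
    have := mul_le_mul_of_nonneg_left hn hη
    linarith [hG.1]
  have hm : G + (-(ε * L)) • d ∈ Ω := by
    have hn := hnorm (-(ε * L)) (by rw [abs_neg, abs_of_pos hεL])
    refine h.inside _ (by rw [dist_eq_norm]; linarith) ?_
    rw [hinn]
    have := mul_le_mul_of_nonneg_left hn hη
    linarith [hG.2]
  by_contra! hcon
  have hconn : IsPreconnected ((fun s : ℝ => G + s • d) '' Set.Icc (-(ε * L)) (ε * L)) :=
    isPreconnected_Icc.image _ (by fun_prop)
  obtain ⟨z, _, hz1, hz2⟩ := hconn Ω (closure Ω)ᶜ hΩ isClosed_closure.isOpen_compl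
    (by
      rintro _ ⟨s, hs, rfl⟩
      have := hcon s (abs_le.2 hs)
      rw [hΩ.frontier_eq] at this
      by_cases hz : G + s • d ∈ Ω
      · exact Or.inl hz
      · exact Or.inr fun hcl => this ⟨hcl, hz⟩)
    ⟨_, ⟨_, Set.left_mem_Icc.2 (by linarith), rfl⟩, hm⟩
    ⟨_, ⟨_, Set.right_mem_Icc.2 (by linarith), rfl⟩, hp⟩
  exact hz2 (subset_closure hz1)

theorem exists_mem_frontier (h : IsConeDir Ω η r x ν) (hΩ : IsOpen Ω) (hη : 0 ≤ η)
    {G d : E3} {L ε c : ℝ} (hd : ‖d‖ = 1) (hL : 0 < L) (hGx : ‖G - x‖ ≤ L)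
    (hG : |inner ℝ ν (G - x)| ≤ η * L) (hε : 0 < ε) (hε1 : ε ≤ 1) (hLr : 2 * L < r)
    (hc : c ≤ |inner ℝ ν d|) (hηc : 3 * η < c * ε) :
    ∃ s : ℝ, |s| ≤ ε * L ∧ G + s • d ∈ frontier Ω := by
  rcases abs_choice (inner ℝ ν d : ℝ) with hs | hs
  · exact h.exists_mem_frontier_of_le hΩ hη hd hL hGx hG hε hε1 hLr (hs ▸ hc) hηc
  · obtain ⟨s, hs1, hs2⟩ := h.exists_mem_frontier_of_le (d := -d) hΩ hη (by rwa [norm_neg]) hL hGx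
      hG hε hε1 hLr (by rw [inner_neg_right, ← hs]; exact hc) hηc
    exact ⟨-s, by rwa [abs_neg], by simpa using hs2⟩

end IsConeDir

/-! ### Linear geometry and the size of an element -/

theorem abs_inner_le_of_mem_hull {S : Finset E3} {ν a x : E3} {K : ℝ}
    (hx : x ∈ convexHull ℝ (S : Set E3)) (hS : ∀ b ∈ S, |inner ℝ ν (b - a)| ≤ K) :
    |inner ℝ ν (x - a)| ≤ K := by
  rw [Finset.mem_convexHull'] at hx
  obtain ⟨w, hw0, hw1, rfl⟩ := hx
  have : ∑ y ∈ S, w y • y - a = ∑ y ∈ S, w y • (y - a) := by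
    simp_rw [smul_sub, Finset.sum_sub_distrib, ← Finset.sum_smul, hw1, one_smul]
  rw [this, inner_sum]
  calc |∑ y ∈ S, inner ℝ ν (w y • (y - a))| ≤ ∑ y ∈ S, |inner ℝ ν (w y • (y - a))| :=
        Finset.abs_sum_le_sum_abs _ _
    _ ≤ ∑ y ∈ S, w y * K := Finset.sum_le_sum fun y hy => by
        rw [inner_smul_right, abs_mul, abs_of_nonneg (hw0 y hy)]
        exact mul_le_mul_of_nonneg_left (hS y hy) (hw0 y hy)
    _ = K := by rw [← Finset.sum_mul, hw1, one_mul]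

theorem exists_unit_orthogonal (u v : E3) :
    ∃ d : E3, ‖d‖ = 1 ∧ inner ℝ u d = 0 ∧ inner ℝ v d = 0 := by
  classical
  set S : Submodule ℝ E3 := Submodule.span ℝ (({u, v} : Finset E3) : Set E3) with hS
  have h1 : Module.finrank ℝ S ≤ 2 :=
    (finrank_span_finset_le_card _).trans Finset.card_le_two
  have h2 := S.finrank_add_finrank_orthogonal
  rw [finrank_euclideanSpace, Fintype.card_fin] at h2
  have h3 : Sᗮ ≠ ⊥ := by
    intro h
    rw [h, finrank_bot] at h2
    omega
  obtain ⟨w, hw, hw0⟩ := Submodule.exists_mem_ne_zero_of_ne_bot h3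
  have hwu : inner ℝ u w = 0 := (Submodule.mem_orthogonal S w).1 hw u
    (Submodule.subset_span (by simp))
  have hwv : inner ℝ v w = 0 := (Submodule.mem_orthogonal S w).1 hw v
    (Submodule.subset_span (by simp))
  refine ⟨‖w‖⁻¹ • w, ?_, by rw [inner_smul_right, hwu, mul_zero],
    by rw [inner_smul_right, hwv, mul_zero]⟩
  rw [norm_smul, norm_inv, norm_norm, inv_mul_cancel₀ (norm_ne_zero_iff.2 hw0)]

/-- In three dimensions, a unit vector almost orthogonal to `τ` and to `q ⟂ τ` is far from being
orthogonal to `d`, where `d ⟂ τ, n` and `n ⟂ τ` makes a small angle with `q`. -/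
theorem cos_div_four_le {τ n d ν q : E3} {C : ℝ} (hτ : ‖τ‖ = 1) (hn : ‖n‖ = 1) (hd : ‖d‖ = 1)
    (hν : ‖ν‖ = 1) (hq : ‖q‖ = 1) (hτn : inner ℝ τ n = 0) (hτd : inner ℝ τ d = 0)
    (hnd : inner ℝ n d = 0) (hτq : inner ℝ τ q = 0) (hC0 : 0 < C)
    (hC : C ≤ |inner ℝ n q|) (hντ : |inner ℝ ν τ| ≤ 1 / 2) (hνq : |inner ℝ ν q| ≤ C / 4) :
    C / 4 ≤ |inner ℝ ν d| := by
  have ho : Orthonormal ℝ ![τ, n, d] := by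
    constructor
    · intro i; fin_cases i <;> simp [hτ, hn, hd]
    · intro i j hij
      have h1 := hτn; have h2 := hτd; have h3 := hnd
      rw [real_inner_comm] at h1 h2 h3
      fin_cases i <;> fin_cases j <;> simp_all
  have hcard : Fintype.card (Fin 3) = Module.finrank ℝ E3 := by simp
  let b := (basisOfOrthonormalOfCardEqFinrank ho hcard).toOrthonormalBasis (by simpa using ho)
  have hb : ∀ i, b i = ![τ, n, d] i := fun i => by simp [b]
  have e1 := b.sum_inner_mul_inner ν q
  have e2 := b.sum_inner_mul_inner ν ν
  have e3 := b.sum_inner_mul_inner q q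
  rw [Fin.sum_univ_three] at e1 e2 e3
  simp only [hb, Matrix.cons_val_zero, Matrix.cons_val_one, Matrix.cons_val] at e1 e2 e3
  rw [real_inner_self_eq_norm_sq, hν, real_inner_comm ν τ, real_inner_comm ν n,
    real_inner_comm ν d] at e2
  rw [real_inner_self_eq_norm_sq, hq, real_inner_comm τ q, real_inner_comm n q,
    real_inner_comm d q, hτq] at e3
  rw [hτq] at e1
  -- If `|⟨ν, d⟩| < C / 4`, the expansion of `⟨ν, q⟩` gives `|⟨ν, n⟩| < 1 / 2`. The squared
  -- components of the unit vector `ν` then sum to less than 1/4 + 1/4 + 1/16.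
  by_contra! hlt
  have hC1 : C ≤ 1 := hC.trans (by
    have := abs_real_inner_le_norm n q
    rwa [hn, hq, one_mul] at this)
  have hQ : |inner ℝ d q| ≤ 1 := by
    have := abs_real_inner_le_norm d q
    rwa [hd, hq, one_mul] at this
  have hY : |inner ℝ ν n| < 1 / 2 := by
    have h1 : |inner ℝ ν n| * |inner ℝ n q| ≤ C / 4 + |inner ℝ ν d| := by
      rw [← abs_mul, show inner ℝ ν n * inner ℝ n q = inner ℝ ν q - inner ℝ ν d * inner ℝ d q by
        linarith]
      refine (abs_sub _ _).trans (add_le_add hνq ?_)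
      rw [abs_mul]
      exact mul_le_of_le_one_right (abs_nonneg _) hQ
    have h2 := mul_le_mul_of_nonneg_left hC (abs_nonneg (inner ℝ ν n : ℝ))
    by_contra! h3
    nlinarith
  have s1 := (sq_le_sq₀ (abs_nonneg _) (by norm_num)).2 hντ
  have s2 := (sq_lt_sq₀ (abs_nonneg _) (by norm_num)).2 hY
  have s3 := (sq_lt_sq₀ (abs_nonneg _) (by norm_num)).2 (hlt.trans_le
    (show C / 4 ≤ 1 / 4 by linarith))
  rw [sq_abs] at s1 s2 s3
  nlinarith

/-- Size `H` and shape regularity `σ` of an element, in terms of barycentric gradients. -/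
structure IsSized (T : Finset E3) (g : E3 → E3) (σ H : ℝ) : Prop where
  pos : 0 < H
  grad : ∀ a ∈ T, ‖g a‖ * H ≤ σ
  dist : ∀ a ∈ T, ∀ b ∈ T, ‖a - b‖ ≤ H

theorem Finset.isBounded_hull (S : Finset E3) : Bornology.IsBounded (convexHull ℝ (S : Set E3)) :=
  (S.finite_toSet.isCompact_convexHull (𝕜 := ℝ)).isBounded

theorem TetMesh.ShapeRegular.isSized {M : TetMesh} {σ : ℝ} (hσ : M.ShapeRegular σ) {T : Finset E3}
    (hT : T ∈ M.elems) {l g} (h : IsBary T l g) :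
    IsSized T g σ (Metric.diam (convexHull ℝ (T : Set E3))) := by
  obtain ⟨c, r, hr, hball, hdiam⟩ := hσ T hT
  have hd : ∀ a ∈ T, ∀ b ∈ T, ‖a - b‖ ≤ Metric.diam (convexHull ℝ (T : Set E3)) := by
    intro a ha b hb
    rw [← dist_eq_norm]
    exact Metric.dist_le_diam_of_mem T.isBounded_hull (subset_convexHull ℝ _ ha)
      (subset_convexHull ℝ _ hb)
  refine ⟨?_, fun a ha => ?_, hd⟩
  · obtain ⟨a, ha, b, hb, hne⟩ := Finset.one_lt_card.1
      (show 1 < T.card by rw [M.card_eq T hT]; norm_num)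
    exact (norm_pos_iff.2 (sub_ne_zero.2 hne)).trans_le (hd a ha b hb)
  · have h1 := h.norm_grad_le ha hr hball
    have h2 := mul_le_mul_of_nonneg_left hdiam (norm_nonneg (g a))
    have hσ0 : 0 ≤ σ := by
      by_contra! hneg
      have : σ * (2 * r) < 0 := mul_neg_of_neg_of_pos hneg (by linarith)
      linarith [Metric.diam_nonneg (s := convexHull ℝ (T : Set E3))]
    nlinarith

/-! ### Elements with a face on the boundary -/

namespace IsBary

variable {T F : Finset E3} {l : E3 → E3 → ℝ} {g : E3 → E3} {σ H : ℝ} {d : E3}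

theorem grad_inner_span (h : IsBary T l g) (hd : d ∉ F) (hdT : insert d F = T) {p : E3}
    (hp : p ∈ vectorSpan ℝ (F : Set E3)) : inner ℝ (g d) p = 0 := by
  have hle : vectorSpan ℝ (F : Set E3) ≤ (ℝ ∙ g d)ᗮ := by
    rw [vectorSpan_def, Submodule.span_le]
    rintro _ ⟨a, ha, b, hb, rfl⟩
    have hF : ∀ a ∈ F, l d a = 0 := fun a ha =>
      h.ne d (hdT ▸ Finset.mem_insert_self d F) a (hdT ▸ Finset.mem_insert_of_mem ha)
        (fun e => hd (e ▸ ha))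
    rw [SetLike.mem_coe, Submodule.mem_orthogonal_singleton_iff_inner_right]
    change inner ℝ (g d) (a - b) = 0
    rw [h.inner_sub, hF a ha, hF b hb, sub_zero]
  exact (Submodule.mem_orthogonal_singleton_iff_inner_right).1 (hle hp)

/-- Passes from heights at the vertices, which the cone condition controls, to arbitrary directions.
-/
theorem inner_eq_sum (h : IsBary T l g) (u v b : E3) :
    inner ℝ v u = ∑ a ∈ T, inner ℝ (g a) u * inner ℝ v (a - b) := by
  conv_lhs => rw [h.vector_eq u b]
  rw [inner_sum]
  simp_rw [inner_smul_right]

theorem abs_grad_inner_le (hs : IsSized T g σ H) {a : E3} (ha : a ∈ T) (u : E3) :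
    |inner ℝ (g a) u| * H ≤ σ * ‖u‖ := by
  have h1 := abs_real_inner_le_norm (g a) u
  have h2 := mul_le_mul_of_nonneg_right h1 hs.pos.le
  have h3 := mul_le_mul_of_nonneg_right (hs.grad a ha) (norm_nonneg u)
  nlinarith

variable {Ω : Set E3} {η r : ℝ} {a₀ ν : E3}

/-- The size cancels: gradients are at most `σ / H` and heights at most `η * H`, for three vertices.
-/
theorem sum_face_le (hs : IsSized T g σ H) (hF : F ⊆ T) (h3 : F.card = 3) {u : E3}
    (hη : 0 ≤ η) (hflat : ∀ a ∈ F, |inner ℝ ν (a - a₀)| ≤ η * ‖a - a₀‖) (ha₀ : a₀ ∈ F) :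
    |∑ a ∈ F, inner ℝ (g a) u * inner ℝ ν (a - a₀)| ≤ 3 * σ * η * ‖u‖ := by
  refine (Finset.abs_sum_le_sum_abs _ _).trans ?_
  have : ∀ a ∈ F, |inner ℝ (g a) u * inner ℝ ν (a - a₀)| ≤ σ * η * ‖u‖ := by
    intro a ha
    rw [abs_mul]
    have h1 := abs_grad_inner_le hs (hF ha) u
    have h2 := (hflat a ha).trans (mul_le_mul_of_nonneg_left (hs.dist a (hF ha) a₀ (hF ha₀)) hη)
    calc |inner ℝ (g a) u| * |inner ℝ ν (a - a₀)| ≤ |inner ℝ (g a) u| * (η * H) :=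
          mul_le_mul_of_nonneg_left h2 (abs_nonneg _)
      _ = η * (|inner ℝ (g a) u| * H) := by ring
      _ ≤ η * (σ * ‖u‖) := mul_le_mul_of_nonneg_left h1 hη
      _ = _ := by ring
  refine (Finset.sum_le_sum this).trans ?_
  rw [Finset.sum_const, h3, nsmul_eq_mul]
  push_cast
  linarith

/-- Vectors in a boundary face are almost tangent. -/
theorem abs_inner_span_le (h : IsBary T l g) (hs : IsSized T g σ H) (h3 : F.card = 3)
    (hd : d ∉ F) (hdT : insert d F = T) (hη : 0 ≤ η)
    (hflat : ∀ a ∈ F, |inner ℝ ν (a - a₀)| ≤ η * ‖a - a₀‖) (ha₀ : a₀ ∈ F) {p : E3}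
    (hp : p ∈ vectorSpan ℝ (F : Set E3)) : |inner ℝ ν p| ≤ 3 * σ * η * ‖p‖ := by
  rw [h.inner_eq_sum p ν a₀, ← hdT, Finset.sum_insert hd, h.grad_inner_span hd hdT hp, zero_mul,
    zero_add]
  exact sum_face_le hs (hdT ▸ Finset.subset_insert d F) h3 hη hflat ha₀

/-- An element with a boundary face lies on the inner side of that face. -/
theorem grad_apex_inner_le (h : IsBary T l g) (hs : IsSized T g σ H) (h3 : F.card = 3)
    (hd : d ∉ F) (hdT : insert d F = T) (hη : 0 ≤ η) (hση : 6 * σ * η ≤ 1) (hν : ‖ν‖ = 1)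
    (hflat : ∀ a ∈ F, |inner ℝ ν (a - a₀)| ≤ η * ‖a - a₀‖) (ha₀ : a₀ ∈ F)
    (hin : inner ℝ ν (d - a₀) ≤ η * ‖d - a₀‖) : inner ℝ (g d) ν * H ≤ -(1 / 2) := by
  have hdm : d ∈ T := hdT ▸ Finset.mem_insert_self d F
  have hF : F ⊆ T := hdT ▸ Finset.subset_insert d F
  have h1 := h.inner_eq_sum ν ν a₀
  rw [← hdT, Finset.sum_insert hd, real_inner_self_eq_norm_sq, hν] at h1
  have h2 := sum_face_le (u := ν) hs hF h3 hη hflat ha₀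
  rw [hν, mul_one] at h2
  have h2' := (abs_le.1 h2).2
  have hdist := hs.dist d hdm a₀ (hF ha₀)
  set X := (inner ℝ (g d) ν : ℝ)
  set Y := (inner ℝ ν (d - a₀) : ℝ)
  -- In the expansion of `⟨ν, ν⟩ = 1` the face contributes at most 1/2, so the apex must supply the
  -- rest. Its height `Y` cannot be nonnegative, since it would then be at most `η * H`; thus both
  -- factors are negative, and `|Y| ≤ H` bounds `X`.
  have hXY : 1 / 2 ≤ X * Y := by nlinarith
  have hX := abs_grad_inner_le hs hdm ν
  rw [hν, mul_one] at hX
  have hYa : |Y| ≤ H := by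
    have := abs_real_inner_le_norm ν (d - a₀)
    rw [hν, one_mul] at this
    exact this.trans hdist
  have hYneg : Y < 0 := by
    by_contra! hY
    have hYη : Y ≤ η * H := hin.trans (mul_le_mul_of_nonneg_left hdist hη)
    have : X * Y ≤ |X| * (η * H) :=
      (mul_le_mul_of_nonneg_right (le_abs_self X) hY).trans
        (mul_le_mul_of_nonneg_left hYη (abs_nonneg X))
    have : η * (|X| * H) ≤ η * σ := mul_le_mul_of_nonneg_left hX hη
    nlinarith
  have hXneg : X < 0 := by
    by_contra! hX0
    have := mul_nonpos_of_nonneg_of_nonpos hX0 hYneg.le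
    linarith
  have := (abs_le.1 hYa).1
  nlinarith

/-- In the expansion of `⟨p, p⟩ = 1` only the vertex `c` survives, because `p` is orthogonal to `g
d` and to `e`; and the height of `c` over `e` is at most `H`. -/
theorem conormal_grad (h : IsBary T l g) (hs : IsSized T g σ H) {e : Finset E3} {c p : E3}
    (hd : d ∉ F) (hdT : insert d F = T) (hc : c ∉ e) (hcF : insert c e = F)
    (ha₀ : a₀ ∈ e) (hp : IsConormal e F p) : 1 ≤ inner ℝ (g c) p * H := by
  obtain ⟨hp1, hp2, hp3, hp4⟩ := hp
  have hcm : c ∈ F := hcF ▸ Finset.mem_insert_self c e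
  have heF : e ⊆ F := hcF ▸ Finset.subset_insert c e
  have hF : F ⊆ T := hdT ▸ Finset.subset_insert d F
  have h1 := h.inner_eq_sum p p a₀
  rw [← hdT, Finset.sum_insert hd, h.grad_inner_span hd hdT hp1, zero_mul, zero_add, ← hcF,
    Finset.sum_insert hc, real_inner_self_eq_norm_sq, hp2, Finset.sum_eq_zero (s := e), add_zero]
    at h1
  · have h2 := hp4 c hcm hc a₀ ha₀
    rw [real_inner_comm] at h2
    have h4 := abs_real_inner_le_norm p (c - a₀)
    rw [hp2, one_mul] at h4
    have h5 := (le_abs_self _).trans (h4.trans (hs.dist c (hF hcm) a₀ (hF (heF ha₀))))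
    have hpos : 0 < inner ℝ (g c) p := by
      by_contra! hn
      have := mul_nonpos_of_nonpos_of_nonneg hn h2.le
      linarith
    have := mul_le_mul_of_nonneg_left h5 hpos.le
    linarith
  · intro a ha
    rw [real_inner_comm (a - a₀) p, hp3 a ha a₀ ha₀, mul_zero]

/-- Both elements meeting at a fold contain points in direction `p₀ - ν / (4 σ)` from the edge. -/
theorem wedge_pos (h : IsBary T l g) (hs : IsSized T g σ H) {e : Finset E3} {c p p₀ : E3}
    (h3 : F.card = 3) (hd : d ∉ F) (hdT : insert d F = T) (hc : c ∉ e) (hcF : insert c e = F)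
    (hη : 0 ≤ η) (hσ : 1 ≤ σ) (hση : 6 * σ * η ≤ 1) (hν : ‖ν‖ = 1)
    (hflat : ∀ a ∈ F, |inner ℝ ν (a - a₀)| ≤ η * ‖a - a₀‖) (ha₀ : a₀ ∈ e)
    (hin : inner ℝ ν (d - a₀) ≤ η * ‖d - a₀‖) (hp : IsConormal e F p)
    (hpp : 8 * σ ^ 2 * ‖p - p₀‖ < 1) :
    0 < inner ℝ (g d) (p₀ - (1 / (4 * σ)) • ν) ∧ 0 < inner ℝ (g c) (p₀ - (1 / (4 * σ)) • ν) := by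
  have hcm : c ∈ F := hcF ▸ Finset.mem_insert_self c e
  have heF : e ⊆ F := hcF ▸ Finset.subset_insert c e
  have hF : F ⊆ T := hdT ▸ Finset.subset_insert d F
  have hdm : d ∈ T := hdT ▸ Finset.mem_insert_self d F
  have hu : p₀ - (1 / (4 * σ)) • ν = p - (p - p₀) - (1 / (4 * σ)) • ν := by abel
  have hσ0 : 0 < σ := by linarith
  -- Scaled by `H`, the apex coordinate gains at least `1 / (8 σ)` from the shift along `-ν` and
  -- nothing from `p`; the coordinate of `c` gains at least 1 from `p` and loses at most 1/4. The
  -- change from `p` to `p₀` costs less than `1 / (8 σ)` in either case.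
  have hdist : σ * ‖p - p₀‖ < 1 / (8 * σ) := by
    rw [lt_div_iff₀ (by positivity)]; nlinarith
  have h18 : 1 / (8 * σ) ≤ 1 / 8 := by
    apply one_div_le_one_div_of_le <;> linarith
  rw [hu]
  simp only [inner_smul_right, inner_sub_right]
  have key : ∀ x : ℝ, 0 < x * H → 0 < x := fun x hx => (pos_iff_pos_of_mul_pos hx).2 hs.pos
  constructor
  · apply key
    have h1 := h.grad_apex_inner_le hs h3 hd hdT hη hση hν hflat (heF ha₀) hin
    have h2 := (abs_grad_inner_le hs hdm (p - p₀))
    have h2' := mul_le_mul_of_nonneg_right (le_abs_self (inner ℝ (g d) (p - p₀) : ℝ)) hs.pos.le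
    rw [inner_sub_right] at h2 h2'
    rw [h.grad_inner_span hd hdT hp.1] at h2 h2' ⊢
    have h4 : 1 / (4 * σ) * (inner ℝ (g d) ν * H) ≤ 1 / (4 * σ) * (-(1 / 2)) :=
      mul_le_mul_of_nonneg_left h1 (by positivity)
    have h5 : 1 / (4 * σ) * (-(1 / 2)) = -(1 / (8 * σ)) := by field_simp; norm_num
    nlinarith
  · apply key
    have h1 := h.conormal_grad hs hd hdT hc hcF ha₀ hp
    have h2 := (abs_grad_inner_le hs (hF hcm) (p - p₀))
    have h2' := mul_le_mul_of_nonneg_right (le_abs_self (inner ℝ (g c) (p - p₀) : ℝ)) hs.pos.le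
    rw [inner_sub_right] at h2 h2'
    have h3 := (abs_grad_inner_le hs (hF hcm) ν)
    have h3' := mul_le_mul_of_nonneg_right (le_abs_self (inner ℝ (g c) ν : ℝ)) hs.pos.le
    rw [hν, mul_one] at h3
    have h4 : 1 / (4 * σ) * (inner ℝ (g c) ν * H) ≤ 1 / (4 * σ) * σ :=
      mul_le_mul_of_nonneg_left (h3'.trans h3) (by positivity)
    have h5 : 1 / (4 * σ) * σ = 1 / 4 := by field_simp
    nlinarith

end IsBary

theorem exists_isConormal {e F : Finset E3} {c a b : E3} (hab : a ≠ b) (he : e = {a, b})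
    (hcF : F = insert c e) (hspan : c - a ∉ Submodule.span ℝ {b - a}) :
    ∃ p, IsConormal e F p := by
  set S := Submodule.span ℝ {b - a} with hS
  set q : E3 := (c - a) - S.starProjection (c - a) with hq
  have hq0 : q ≠ 0 := by
    intro h0
    apply hspan
    rw [sub_eq_zero.1 h0]
    exact Submodule.starProjection_apply_mem _ _
  have hqS : q ∈ Sᗮ := Submodule.sub_starProjection_mem_orthogonal _
  have hqb : inner ℝ (b - a) q = 0 :=
    (Submodule.mem_orthogonal S q).1 hqS _ (Submodule.mem_span_singleton_self _)
  have hqc : inner ℝ (c - a) q = ‖q‖ ^ 2 := by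
    have h1 : inner ℝ (S.starProjection (c - a)) q = 0 :=
      (Submodule.mem_orthogonal S q).1 hqS _ (Submodule.starProjection_apply_mem _ _)
    rw [← real_inner_self_eq_norm_sq]
    conv_rhs => rw [hq, ← hq, inner_sub_left, h1, sub_zero]
  have hn : 0 < ‖q‖ := norm_pos_iff.2 hq0
  have ham : a ∈ F := by simp [hcF, he]
  have hbm : b ∈ F := by simp [hcF, he]
  have hcm : c ∈ F := by simp [hcF]
  refine ⟨‖q‖⁻¹ • q, ?_, by rw [norm_smul, norm_inv, norm_norm, inv_mul_cancel₀ hn.ne'], ?_, ?_⟩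
  · apply Submodule.smul_mem
    apply Submodule.sub_mem
    · exact vsub_mem_vectorSpan ℝ (by exact_mod_cast hcm) (by exact_mod_cast ham)
    · refine (Submodule.span_le.2 ?_) (Submodule.starProjection_apply_mem S (c - a))
      rw [Set.singleton_subset_iff]
      exact vsub_mem_vectorSpan ℝ (by exact_mod_cast hbm) (by exact_mod_cast ham)
  · intro x hx y hy
    rw [inner_smul_right]
    have hqb' : inner ℝ (a - b) q = 0 := by rw [← neg_sub, inner_neg_left, hqb, neg_zero]
    rw [he, Finset.mem_insert, Finset.mem_singleton] at hx hy
    rcases hx with rfl | rfl <;> rcases hy with rfl | rfl <;> simp [hqb, hqb']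
  · intro x hx hxe y hy
    rw [hcF, Finset.mem_insert] at hx
    obtain rfl : x = c := hx.resolve_right hxe
    rw [inner_smul_right]
    rw [he, Finset.mem_insert, Finset.mem_singleton] at hy
    have : inner ℝ (x - y) q = ‖q‖ ^ 2 := by
      rcases hy with rfl | rfl
      · exact hqc
      · rw [show x - y = (x - a) - (y - a) by abel, inner_sub_left, hqc, hqb, sub_zero]
    rw [this]
    positivity

/-! ### Existence of nodes near centroids and mid-points -/

namespace TetMesh

variable {M : TetMesh} {Ω : Set E3} {σ η r : ℝ}

theorem diam_le_meshSize {T : Finset E3} (hT : T ∈ M.elems) :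
    Metric.diam (convexHull ℝ (T : Set E3)) ≤ M.meshSize :=
  le_ciSup (f := fun T : M.elems => Metric.diam (convexHull ℝ (T.1 : Set E3)))
    (Set.finite_range _).bddAbove ⟨T, hT⟩

theorem Fits.mem_frontier (hfit : M.Fits Ω) {S T : Finset E3} (hT : T ∈ M.elems) (hS : S ⊆ T)
    (hb : convexHull ℝ (S : Set E3) ⊆ M.bdry) {x : E3} (hx : x ∈ S) : x ∈ frontier Ω :=
  hfit.2 T hT x (hS hx) (hb (subset_convexHull ℝ _ hx))

theorem dist_vertices_lt (hr : M.meshSize < r) {T : Finset E3} (hT : T ∈ M.elems) {a b : E3}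
    (ha : a ∈ T) (hb : b ∈ T) : dist a b < r :=
  (Metric.dist_le_diam_of_mem T.isBounded_hull (subset_convexHull ℝ _ ha)
      (subset_convexHull ℝ _ hb)).trans_lt ((diam_le_meshSize hT).trans_lt hr)

theorem Fits.flat (hfit : M.Fits Ω) (hΩ : IsOpen Ω) (hr : M.meshSize < r) {S T : Finset E3}
    (hT : T ∈ M.elems) (hS : S ⊆ T) (hb : convexHull ℝ (S : Set E3) ⊆ M.bdry) {a₀ ν : E3}
    (hν : IsConeDir Ω η r a₀ ν) (ha₀ : a₀ ∈ S) {a : E3} (ha : a ∈ S) :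
    |inner ℝ ν (a - a₀)| ≤ η * ‖a - a₀‖ :=
  hν.abs_inner_le hΩ (hfit.mem_frontier hT hS hb ha) (dist_vertices_lt hr hT (hS ha) (hS ha₀))

/-- Every vertex of `F'` lies on an edge of `F'`, which is a boundary edge of `T` and hence an edge
of `F`. -/
theorem AtMostOneFaceOrEdge.face_unique (hone : M.AtMostOneFaceOrEdge) {T F F' : Finset E3}
    (hT : T ∈ M.elems) (hF : M.IsBdryFace F) (hF' : M.IsBdryFace F') (hFT : F ⊆ T)
    (hFT' : F' ⊆ T) : F = F' := by
  refine (Finset.eq_of_subset_of_card_le (fun x hx => ?_) (by rw [hF.1.1, hF'.1.1])).symm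
  obtain ⟨y, hy, hne⟩ := Finset.exists_mem_ne (show 1 < F'.card by rw [hF'.1.1]; norm_num) x
  have hsub : ({x, y} : Finset E3) ⊆ F' := by
    intro z hz
    rcases Finset.mem_insert.1 hz with rfl | hz
    · exact hx
    · rwa [Finset.mem_singleton.1 hz]
  refine (hone T hT).1 F hFT hF {x, y} (hsub.trans hFT') ⟨⟨Finset.card_pair hne.symm, T, hT,
    hsub.trans hFT'⟩, ?_⟩ (Finset.mem_insert_self x _)
  exact (convexHull_mono (by exact_mod_cast hsub)).trans hF'.2

/-- The conormals of two boundary faces meeting at an edge are not close: there are no folds. -/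
theorem conormals_apart (hΩ : IsOpen Ω) (hfit : M.Fits Ω) (hreg : M.ShapeRegular σ)
    (hone : M.AtMostOneFaceOrEdge) (hr : M.meshSize < r) (hη : 0 ≤ η) (hσ : 1 ≤ σ)
    (hση : 6 * σ * η ≤ 1) {e F F' : Finset E3} (he : e.card = 2) (hF : M.IsBdryFace F)
    (hF' : M.IsBdryFace F') (heF : e ⊆ F) (heF' : e ⊆ F') (hne : F ≠ F') {a₀ ν : E3}
    (ha₀ : a₀ ∈ e) (hν : IsConeDir Ω η r a₀ ν) {p p' : E3} (hp : IsConormal e F p)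
    (hp' : IsConormal e F' p') : 1 ≤ 8 * σ ^ 2 * ‖p - p'‖ := by
  by_contra! hlt
  obtain ⟨⟨h3, T, hT, hFT⟩, hFb⟩ := id hF
  obtain ⟨⟨h3', T', hT', hFT'⟩, hFb'⟩ := id hF'
  obtain ⟨l, g, h⟩ := exists_bary hT
  obtain ⟨l', g', h'⟩ := exists_bary hT'
  obtain ⟨d, hd, hdT⟩ := Finset.exists_apex hFT h3 (M.card_eq T hT)
  obtain ⟨d', hd', hdT'⟩ := Finset.exists_apex hFT' h3' (M.card_eq T' hT')
  obtain ⟨c, hc, hcF⟩ := Finset.exists_eq_insert_iff.2 ⟨heF, by omega⟩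
  obtain ⟨c', hc', hcF'⟩ := Finset.exists_eq_insert_iff.2 ⟨heF', by omega⟩
  have hdm : d ∈ T := hdT ▸ Finset.mem_insert_self d F
  have hdm' : d' ∈ T' := hdT' ▸ Finset.mem_insert_self d' F'
  -- With close conormals, the same direction `u` leads from the mid-point of `e` into both
  -- elements. They overlap, hence coincide, and one element cannot have two boundary faces.
  obtain ⟨w1, w2⟩ := h.wedge_pos (p₀ := p) (hreg.isSized hT h) h3 hd hdT hc hcF hη hσ hση
    hν.norm_eq (fun a ha => hfit.flat hΩ hr hT hFT hFb hν (heF ha₀) ha) ha₀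
    (hν.inner_le (hfit.1 T hT d hdm) (dist_vertices_lt hr hT hdm (hFT (heF ha₀)))) hp (by simp)
  obtain ⟨w1', w2'⟩ := h'.wedge_pos (p₀ := p) (hreg.isSized hT' h') h3' hd' hdT' hc' hcF' hη hσ
    hση hν.norm_eq (fun a ha => hfit.flat hΩ hr hT' hFT' hFb' hν (heF' ha₀) ha) ha₀
    (hν.inner_le (hfit.1 T' hT' d' hdm') (dist_vertices_lt hr hT' hdm' (hFT' (heF' ha₀)))) hp'
    (by rwa [norm_sub_rev])
  set u := p - (1 / (4 * σ)) • ν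
  set m := e.centroid ℝ id
  have key : ∀ {T F : Finset E3} {l g} {c d : E3}, IsBary T l g → insert d F = T → d ∉ F →
      insert c e = F → c ∉ e → 0 < inner ℝ (g d) u → 0 < inner ℝ (g c) u →
      ∀ᶠ s : ℝ in nhdsWithin 0 (Set.Ioi 0), ∀ a ∈ T, 0 < l a (m + s • u) := by
    classical
    intro T F l g c d h hdT hd hcF hc w1 w2
    have hcm : c ∈ T := hdT ▸ Finset.mem_insert_of_mem (hcF ▸ Finset.mem_insert_self c e)
    have hdm : d ∈ T := hdT ▸ Finset.mem_insert_self d F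
    have heT : e ⊆ T :=
      (hcF ▸ Finset.subset_insert c e : e ⊆ F).trans (hdT ▸ Finset.subset_insert d F)
    have hde : d ∉ e := fun hde => hd (hcF ▸ Finset.mem_insert_of_mem hde)
    rw [Filter.eventually_all_finset]
    intro a ha
    have hval : ∀ s : ℝ, l a (m + s • u) = l a m + s * inner ℝ (g a) u := fun s => by
      rw [h.eq_add a (m + s • u) m, add_sub_cancel_left, inner_smul_right]
    -- At the mid-point the coordinates of the end-points are positive and survive a small step; the
    -- other two vanish there and increase along `u`.
    by_cases hae : a ∈ e
    · have hcont : Continuous fun s : ℝ => l a (m + s • u) := by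
        have := h.continuous a
        fun_prop
      have := hcont.tendsto 0
      simp only [zero_smul, add_zero] at this
      exact (this.mono_left nhdsWithin_le_nhds).eventually (lt_mem_nhds (h.centroid_pos heT hae))
    · filter_upwards [self_mem_nhdsWithin] with s hs
      have hs : 0 < s := hs
      rw [hval, h.centroid heT ⟨a₀, ha₀⟩ ha, if_neg hae, zero_add]
      apply mul_pos hs
      rw [← hdT, Finset.mem_insert, ← hcF, Finset.mem_insert] at ha
      rcases ha with rfl | rfl | ha
      exacts [w1, w2, absurd ha hae]
  obtain ⟨s, hs1, hs2⟩ := ((key h hdT hd hcF hc w1 w2).and (key h' hdT' hd' hcF' hc' w1' w2')).exists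
  obtain rfl : T = T' := eq_of_overlap hT hT' h hs1 (h'.mem_hull.2 fun a ha => (hs2 a ha).le)
  exact hne (hone.face_unique hT hF hF' hFT hFT')

theorem exists_conormal {e F : Finset E3} (he : e.card = 2) (hF : M.IsFace F) (heF : e ⊆ F) :
    ∃ p, IsConormal e F p := by
  classical
  obtain ⟨h3, T, hT, hFT⟩ := hF
  obtain ⟨l, g, h⟩ := exists_bary hT
  obtain ⟨c, hc, hcF⟩ := Finset.exists_eq_insert_iff.2 ⟨heF, by omega⟩
  obtain ⟨a, b, hab, rfl⟩ := Finset.card_eq_two.1 he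
  refine exists_isConormal hab rfl hcF.symm fun hmem => ?_
  obtain ⟨t, ht⟩ := Submodule.mem_span_singleton.1 hmem
  have hcm : c ∈ T := hFT (hcF ▸ Finset.mem_insert_self c _)
  have hz : ∀ x ∈ ({a, b} : Finset E3), l c x = 0 := fun x hx =>
    h.ne c hcm x (hFT (heF hx)) (fun e => hc (e ▸ hx))
  have h1 : inner ℝ (g c) (c - a) = 1 := by
    rw [h.inner_sub, h.self c hcm, hz a (by simp), sub_zero]
  rw [← ht, inner_smul_right, h.inner_sub, hz a (by simp), hz b (by simp)] at h1
  simp at h1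

theorem norm_centroid_sub_le {S T : Finset E3} (hT : T ∈ M.elems) (hS : S ⊆ T) {a : E3}
    (ha : a ∈ S) : ‖S.centroid ℝ id - a‖ ≤ Metric.diam (S : Set E3) := by
  obtain ⟨l, g, h⟩ := exists_bary hT
  rw [← convexHull_diam, ← dist_eq_norm]
  exact Metric.dist_le_diam_of_mem S.isBounded_hull (h.centroid_mem hS ⟨a, ha⟩)
    (subset_convexHull ℝ _ ha)

theorem diam_le_diam_hull {S T : Finset E3} (hS : S ⊆ T) :
    Metric.diam (S : Set E3) ≤ Metric.diam (convexHull ℝ (T : Set E3)) :=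
  Metric.diam_mono ((Finset.coe_subset.2 hS).trans (subset_convexHull ℝ _)) T.isBounded_hull

theorem diam_pos {S : Finset E3} (hS : 1 < S.card) : 0 < Metric.diam (S : Set E3) := by
  obtain ⟨a, ha, b, hb, hne⟩ := Finset.one_lt_card.1 hS
  exact (dist_pos.2 hne).trans_le
    (Metric.dist_le_diam_of_mem S.finite_toSet.isBounded ha hb)

theorem Fits.centroid_flat (hfit : M.Fits Ω) (hΩ : IsOpen Ω) (hη : 0 ≤ η) (hr : M.meshSize < r)
    {S T : Finset E3} (hT : T ∈ M.elems) (hS : S ⊆ T) (hb : convexHull ℝ (S : Set E3) ⊆ M.bdry)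
    {a₀ ν : E3} (hν : IsConeDir Ω η r a₀ ν) (ha₀ : a₀ ∈ S) :
    |inner ℝ ν (S.centroid ℝ id - a₀)| ≤ η * Metric.diam (S : Set E3) := by
  obtain ⟨l, g, h⟩ := exists_bary hT
  refine abs_inner_le_of_mem_hull (h.centroid_mem hS ⟨a₀, ha₀⟩) fun b hbS =>
    (hfit.flat hΩ hr hT hS hb hν ha₀ hbS).trans (mul_le_mul_of_nonneg_left ?_ hη)
  rw [← dist_eq_norm]
  exact Metric.dist_le_diam_of_mem S.finite_toSet.isBounded hbS ha₀

/-- The perpendicular has direction `g d`. Its component along `ν` is at least `1 / (2 * H)` in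
modulus while `‖g d‖ ≤ σ / H`, whence the transversality constant `1 / (2 * σ)`. -/
theorem exists_face_node (hΩ : IsOpen Ω) (hfit : M.Fits Ω) (hreg : M.ShapeRegular σ)
    (hr : 2 * M.meshSize < r) (hη : 0 ≤ η) (hσ : 1 ≤ σ) (hση : 6 * σ * η ≤ 1) {ε : ℝ} (hε : 0 < ε)
    (hε1 : ε ≤ 1) (hηε : 3 * η < 1 / (2 * σ) * ε)
    (hcone : ∀ x ∈ frontier Ω, ∃ ν, IsConeDir Ω η r x ν) {F : Finset E3} (hF : M.IsBdryFace F) :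
    ∃ x ∈ frontier Ω ∩ faceLine F,
      dist (F.centroid ℝ id) x ≤ ε * Metric.diam (F : Set E3) := by
  obtain ⟨⟨h3, T, hT, hFT⟩, hFb⟩ := hF
  obtain ⟨l, g, h⟩ := exists_bary hT
  have hs := hreg.isSized hT h
  have hHm := diam_le_meshSize hT
  have hr' : M.meshSize < r := by linarith [hs.pos]
  obtain ⟨d, hd, hdT⟩ := Finset.exists_apex hFT h3 (M.card_eq T hT)
  have hdm : d ∈ T := hdT ▸ Finset.mem_insert_self d F
  obtain ⟨a₀, ha₀⟩ := Finset.card_pos.1 (show 0 < F.card by omega)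
  obtain ⟨ν, hν⟩ := hcone a₀ (hfit.mem_frontier hT hFT hFb ha₀)
  have hgd := h.grad_apex_inner_le hs h3 hd hdT hη hση hν.norm_eq
    (fun a ha => hfit.flat hΩ hr' hT hFT hFb hν ha₀ ha) ha₀
    (hν.inner_le (hfit.1 T hT d hdm) (dist_vertices_lt hr' hT hdm (hFT ha₀)))
  have hgn := hs.grad d hdm
  have hg0 : 0 < ‖g d‖ :=
    norm_pos_iff.2 (h.grad_ne_zero (by rw [M.card_eq T hT]; omega) hdm)
  have hlow : 1 / (2 * σ) ≤ |inner ℝ ν (‖g d‖⁻¹ • g d)| := by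
    rw [inner_smul_right, abs_mul, abs_of_pos (inv_pos.2 hg0), real_inner_comm, inv_mul_eq_div,
      le_div_iff₀ hg0, div_mul_eq_mul_div, div_le_iff₀ (by linarith), one_mul]
    have h1 := neg_abs_le (inner ℝ (g d) ν : ℝ)
    have h2 := mul_le_mul_of_nonneg_right h1 hs.pos.le
    have h3 : 1 / 2 ≤ |inner ℝ (g d) ν| * Metric.diam (convexHull ℝ (T : Set E3)) := by linarith
    refine le_of_mul_le_mul_right ?_ hs.pos
    nlinarith
  obtain ⟨s, hs1, hs2⟩ := hν.exists_mem_frontier hΩ hη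
    (by rw [norm_smul, norm_inv, norm_norm, inv_mul_cancel₀ hg0.ne'] : ‖‖g d‖⁻¹ • g d‖ = 1)
    (diam_pos (show 1 < F.card by omega)) (norm_centroid_sub_le hT hFT ha₀)
    (hfit.centroid_flat hΩ hη hr' hT hFT hFb hν ha₀) hε hε1
    (by linarith [diam_le_diam_hull hFT]) hlow hηε
  refine ⟨_, ⟨hs2, fun a ha b hb => ?_⟩, ?_⟩
  · rw [add_sub_cancel_left, inner_smul_right, inner_smul_right, real_inner_comm,
      h.grad_inner_span hd hdT (vsub_mem_vectorSpan ℝ (by exact_mod_cast ha)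
        (by exact_mod_cast hb) : a - b ∈ _), mul_zero, mul_zero]
  · rw [dist_eq_norm, sub_add_cancel_left, norm_neg, norm_smul, norm_smul, norm_inv, norm_norm,
      inv_mul_cancel₀ hg0.ne', mul_one]
    exact hs1

/-- The unit vector orthogonal to the edge and to `n` is transversal by `cos_div_four_le`, applied
with `q` the normalized difference of the conormals of two boundary faces at the edge. -/
theorem exists_edge_node (hΩ : IsOpen Ω) (hfit : M.Fits Ω) (hreg : M.ShapeRegular σ)
    (hone : M.AtMostOneFaceOrEdge) (hr : 2 * M.meshSize < r) (hη : 0 ≤ η) (hη2 : η ≤ 1 / 2)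
    (hσ : 1 ≤ σ) {C : ℝ} (hC : 0 < C) (hσηC : 48 * σ ^ 3 * η ≤ C / 4) (hσ1 : 6 * σ * η ≤ 1)
    {ε : ℝ} (hε : 0 < ε) (hε1 : ε ≤ 1) (hηε : 3 * η < C / 4 * ε)
    (hcone : ∀ x ∈ frontier Ω, ∃ ν, IsConeDir Ω η r x ν) {e : Finset E3} (he : M.IsBdryEdge e)
    {n : E3} (hn0 : n ≠ 0) (hne : ∀ a ∈ e, ∀ b ∈ e, inner ℝ (a - b) n = 0)
    (hskin : ∀ F F', M.IsBdryFace F → M.IsBdryFace F' → e ⊆ F → e ⊆ F' → F ≠ F' →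
      ∀ p p', IsConormal e F p → IsConormal e F' p' →
        C * (‖n‖ * ‖p - p'‖) ≤ |inner ℝ n (p - p')|) :
    ∃ x ∈ frontier Ω ∩ edgeLine e n,
      dist (e.centroid ℝ id) x ≤ ε * Metric.diam (e : Set E3) := by
  obtain ⟨F, F', hF, hF', heF, heF', hFF'⟩ := exists_two_bdryFaces he
  obtain ⟨⟨he2, T, hT, heT⟩, heb⟩ := he
  obtain ⟨a, b, hab, rfl⟩ := Finset.card_eq_two.1 he2
  have ham : a ∈ ({a, b} : Finset E3) := by simp
  have hbm : b ∈ ({a, b} : Finset E3) := by simp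
  obtain ⟨ν, hν⟩ := hcone a (hfit.mem_frontier hT heT heb ham)
  have hdp := diam_pos (show 1 < ({a, b} : Finset E3).card by omega)
  have hHm := diam_le_meshSize hT
  have hde := diam_le_diam_hull heT
  have hr' : M.meshSize < r := by linarith
  obtain ⟨p, hp⟩ := exists_conormal he2 hF.1 heF
  obtain ⟨p', hp'⟩ := exists_conormal he2 hF'.1 heF'
  have hapart := conormals_apart hΩ hfit hreg hone hr' hη hσ hσ1 he2 hF hF' heF heF' hFF' ham hν
    hp hp'
  have hsk := hskin F F' hF hF' heF heF' hFF' p p' hp hp'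
  have hflat : ∀ {F p}, M.IsBdryFace F → {a, b} ⊆ F → IsConormal {a, b} F p →
      |inner ℝ ν p| ≤ 3 * σ * η := by
    intro F p hF heF hp
    obtain ⟨⟨h3, T, hT, hFT⟩, hFb⟩ := hF
    obtain ⟨l, g, h⟩ := exists_bary hT
    obtain ⟨d, hd, hdT⟩ := Finset.exists_apex hFT h3 (M.card_eq T hT)
    have := h.abs_inner_span_le (hreg.isSized hT h) h3 hd hdT hη
      (fun x hx => hfit.flat hΩ hr' hT hFT hFb hν (heF ham) hx) (heF ham) hp.1
    rwa [hp.2.1, mul_one] at this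
  have hq0 : 0 < ‖p - p'‖ := by
    by_contra! h0
    have : ‖p - p'‖ = 0 := le_antisymm h0 (norm_nonneg _)
    rw [this] at hapart
    norm_num at hapart
  have hn : 0 < ‖n‖ := norm_pos_iff.2 hn0
  have hab0 : 0 < ‖a - b‖ := norm_pos_iff.2 (sub_ne_zero.2 hab)
  obtain ⟨d, hd, hdab, hdn⟩ := exists_unit_orthogonal (a - b) n
  have hunit : ∀ {v : E3}, 0 < ‖v‖ → ‖‖v‖⁻¹ • v‖ = 1 := fun {v} hv => by
    rw [norm_smul, norm_inv, norm_norm, inv_mul_cancel₀ hv.ne']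
  have hlow : C / 4 ≤ |inner ℝ ν d| := by
    refine cos_div_four_le (τ := ‖a - b‖⁻¹ • (a - b)) (n := ‖n‖⁻¹ • n)
      (q := ‖p - p'‖⁻¹ • (p - p')) (hunit hab0) (hunit hn) hd hν.norm_eq (hunit hq0) ?_ ?_ ?_ ?_ hC
      ?_ ?_ ?_
    · rw [real_inner_smul_left, inner_smul_right, hne a ham b hbm, mul_zero, mul_zero]
    · rw [real_inner_smul_left, hdab, mul_zero]
    · rw [real_inner_smul_left, hdn, mul_zero]
    · rw [real_inner_smul_left, inner_smul_right, inner_sub_right, hp.2.2.1 a ham b hbm,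
        hp'.2.2.1 a ham b hbm, sub_zero, mul_zero, mul_zero]
    · rw [real_inner_smul_left, inner_smul_right, abs_mul, abs_mul, abs_of_pos (inv_pos.2 hn),
        abs_of_pos (inv_pos.2 hq0), inv_mul_eq_div, inv_mul_eq_div, div_div, le_div_iff₀
        (by positivity)]
      linarith
    · rw [inner_smul_right, abs_mul, abs_of_pos (inv_pos.2 hab0), inv_mul_eq_div,
        div_le_iff₀ hab0, ← neg_sub b a, inner_neg_right, abs_neg, norm_neg]
      exact (hfit.flat hΩ hr' hT heT heb hν ham hbm).trans
        (mul_le_mul_of_nonneg_right hη2 (norm_nonneg _))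
    · rw [inner_smul_right, abs_mul, abs_of_pos (inv_pos.2 hq0), inv_mul_eq_div,
        div_le_iff₀ hq0, inner_sub_right]
      have h1 := hflat hF heF hp
      have h2 := hflat hF' heF' hp'
      have h3 := (abs_sub (inner ℝ ν p : ℝ) (inner ℝ ν p')).trans (add_le_add h1 h2)
      -- Normalizing `p - p'`, of length at least `1 / (8 σ²)`, turns the tangency bound `6 σ η`
      -- into `48 σ³ η`.
      have h4 : 6 * σ * η * 1 ≤ 6 * σ * η * (8 * σ ^ 2 * ‖p - p'‖) :=
        mul_le_mul_of_nonneg_left hapart (by positivity)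
      have h5 := mul_le_mul_of_nonneg_right hσηC hq0.le
      nlinarith
  obtain ⟨s, hs1, hs2⟩ := hν.exists_mem_frontier hΩ hη hd hdp
    (norm_centroid_sub_le hT heT ham)
    (hfit.centroid_flat hΩ hη hr' hT heT heb hν ham) hε hε1
    (by linarith) hlow hηε
  refine ⟨_, ⟨hs2, fun x hx y hy => ?_, ?_⟩, ?_⟩
  · rw [add_sub_cancel_left, inner_smul_right]
    have hba : inner ℝ (b - a) d = 0 := by rw [← neg_sub, inner_neg_left, hdab, neg_zero]
    rw [Finset.mem_insert, Finset.mem_singleton] at hx hy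
    rcases hx with rfl | rfl <;> rcases hy with rfl | rfl <;> simp [hdab, hba]
  · rw [add_sub_cancel_left, inner_smul_right, hdn, mul_zero]
  · rw [dist_eq_norm, sub_add_cancel_left, norm_neg, norm_smul, hd, mul_one]
    exact hs1

end TetMesh

/-- On fine meshes the lines carrying the nodes meet the boundary close to the centroids. -/
theorem IsC1Domain.exists_nodes_close {Ω : Set E3} (hΩ : IsC1Domain Ω) {σ θ ε : ℝ} (hσ : 1 ≤ σ)
    (hθ : θ ∈ Set.Ico 0 (Real.pi / 2)) (hε : 0 < ε) (hε1 : ε ≤ 1) :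
    ∃ h₀ : ℝ, 0 < h₀ ∧ ∀ M : TetMesh, M.Fits Ω → M.ShapeRegular σ → M.AtMostOneFaceOrEdge →
      M.meshSize ≤ h₀ → ∀ n : Finset E3 → E3, M.IsSkinFamily θ n →
        (∀ F, M.IsBdryFace F → ∃ x ∈ frontier Ω ∩ faceLine F,
          dist (F.centroid ℝ id) x ≤ ε * Metric.diam (F : Set E3)) ∧
        (∀ e, M.IsBdryEdge e → ∃ x ∈ frontier Ω ∩ edgeLine e (n e),
          dist (e.centroid ℝ id) x ≤ ε * Metric.diam (e : Set E3)) := by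
  have hC : 0 < Real.cos θ := Real.cos_pos_of_mem_Ioo ⟨by linarith [hθ.1, Real.pi_pos], hθ.2⟩
  have hC1 : Real.cos θ ≤ 1 := Real.cos_le_one θ
  set C := Real.cos θ
  have hσ0 : 0 < σ := by linarith
  -- The power `σ ^ 3` comes from the edge condition `48 σ³ η ≤ C / 4`; the factor `ε` serves the
  -- two crossing conditions on `3 η`.
  set η : ℝ := ε * C / (1000 * σ ^ 3) with hηdef
  have hη : 0 < η := by positivity
  have hησ : η * σ ^ 3 = ε * C / 1000 := by rw [hηdef]; field_simp
  have hσ2 : 1 ≤ σ ^ 2 := one_le_pow₀ hσ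
  have h1 : η * σ ≤ ε * C / 1000 := by
    rw [← hησ]
    exact mul_le_mul_of_nonneg_left (by nlinarith) hη.le
  have h2 : η ≤ η * σ := le_mul_of_one_le_right hη.le hσ
  have hεC : ε * C ≤ 1 := by nlinarith
  have hεC' : ε * C ≤ ε := by nlinarith
  have hεC'' : ε * C ≤ C := by nlinarith
  obtain ⟨r, hr, hcone⟩ := hΩ.exists_isConeDir hη
  refine ⟨r / 3, by positivity, fun M hfit hreg hone hsize n hskin => ⟨fun F hF => ?_,
    fun e he => ?_⟩⟩
  · refine TetMesh.exists_face_node hΩ.isOpen hfit hreg (by linarith) hη.le hσ (by linarith) hε hε1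
      ?_ hcone hF
    rw [div_mul_eq_mul_div, lt_div_iff₀ (by positivity)]
    linarith
  · obtain ⟨hn0, hne, hsk⟩ := hskin e he
    refine TetMesh.exists_edge_node hΩ.isOpen hfit hreg hone (by linarith) hη.le
      (by linarith) hσ hC (by linarith) (by linarith) hε hε1 ?_ hcone he hn0 hne hsk
    have : 0 < C * ε := mul_pos hC hε
    linarith

/-! ### Quadratic polynomials and their affine gradients -/

/-- Functions given by a constant, a linear and a quadratic part. -/
def IsQuadratic (f : E3 → ℝ) : Prop :=
  ∃ (c : ℝ) (v : E3) (A : E3 →L[ℝ] E3), ∀ x, f x = c + inner ℝ v x + inner ℝ (A x) x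

namespace IsQuadratic

theorem add {f f' : E3 → ℝ} (h : IsQuadratic f) (h' : IsQuadratic f') :
    IsQuadratic fun x => f x + f' x := by
  obtain ⟨c, v, A, h⟩ := h
  obtain ⟨c', v', A', h'⟩ := h'
  refine ⟨c + c', v + v', A + A', fun x => ?_⟩
  simp only [h, h', inner_add_left, add_apply]
  ring

theorem const_mul {f : E3 → ℝ} (h : IsQuadratic f) (k : ℝ) : IsQuadratic fun x => k * f x := by
  obtain ⟨c, v, A, h⟩ := h
  refine ⟨k * c, k • v, k • A, fun x => ?_⟩
  simp only [h, real_inner_smul_left, smul_apply]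
  ring

theorem const (c : ℝ) : IsQuadratic fun _ => c := ⟨c, 0, 0, fun x => by simp⟩

theorem coord (i : Fin 3) : IsQuadratic fun x => x i :=
  ⟨0, EuclideanSpace.single i 1, 0, fun x => by simp [EuclideanSpace.inner_single_left]⟩

theorem coord_mul_coord (i j : Fin 3) : IsQuadratic fun x => x i * x j :=
  ⟨0, 0, (EuclideanSpace.proj i : E3 →L[ℝ] ℝ).smulRight (EuclideanSpace.single j 1),
    fun x => by simp [EuclideanSpace.inner_single_left, real_inner_smul_left]⟩

/-- The gradient `(A + A*) x + v` is affine, so the mid-point rule integrates it exactly along a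
segment. -/
theorem exists_gradient {f : E3 → ℝ} (h : IsQuadratic f) : ∃ G : E3 →ᵃ[ℝ] E3,
    (∀ x, HasGradientAt f (G x) x) ∧ ∀ x y, f x - f y = inner ℝ (G (midpoint ℝ x y)) (x - y) := by
  obtain ⟨c, v, A, h⟩ := h
  have hG : ∀ x, ((A + A.adjoint).toLinearMap.toAffineMap + AffineMap.const ℝ E3 v) x
      = A x + A.adjoint x + v := fun x => by simp
  refine ⟨(A + A.adjoint).toLinearMap.toAffineMap + AffineMap.const ℝ E3 v, fun x => ?_,
    fun x y => ?_⟩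
  · rw [hG, hasGradientAt_iff_hasFDerivAt, funext h]
    have h1 : HasFDerivAt (fun x : E3 => inner ℝ v x) (innerSL ℝ v) x :=
      (innerSL ℝ v).hasFDerivAt
    have h2 := (A.hasFDerivAt (x := x)).inner ℝ (hasFDerivAt_id x)
    refine ((h1.const_add c).add h2).congr_fderiv ?_
    ext u
    simp [ContinuousLinearMap.adjoint_inner_left, real_inner_comm (A u) x,
      fderivInnerCLM_apply]
    ring
  · rw [hG, h, h]
    have : midpoint ℝ x y = (2⁻¹ : ℝ) • (x + y) := by rw [midpoint_eq_smul_add]; simp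
    rw [this]
    simp only [map_smul, map_add, inner_add_left, inner_sub_right, real_inner_smul_left,
      ContinuousLinearMap.adjoint_inner_left, smul_add]
    rw [real_inner_comm x (A x), real_inner_comm x (A y), real_inner_comm y (A x),
      real_inner_comm y (A y)]
    ring

end IsQuadratic

namespace P2

theorem isQuadratic (p : P2) : IsQuadratic p.val := by
  obtain ⟨p, hp⟩ := p
  change IsQuadratic fun x : E3 => MvPolynomial.eval (fun i => x i) p
  rw [MvPolynomial.restrictTotalDegree, MvPolynomial.restrictSupport_eq_span] at hp
  induction hp using Submodule.span_induction with
  | mem q hq =>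
    obtain ⟨m, hm, rfl⟩ := hq
    have hm : m.sum (fun _ e => e) ≤ 2 := hm
    rw [Finsupp.sum_fintype _ _ (fun _ => rfl), Fin.sum_univ_three] at hm
    have he : (fun x : E3 => MvPolynomial.eval (fun i => x i) (MvPolynomial.monomial m (1 : ℝ)))
        = fun x : E3 => x 0 ^ m 0 * x 1 ^ m 1 * x 2 ^ m 2 := by
      funext x
      rw [MvPolynomial.eval_monomial, Finsupp.prod_fintype _ _ (fun _ => pow_zero _),
        Fin.prod_univ_three, one_mul]
    simp only [he]
    generalize m 0 = a at *
    generalize m 1 = b at *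
    generalize m 2 = c at *
    have ha : a ≤ 2 := by omega
    have hb : b ≤ 2 := by omega
    have hc : c ≤ 2 := by omega
    -- Ten exponent triples have degree at most two; the others contradict the degree bound.
    interval_cases a <;> interval_cases b <;> interval_cases c <;>
      first
        | omega
        | simpa using IsQuadratic.const 1
        | simpa using IsQuadratic.coord 0
        | simpa using IsQuadratic.coord 1
        | simpa using IsQuadratic.coord 2
        | simpa [sq] using IsQuadratic.coord_mul_coord 0 0
        | simpa [sq] using IsQuadratic.coord_mul_coord 1 1
        | simpa [sq] using IsQuadratic.coord_mul_coord 2 2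
        | simpa using IsQuadratic.coord_mul_coord 0 1
        | simpa using IsQuadratic.coord_mul_coord 0 2
        | simpa using IsQuadratic.coord_mul_coord 1 2
  | zero => simpa using IsQuadratic.const 0
  | add p q _ _ hp hq => simpa using hp.add hq
  | smul k p _ hp => simpa [MvPolynomial.smul_eval] using hp.const_mul k

theorem differentiable (p : P2) : Differentiable ℝ p.val := by
  obtain ⟨G, hG, _⟩ := p.isQuadratic.exists_gradient
  exact fun x => (hG x).differentiableAt

/-- The gradient at a point, as a linear map. -/
def gradAt (x : E3) : P2 →ₗ[ℝ] E3 where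
  toFun p := gradient p.val x
  map_add' p q := by
    have : (p + q).val = p.val + q.val := funext fun y => by simp
    rw [this, gradient, fderiv_add (p.differentiable x) (q.differentiable x), map_add]
    rfl
  map_smul' c p := by
    have : (c • p).val = c • p.val := funext fun y => by simp
    rw [this, gradient, fderiv_const_smul (p.differentiable x), map_smulₛₗ]
    rfl

theorem gradAt_apply (x : E3) (p : P2) : gradAt x p = gradient p.val x := rfl

/-- Evaluation at a point, as a linear map. -/
def evalAt (x : E3) : P2 →ₗ[ℝ] ℝ where
  toFun p := p.val x
  map_add' p q := by simp
  map_smul' c p := by simp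

theorem evalAt_apply (x : E3) (p : P2) : evalAt x p = p.val x := rfl

theorem exists_gradAt (p : P2) : ∃ G : E3 →ᵃ[ℝ] E3, (∀ x, gradAt x p = G x) ∧
    ∀ x y, p.val x - p.val y = inner ℝ (gradAt (midpoint ℝ x y) p) (x - y) := by
  obtain ⟨G, hG, h⟩ := p.isQuadratic.exists_gradient
  have : ∀ x, gradAt x p = G x := fun x => (hG x).gradient
  exact ⟨G, this, fun x y => by rw [this]; exact h x y⟩

theorem sub_eq_inner (p : P2) (x y : E3) :
    p.val x - p.val y = inner ℝ (gradAt (midpoint ℝ x y) p) (x - y) := by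
  obtain ⟨_, _, h⟩ := p.exists_gradAt
  exact h x y

theorem continuous_gradAt (p : P2) : Continuous fun x => gradAt x p := by
  obtain ⟨G, hG, _⟩ := p.exists_gradAt
  simp_rw [hG]
  exact G.continuous_of_finiteDimensional

theorem continuous_val (p : P2) : Continuous p.val := p.differentiable.continuous

/-- Since the gradient is affine, its vertex values control it everywhere, also outside the element,
where the nodes may lie. -/
theorem gradAt_eq_sum {T : Finset E3} {l g} (h : IsBary T l g) (p : P2) (x : E3) :
    gradAt x p = ∑ a ∈ T, l a x • gradAt a p := by
  obtain ⟨G, hG, _⟩ := p.exists_gradAt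
  simp_rw [hG]
  exact h.affine_eq G x

theorem ext_val {p q : P2} (h : ∀ x, p.val x = q.val x) : p = q := by
  apply Subtype.ext
  apply MvPolynomial.funext
  intro x
  exact h (WithLp.toLp 2 x)

end P2

/-! ### Basis functions dual to the degrees of freedom -/

/-- The barycentric coordinate `l a` as a polynomial. -/
def baryPoly (l : E3 → E3 → ℝ) (g : E3 → E3) (a : E3) : MvPolynomial (Fin 3) ℝ :=
  MvPolynomial.C (l a 0) + ∑ i, MvPolynomial.C (g a i) * MvPolynomial.X i

theorem totalDegree_baryPoly_le (l : E3 → E3 → ℝ) (g : E3 → E3) (a : E3) :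
    (baryPoly l g a).totalDegree ≤ 1 := by
  refine (MvPolynomial.totalDegree_add _ _).trans (max_le (by simp) ?_)
  refine MvPolynomial.totalDegree_finsetSum_le fun i _ => ?_
  refine (MvPolynomial.totalDegree_mul _ _).trans ?_
  simp

namespace IsBary

variable {T : Finset E3} {l : E3 → E3 → ℝ} {g : E3 → E3}

theorem eval_baryPoly (h : IsBary T l g) (a x : E3) :
    MvPolynomial.eval (fun i => x i) (baryPoly l g a) = l a x := by
  rw [h.eq_add a x 0, sub_zero, baryPoly, map_add, map_sum, PiLp.inner_apply]
  simp [mul_comm]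

end IsBary

/-- The product of two barycentric coordinates. -/
def baryMul (l : E3 → E3 → ℝ) (g : E3 → E3) (a b : E3) : P2 :=
  ⟨baryPoly l g a * baryPoly l g b, by
    rw [MvPolynomial.mem_restrictTotalDegree]
    have h1 := totalDegree_baryPoly_le l g a
    have h2 := totalDegree_baryPoly_le l g b
    exact (MvPolynomial.totalDegree_mul _ _).trans (by omega)⟩

/-- A barycentric coordinate. -/
def baryLin (l : E3 → E3 → ℝ) (g : E3 → E3) (a : E3) : P2 :=
  ⟨baryPoly l g a, by
    rw [MvPolynomial.mem_restrictTotalDegree]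
    exact (totalDegree_baryPoly_le l g a).trans (by norm_num)⟩

/-- The polynomial `5 λ² - 4 λ` of a barycentric coordinate. -/
def vertexPoly (l : E3 → E3 → ℝ) (g : E3 → E3) (a : E3) : P2 :=
  (5 : ℝ) • baryMul l g a a - (4 : ℝ) • baryLin l g a

/-- The basis function of the degree of freedom `μ_F`. -/
def facePoly (T : Finset E3) (l : E3 → E3 → ℝ) (g : E3 → E3) (F : Finset E3) : P2 :=
  (6 / 7 : ℝ) • ∑ a ∈ T, vertexPoly l g a - (9 / 7 : ℝ) • ∑ a ∈ F, vertexPoly l g a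

/-- The basis function of the degree of freedom `ν_e`. -/
def edgePoly (T : Finset E3) (l : E3 → E3 → ℝ) (g : E3 → E3) (e : Finset E3) : P2 :=
  (10 / 7 : ℝ) • ∑ a ∈ e, vertexPoly l g a - (10 / 21 : ℝ) • ∑ a ∈ T, vertexPoly l g a
    + (5 : ℝ) • (∑ a ∈ e, ∑ b ∈ e, baryMul l g a b - ∑ a ∈ e, baryMul l g a a)

/-- The quadratic polynomial with the degrees of freedom `d`. -/
def interp (T : Finset E3) (l : E3 → E3 → ℝ) (g : E3 → E3) : (Finset E3 → ℝ) →ₗ[ℝ] P2 where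
  toFun d := ∑ F ∈ T.powersetCard 3, d F • facePoly T l g F
    + ∑ e ∈ T.powersetCard 2, d e • edgePoly T l g e
  map_add' d d' := by
    simp only [Pi.add_apply, add_smul, Finset.sum_add_distrib]; abel
  map_smul' c d := by
    simp only [Pi.smul_apply, smul_eq_mul, mul_smul, ← Finset.smul_sum, smul_add,
      RingHom.id_apply]

namespace IsBary

variable {T : Finset E3} {l : E3 → E3 → ℝ} {g : E3 → E3}

theorem evalAt_baryMul (h : IsBary T l g) (a b x : E3) :
    P2.evalAt x (baryMul l g a b) = l a x * l b x := by
  rw [P2.evalAt_apply, P2.val, baryMul, map_mul, h.eval_baryPoly, h.eval_baryPoly]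

theorem evalAt_baryLin (h : IsBary T l g) (a x : E3) :
    P2.evalAt x (baryLin l g a) = l a x := by
  rw [P2.evalAt_apply, P2.val, baryLin, h.eval_baryPoly]

theorem gradAt_baryLin (h : IsBary T l g) (a x : E3) :
    P2.gradAt x (baryLin l g a) = g a := by
  rw [P2.gradAt_apply, show (baryLin l g a).val = l a from funext (h.evalAt_baryLin a)]
  exact HasGradientAt.gradient (h.hasFDerivAt a x)

theorem gradAt_baryMul (h : IsBary T l g) (a b x : E3) :
    P2.gradAt x (baryMul l g a b) = l a x • g b + l b x • g a := by
  rw [P2.gradAt_apply,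
    show (baryMul l g a b).val = fun x => l a x * l b x from funext (h.evalAt_baryMul a b)]
  refine HasGradientAt.gradient ?_
  rw [hasGradientAt_iff_hasFDerivAt]
  refine ((h.hasFDerivAt a x).mul (h.hasFDerivAt b x)).congr_fderiv ?_
  ext u
  simp

/-- The function `5 λ² - 4 λ` takes the values 1, -3/4, -7/9 at its vertex and at the centroids of
edges and faces containing it. As 0.4 · (-3/4) + 0.3 = 0, all its edge means vanish, which is what
makes it a building block. -/
theorem evalAt_sum_vertexPoly (h : IsBary T l g) {S X : Finset E3} [DecidableEq E3] (hS : S ⊆ T)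
    (hne : S.Nonempty) (hX : X ⊆ T) :
    P2.evalAt (S.centroid ℝ id) (∑ a ∈ X, vertexPoly l g a) =
      (X ∩ S).card * (5 / (S.card : ℝ) ^ 2 - 4 / S.card) := by
  have : ∀ a ∈ X, P2.evalAt (S.centroid ℝ id) (vertexPoly l g a) =
      if a ∈ S then 5 / (S.card : ℝ) ^ 2 - 4 / S.card else 0 := by
    intro a ha
    rw [vertexPoly, map_sub, map_smul, map_smul, h.evalAt_baryMul, h.evalAt_baryLin,
      h.centroid hS hne (hX ha)]
    split_ifs
    · simp; ring
    · simp
  rw [map_sum, Finset.sum_congr rfl this, ← Finset.sum_filter, Finset.sum_const,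
    Finset.filter_mem_eq_inter, nsmul_eq_mul]

theorem evalAt_facePoly (h : IsBary T l g) {S X : Finset E3} [DecidableEq E3] (hS : S ⊆ T)
    (hne : S.Nonempty) (hX : X ⊆ T) :
    P2.evalAt (S.centroid ℝ id) (facePoly T l g X) =
      (6 / 7) * (S.card * (5 / (S.card : ℝ) ^ 2 - 4 / S.card)) -
        (9 / 7) * ((X ∩ S).card * (5 / (S.card : ℝ) ^ 2 - 4 / S.card)) := by
  rw [facePoly, map_sub, map_smul, map_smul, h.evalAt_sum_vertexPoly hS hne hX,
    h.evalAt_sum_vertexPoly hS hne (Finset.Subset.refl T), Finset.inter_eq_right.2 hS]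
  rfl

theorem evalAt_edgePoly (h : IsBary T l g) {S X : Finset E3} [DecidableEq E3] (hS : S ⊆ T)
    (hne : S.Nonempty) (hX : X ⊆ T) :
    P2.evalAt (S.centroid ℝ id) (edgePoly T l g X) =
      (10 / 7) * ((X ∩ S).card * (5 / (S.card : ℝ) ^ 2 - 4 / S.card)) -
        (10 / 21) * (S.card * (5 / (S.card : ℝ) ^ 2 - 4 / S.card)) +
        5 * (((X ∩ S).card / (S.card : ℝ)) ^ 2 - (X ∩ S).card / (S.card : ℝ) ^ 2) := by
  have hl : ∀ a ∈ X, l a (S.centroid ℝ id) = if a ∈ S then (S.card : ℝ)⁻¹ else 0 :=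
    fun a ha => h.centroid hS hne (hX ha)
  have h1 : ∑ a ∈ X, l a (S.centroid ℝ id) = (X ∩ S).card / (S.card : ℝ) := by
    rw [Finset.sum_congr rfl hl, ← Finset.sum_filter, Finset.sum_const,
      Finset.filter_mem_eq_inter, nsmul_eq_mul, div_eq_mul_inv]
  have h2 : ∑ a ∈ X, l a (S.centroid ℝ id) * l a (S.centroid ℝ id)
      = (X ∩ S).card / (S.card : ℝ) ^ 2 := by
    have : ∀ a ∈ X, l a (S.centroid ℝ id) * l a (S.centroid ℝ id) =
        if a ∈ S then ((S.card : ℝ) ^ 2)⁻¹ else 0 := fun a ha => by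
      rw [hl a ha]; split_ifs <;> simp [sq]
    rw [Finset.sum_congr rfl this, ← Finset.sum_filter, Finset.sum_const,
      Finset.filter_mem_eq_inter, nsmul_eq_mul, div_eq_mul_inv]
  rw [edgePoly, map_add, map_sub, map_smul, map_smul, map_smul, map_sub, map_sum, map_sum,
    map_sum, map_sum, ← map_sum, ← map_sum, h.evalAt_sum_vertexPoly hS hne hX,
    h.evalAt_sum_vertexPoly hS hne (Finset.Subset.refl T), Finset.inter_eq_right.2 hS]
  simp_rw [map_sum, h.evalAt_baryMul]
  rw [h2, ← Finset.sum_mul_sum, h1, sq ((((X ∩ S).card : ℝ)) / _)]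
  rfl

end IsBary

theorem P2.edgeMean_eq (p : P2) (e : Finset E3) (Q : E3) :
    p.edgeMean e Q = (2 / 5) * P2.evalAt Q p
      + (3 / 10) * ∑ A ∈ e, P2.evalAt (({A} : Finset E3).centroid ℝ id) p := by
  simp only [P2.edgeMean, P2.evalAt_apply, Finset.centroid_singleton, id]

namespace IsBary

variable {T : Finset E3} {l : E3 → E3 → ℝ} {g : E3 → E3}

/-- With k common vertices the value is k - 2, and distinct faces of a tetrahedron share exactly two
vertices. -/
theorem mu_facePoly (h : IsBary T l g) (hT : T.card = 4) {F F' : Finset E3} [DecidableEq E3]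
    (hF : F ⊆ T) (hF3 : F.card = 3) (hF' : F' ⊆ T) (hF3' : F'.card = 3) :
    (facePoly T l g F).mu F' = if F = F' then 1 else 0 := by
  have hne : F'.Nonempty := Finset.card_pos.1 (by omega)
  change P2.evalAt _ (facePoly T l g F) = _
  rw [h.evalAt_facePoly hF' hne hF, hF3']
  split_ifs with heq
  · rw [heq, Finset.inter_self, hF3']; norm_num
  · have h1 := Finset.card_union_add_card_inter F F'
    have h2 : (F ∪ F').card ≤ 4 := hT ▸ Finset.card_le_card (Finset.union_subset hF hF')
    have h3 : (F ∩ F').card < 3 := by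
      by_contra! h3
      have e1 : F ∩ F' = F := Finset.eq_of_subset_of_card_le Finset.inter_subset_left (by omega)
      have e2 : F ∩ F' = F' := Finset.eq_of_subset_of_card_le Finset.inter_subset_right (by omega)
      exact heq (e1.symm.trans e2)
    have h4 : (F ∩ F').card = 2 := by omega
    rw [h4]; norm_num

/-- With k common vertices the value is 5 (k - 1) (k - 2) / 9, and an edge meets a face of the
tetrahedron in one or two vertices. -/
theorem mu_edgePoly (h : IsBary T l g) (hT : T.card = 4) {e F' : Finset E3}
    (he : e ⊆ T) (he2 : e.card = 2) (hF' : F' ⊆ T) (hF3' : F'.card = 3) :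
    (edgePoly T l g e).mu F' = 0 := by
  classical
  have hne : F'.Nonempty := Finset.card_pos.1 (by omega)
  change P2.evalAt _ (edgePoly T l g e) = _
  rw [h.evalAt_edgePoly hF' hne he, hF3']
  have h1 := Finset.card_union_add_card_inter e F'
  have h2 : (e ∪ F').card ≤ 4 := hT ▸ Finset.card_le_card (Finset.union_subset he hF')
  have h3 : (e ∩ F').card ≤ 2 := he2 ▸ Finset.card_le_card Finset.inter_subset_left
  have h4 : (e ∩ F').card = 1 ∨ (e ∩ F').card = 2 := by omega
  rcases h4 with h4 | h4 <;> rw [h4] <;> norm_num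

theorem sum_card_inter_singleton (X e : Finset E3) [DecidableEq E3] :
    ∑ A ∈ e, ((X ∩ {A}).card : ℝ) = (X ∩ e).card := by
  have : ∀ A ∈ e, ((X ∩ {A}).card : ℝ) = if A ∈ X then 1 else 0 := by
    intro A _
    split_ifs with hA
    · rw [Finset.inter_singleton_of_mem hA]; simp
    · rw [Finset.inter_singleton_of_notMem hA]; simp
  rw [Finset.sum_congr rfl this, Finset.sum_boole, Finset.filter_mem_eq_inter,
    Finset.inter_comm]

theorem nu_facePoly (h : IsBary T l g) {F e' : Finset E3}
    (hF : F ⊆ T) (he' : e' ⊆ T) (he2' : e'.card = 2) :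
    (facePoly T l g F).nu e' = 0 := by
  classical
  have hne : e'.Nonempty := Finset.card_pos.1 (by omega)
  have hv : ∀ A ∈ e', P2.evalAt (({A} : Finset E3).centroid ℝ id) (facePoly T l g F) =
      6 / 7 - (9 / 7) * ((F ∩ {A}).card : ℝ) := fun A hA => by
    rw [h.evalAt_facePoly (Finset.singleton_subset_iff.2 (he' hA)) (Finset.singleton_nonempty A)
      hF, Finset.card_singleton]
    norm_num
  rw [P2.nu, P2.edgeMean_eq, h.evalAt_facePoly he' hne hF, he2', Finset.sum_congr rfl hv,
    Finset.sum_sub_distrib, ← Finset.mul_sum, sum_card_inter_singleton, Finset.sum_const, he2']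
  norm_num
  ring

/-- The vertex functions have zero edge means; the product term leaves k (k - 1) / 2 for k common
vertices. -/
theorem nu_edgePoly (h : IsBary T l g) {e e' : Finset E3} [DecidableEq E3]
    (he : e ⊆ T) (he2 : e.card = 2) (he' : e' ⊆ T) (he2' : e'.card = 2) :
    (edgePoly T l g e).nu e' = if e = e' then 1 else 0 := by
  have hne : e'.Nonempty := Finset.card_pos.1 (by omega)
  have hv : ∀ A ∈ e', P2.evalAt (({A} : Finset E3).centroid ℝ id) (edgePoly T l g e) =
      (10 / 7) * ((e ∩ {A}).card : ℝ) - 10 / 21 := fun A hA => by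
    rw [h.evalAt_edgePoly (Finset.singleton_subset_iff.2 (he' hA)) (Finset.singleton_nonempty A)
      he, Finset.card_singleton]
    have : (e ∩ {A}).card ≤ 1 := (Finset.card_le_card Finset.inter_subset_right).trans (by simp)
    have : (e ∩ {A}).card = 0 ∨ (e ∩ {A}).card = 1 := by omega
    rcases this with h1 | h1 <;> rw [h1] <;> norm_num
  rw [P2.nu, P2.edgeMean_eq, h.evalAt_edgePoly he' hne he, he2', Finset.sum_congr rfl hv,
    Finset.sum_sub_distrib, ← Finset.mul_sum, sum_card_inter_singleton, Finset.sum_const, he2']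
  split_ifs with heq
  · rw [heq, Finset.inter_self, he2']; norm_num
  · have h3 : (e ∩ e').card < 2 := by
      by_contra! h3
      have e1 : e ∩ e' = e := Finset.eq_of_subset_of_card_le Finset.inter_subset_left (by omega)
      have e2 : e ∩ e' = e' := Finset.eq_of_subset_of_card_le Finset.inter_subset_right (by omega)
      exact heq (e1.symm.trans e2)
    have : (e ∩ e').card = 0 ∨ (e ∩ e').card = 1 := by omega
    rcases this with h1 | h1 <;> rw [h1] <;> norm_num

theorem mu_eq_evalAt (p : P2) (F : Finset E3) : p.mu F = P2.evalAt (F.centroid ℝ id) p := rfl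

end IsBary

/-- The weighted edge mean as a linear map. -/
def P2.edgeMeanAt (e : Finset E3) (Q : E3) : P2 →ₗ[ℝ] ℝ where
  toFun p := p.edgeMean e Q
  map_add' p q := by simp
  map_smul' c p := by simp

/-! ### Interpolation and gradient bounds -/

namespace IsBary

variable {T : Finset E3} {l : E3 → E3 → ℝ} {g : E3 → E3}

theorem mu_interp (h : IsBary T l g) (hT : T.card = 4) (d : Finset E3 → ℝ) {F : Finset E3}
    (hF : F ⊆ T) (hF3 : F.card = 3) : (interp T l g d).mu F = d F := by
  classical
  change P2.evalAt (F.centroid ℝ id) (∑ F ∈ T.powersetCard 3, d F • facePoly T l g F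
    + ∑ e ∈ T.powersetCard 2, d e • edgePoly T l g e) = d F
  rw [map_add, map_sum, map_sum, Finset.sum_eq_single_of_mem F
    (Finset.mem_powersetCard.2 ⟨hF, hF3⟩), Finset.sum_eq_zero, add_zero, map_smul,
    ← mu_eq_evalAt, h.mu_facePoly hT hF hF3 hF hF3, if_pos rfl, smul_eq_mul, mul_one]
  · intro e he
    obtain ⟨he1, he2⟩ := Finset.mem_powersetCard.1 he
    rw [map_smul, ← mu_eq_evalAt, h.mu_edgePoly hT he1 he2 hF hF3, smul_zero]
  · intro F' hF' hne
    obtain ⟨h1, h2⟩ := Finset.mem_powersetCard.1 hF'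
    rw [map_smul, ← mu_eq_evalAt, h.mu_facePoly hT h1 h2 hF hF3, if_neg hne, smul_zero]

theorem nu_interp (h : IsBary T l g) (d : Finset E3 → ℝ) {e : Finset E3}
    (he : e ⊆ T) (he2 : e.card = 2) : (interp T l g d).nu e = d e := by
  classical
  change P2.edgeMeanAt e (e.centroid ℝ id) (∑ F ∈ T.powersetCard 3, d F • facePoly T l g F
    + ∑ e ∈ T.powersetCard 2, d e • edgePoly T l g e) = d e
  have hnu : ∀ p : P2, P2.edgeMeanAt e (e.centroid ℝ id) p = p.nu e := fun _ => rfl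
  rw [map_add, map_sum, map_sum, Finset.sum_eq_zero, zero_add, Finset.sum_eq_single_of_mem e
    (Finset.mem_powersetCard.2 ⟨he, he2⟩), map_smul, hnu, h.nu_edgePoly he he2 he he2,
    if_pos rfl, smul_eq_mul, mul_one]
  · intro e' he' hne
    obtain ⟨h1, h2⟩ := Finset.mem_powersetCard.1 he'
    rw [map_smul, hnu, h.nu_edgePoly h1 h2 he he2, if_neg hne, smul_zero]
  · intro F' hF'
    obtain ⟨h1, h2⟩ := Finset.mem_powersetCard.1 hF'
    rw [map_smul, hnu, h.nu_facePoly h1 he he2, smul_zero]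

theorem norm_gradAt_baryMul_le (h : IsBary T l g) {K : ℝ} (hg : ∀ a ∈ T, ‖g a‖ ≤ K) {x : E3}
    (hx : x ∈ convexHull ℝ (T : Set E3)) {a b : E3} (ha : a ∈ T) (hb : b ∈ T) :
    ‖P2.gradAt x (baryMul l g a b)‖ ≤ 2 * K := by
  rw [h.gradAt_baryMul]
  have : ∀ a ∈ T, ∀ b ∈ T, ‖l a x • g b‖ ≤ K := fun a ha b hb => by
    rw [norm_smul, Real.norm_of_nonneg (h.mem_hull.1 hx a ha)]
    exact (mul_le_of_le_one_left (norm_nonneg _) (h.le_one hx ha)).trans (hg b hb)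
  linarith [norm_add_le (l a x • g b) (l b x • g a), this a ha b hb, this b hb a ha]

theorem norm_gradAt_vertexPoly_le (h : IsBary T l g) {K : ℝ} (hg : ∀ a ∈ T, ‖g a‖ ≤ K) {x : E3}
    (hx : x ∈ convexHull ℝ (T : Set E3)) {a : E3} (ha : a ∈ T) :
    ‖P2.gradAt x (vertexPoly l g a)‖ ≤ 14 * K := by
  rw [vertexPoly, map_sub, map_smul, map_smul, h.gradAt_baryLin]
  have h1 := norm_sub_le ((5 : ℝ) • P2.gradAt x (baryMul l g a a)) ((4 : ℝ) • g a)
  rw [norm_smul, norm_smul] at h1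
  norm_num at h1
  linarith [h.norm_gradAt_baryMul_le hg hx ha ha, hg a ha]

theorem norm_gradAt_sum_vertexPoly_le (h : IsBary T l g) {K : ℝ} (hg : ∀ a ∈ T, ‖g a‖ ≤ K)
    {x : E3} (hx : x ∈ convexHull ℝ (T : Set E3)) {X : Finset E3} (hX : X ⊆ T) :
    ‖P2.gradAt x (∑ a ∈ X, vertexPoly l g a)‖ ≤ X.card * (14 * K) := by
  rw [map_sum, ← nsmul_eq_mul]
  exact norm_sum_le_of_le _ (fun a ha => h.norm_gradAt_vertexPoly_le hg hx (hX ha)) |>.trans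
    (by rw [Finset.sum_const])

theorem norm_gradAt_facePoly_le (h : IsBary T l g) (hT : T.card = 4) {K : ℝ}
    (hg : ∀ a ∈ T, ‖g a‖ ≤ K) {x : E3} (hx : x ∈ convexHull ℝ (T : Set E3)) {F : Finset E3}
    (hF : F ⊆ T) (hF3 : F.card = 3) : ‖P2.gradAt x (facePoly T l g F)‖ ≤ 102 * K := by
  rw [facePoly, map_sub, map_smul, map_smul]
  have h1 := norm_sub_le ((6 / 7 : ℝ) • P2.gradAt x (∑ a ∈ T, vertexPoly l g a))
    ((9 / 7 : ℝ) • P2.gradAt x (∑ a ∈ F, vertexPoly l g a))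
  have h2 := h.norm_gradAt_sum_vertexPoly_le hg hx (Finset.Subset.refl T)
  have h3 := h.norm_gradAt_sum_vertexPoly_le hg hx hF
  rw [hT] at h2
  rw [hF3] at h3
  rw [norm_smul, norm_smul] at h1
  norm_num [-map_sum] at h1 h2 h3
  linarith

theorem norm_gradAt_edgePoly_le (h : IsBary T l g) (hT : T.card = 4) {K : ℝ}
    (hg : ∀ a ∈ T, ‖g a‖ ≤ K) {x : E3} (hx : x ∈ convexHull ℝ (T : Set E3)) {e : Finset E3}
    (he : e ⊆ T) (he2 : e.card = 2) : ‖P2.gradAt x (edgePoly T l g e)‖ ≤ 127 * K := by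
  rw [edgePoly, map_add, map_sub, map_smul, map_smul, map_smul]
  have h0 := norm_add_le ((10 / 7 : ℝ) • P2.gradAt x (∑ a ∈ e, vertexPoly l g a) -
      (10 / 21 : ℝ) • P2.gradAt x (∑ a ∈ T, vertexPoly l g a))
    ((5 : ℝ) • P2.gradAt x (∑ a ∈ e, ∑ b ∈ e, baryMul l g a b - ∑ a ∈ e, baryMul l g a a))
  have h1 := norm_sub_le ((10 / 7 : ℝ) • P2.gradAt x (∑ a ∈ e, vertexPoly l g a))
    ((10 / 21 : ℝ) • P2.gradAt x (∑ a ∈ T, vertexPoly l g a))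
  have h2 := h.norm_gradAt_sum_vertexPoly_le hg hx (Finset.Subset.refl T)
  have h3 := h.norm_gradAt_sum_vertexPoly_le hg hx he
  rw [map_sub] at h0 ⊢
  have h4 := norm_sub_le (P2.gradAt x (∑ a ∈ e, ∑ b ∈ e, baryMul l g a b))
    (P2.gradAt x (∑ a ∈ e, baryMul l g a a))
  have h5 : ‖P2.gradAt x (∑ a ∈ e, baryMul l g a a)‖ ≤ 4 * K := by
    rw [map_sum]
    refine (norm_sum_le_of_le _ fun a ha =>
      h.norm_gradAt_baryMul_le hg hx (he ha) (he ha)).trans ?_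
    rw [Finset.sum_const, he2, nsmul_eq_mul]
    push_cast
    linarith
  have h6 : ‖P2.gradAt x (∑ a ∈ e, ∑ b ∈ e, baryMul l g a b)‖ ≤ 8 * K := by
    simp_rw [map_sum]
    refine (norm_sum_le_of_le _ fun a ha => norm_sum_le_of_le _ fun b hb =>
      h.norm_gradAt_baryMul_le hg hx (he ha) (he hb)).trans ?_
    simp_rw [Finset.sum_const, he2, nsmul_eq_mul]
    push_cast
    linarith
  rw [hT] at h2
  rw [he2] at h3
  rw [norm_smul] at h0
  rw [norm_smul, norm_smul] at h1
  norm_num [-map_sum] at h0 h1 h2 h3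
  have hK := (norm_nonneg _).trans h5
  linarith

/-- Four face functions and six edge functions: 4 · 102 + 6 · 127 = 1170. -/
theorem norm_gradAt_interp_le (h : IsBary T l g) (hT : T.card = 4) {K δ : ℝ}
    (hg : ∀ a ∈ T, ‖g a‖ ≤ K) {x : E3} (hx : x ∈ convexHull ℝ (T : Set E3))
    {d : Finset E3 → ℝ} (hd : ∀ S ⊆ T, |d S| ≤ δ) :
    ‖P2.gradAt x (interp T l g d)‖ ≤ 1200 * (K * δ) := by
  have hδ : 0 ≤ δ := (abs_nonneg _).trans (hd ∅ (Finset.empty_subset T))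
  change ‖P2.gradAt x (∑ F ∈ T.powersetCard 3, d F • facePoly T l g F
    + ∑ e ∈ T.powersetCard 2, d e • edgePoly T l g e)‖ ≤ _
  obtain ⟨a, ha⟩ := Finset.card_pos.1 (show 0 < T.card by omega)
  have hK : 0 ≤ K := (norm_nonneg _).trans (hg a ha)
  rw [map_add, map_sum, map_sum]
  refine (norm_add_le _ _).trans ?_
  have h1 : ‖∑ F ∈ T.powersetCard 3, P2.gradAt x (d F • facePoly T l g F)‖
      ≤ ∑ F ∈ T.powersetCard 3, δ * (102 * K) := norm_sum_le_of_le _ fun F hF => by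
    obtain ⟨h1, h2⟩ := Finset.mem_powersetCard.1 hF
    rw [map_smul, norm_smul]
    exact mul_le_mul (hd F h1) (h.norm_gradAt_facePoly_le hT hg hx h1 h2) (norm_nonneg _) hδ
  have h2 : ‖∑ e ∈ T.powersetCard 2, P2.gradAt x (d e • edgePoly T l g e)‖
      ≤ ∑ e ∈ T.powersetCard 2, δ * (127 * K) := norm_sum_le_of_le _ fun F hF => by
    obtain ⟨h1, h2⟩ := Finset.mem_powersetCard.1 hF
    rw [map_smul, norm_smul]
    exact mul_le_mul (hd F h1) (h.norm_gradAt_edgePoly_le hT hg hx h1 h2) (norm_nonneg _) hδ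
  rw [Finset.sum_const, Finset.card_powersetCard, hT, nsmul_eq_mul,
    show Nat.choose 4 3 = 4 from rfl] at h1
  rw [Finset.sum_const, Finset.card_powersetCard, hT, nsmul_eq_mul,
    show Nat.choose 4 2 = 6 from rfl] at h2
  push_cast at h1 h2
  have := mul_nonneg hK hδ
  linarith

end IsBary

/-! ### Coercivity on one element -/

theorem Finset.isCompact_hull (S : Finset E3) : IsCompact (convexHull ℝ (S : Set E3)) :=
  S.finite_toSet.isCompact_convexHull (𝕜 := ℝ)

namespace IsBary

variable {T : Finset E3} {l : E3 → E3 → ℝ} {g : E3 → E3} {σ H : ℝ}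

theorem volume_pos (h : IsBary T l g) : 0 < volume.real (convexHull ℝ (T : Set E3)) := by
  refine ENNReal.toReal_pos (ne_of_gt ?_) T.isCompact_hull.measure_ne_top
  exact (isOpen_interior.measure_pos volume h.interior_nonempty).trans_le
    (measure_mono interior_subset)

theorem norm_gradAt_le (h : IsBary T l g) {w : P2} {K : ℝ} (hK : ∀ a ∈ T, ‖P2.gradAt a w‖ ≤ K)
    {x : E3} (hx : x ∈ convexHull ℝ (T : Set E3)) : ‖P2.gradAt x w‖ ≤ K := by
  rw [P2.gradAt_eq_sum h w x]
  calc ‖∑ a ∈ T, l a x • P2.gradAt a w‖ ≤ ∑ a ∈ T, l a x * K :=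
        norm_sum_le_of_le _ fun a ha => by
          rw [norm_smul, Real.norm_of_nonneg (h.mem_hull.1 hx a ha)]
          exact mul_le_mul_of_nonneg_left (hK a ha) (h.mem_hull.1 hx a ha)
    _ = K := by rw [← Finset.sum_mul, h.sum_eq, one_mul]

/-- The maximal vertex gradient has weight at least 3/4 and the others together at most 1/4. -/
theorem norm_gradAt_ge (h : IsBary T l g) {w : P2} {K : ℝ} (hK : ∀ a ∈ T, ‖P2.gradAt a w‖ ≤ K)
    {a₁ : E3} (ha₁ : a₁ ∈ T) (hK₁ : ‖P2.gradAt a₁ w‖ = K)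
    {x : E3} (hx : x ∈ convexHull ℝ (T : Set E3)) (hl : 3 / 4 ≤ l a₁ x) :
    K / 2 ≤ ‖P2.gradAt x w‖ := by
  have hK0 : 0 ≤ K := hK₁ ▸ norm_nonneg _
  rw [P2.gradAt_eq_sum h w x, ← Finset.add_sum_erase T _ ha₁]
  have h1 : ‖∑ a ∈ T.erase a₁, l a x • P2.gradAt a w‖ ≤ (1 - l a₁ x) * K :=
    calc ‖∑ a ∈ T.erase a₁, l a x • P2.gradAt a w‖ ≤ ∑ a ∈ T.erase a₁, l a x * K :=
          norm_sum_le_of_le _ fun a ha => by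
            have ha := Finset.mem_of_mem_erase ha
            rw [norm_smul, Real.norm_of_nonneg (h.mem_hull.1 hx a ha)]
            exact mul_le_mul_of_nonneg_left (hK a ha) (h.mem_hull.1 hx a ha)
      _ = (1 - l a₁ x) * K := by
          rw [← Finset.sum_mul, ← h.sum_eq x, ← Finset.add_sum_erase T _ ha₁]; ring
  have h2 : ‖l a₁ x • P2.gradAt a₁ w‖ = l a₁ x * K := by
    rw [norm_smul, hK₁, Real.norm_of_nonneg (by linarith)]
  have h3 := norm_sub_le_norm_add (l a₁ x • P2.gradAt a₁ w)
    (∑ a ∈ T.erase a₁, l a x • P2.gradAt a w)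
  nlinarith

/-- On the copy of `T` shrunk by 1/4 towards `a₁`, of relative volume 1/64, the coordinate of `a₁`
is at least 3/4, so the squared gradient is at least `K ^ 2 / 4`. -/
theorem integral_norm_sq_ge (h : IsBary T l g) {w : P2} {K : ℝ}
    (hK : ∀ a ∈ T, ‖P2.gradAt a w‖ ≤ K) {a₁ : E3} (ha₁ : a₁ ∈ T) (hK₁ : ‖P2.gradAt a₁ w‖ = K) :
    volume.real (convexHull ℝ (T : Set E3)) * (K ^ 2 / 256) ≤
      ∫ x in convexHull ℝ (T : Set E3), ‖P2.gradAt x w‖ ^ 2 := by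
  have hK0 : 0 ≤ K := hK₁ ▸ norm_nonneg _
  set C := convexHull ℝ (T : Set E3) with hC
  set C' := AffineMap.homothety a₁ (1 / 4 : ℝ) '' C with hC'
  have hcomp : IsCompact C := T.isCompact_hull
  have hcomp' : IsCompact C' :=
    hcomp.image (AffineMap.homothety a₁ (1 / 4 : ℝ)).continuous_of_finiteDimensional
  have ha₁C : a₁ ∈ C := subset_convexHull ℝ _ ha₁
  have himg : ∀ y, AffineMap.homothety a₁ (1 / 4 : ℝ) y = a₁ + (1 / 4 : ℝ) • (y - a₁) := fun y => by
    rw [AffineMap.homothety_apply, vsub_eq_sub, vadd_eq_add, add_comm]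
  have hsub : C' ⊆ C := by
    rintro _ ⟨y, hy, rfl⟩
    rw [himg]
    exact (convex_convexHull ℝ (T : Set E3)).add_smul_sub_mem ha₁C hy ⟨by norm_num, by norm_num⟩
  have hint : ∀ {S : Set E3}, IsCompact S →
      IntegrableOn (fun x => ‖P2.gradAt x w‖ ^ 2) S volume := fun hS =>
    ((w.continuous_gradAt.norm.pow 2).continuousOn).integrableOn_compact hS
  have hvol : volume.real C' = 1 / 64 * volume.real C := by
    rw [Measure.real, hC', Measure.addHaar_image_homothety, ENNReal.toReal_mul,
      finrank_euclideanSpace, Fintype.card_fin, ENNReal.toReal_ofReal (abs_nonneg _), Measure.real]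
    norm_num
  have h1 : (K / 2) ^ 2 * volume.real C' ≤ ∫ x in C', ‖P2.gradAt x w‖ ^ 2 := by
    refine setIntegral_ge_of_const_le_real hcomp'.measurableSet hcomp'.measure_ne_top ?_
      (hint hcomp')
    rintro _ ⟨y, hy, rfl⟩
    have hx := hsub ⟨y, hy, rfl⟩
    refine pow_le_pow_left₀ (by positivity) (h.norm_gradAt_ge hK ha₁ hK₁ hx ?_) 2
    rw [himg, h.line, h.self a₁ ha₁]
    linarith [h.mem_hull.1 hy a₁ ha₁]
  have h2 : ∫ x in C', ‖P2.gradAt x w‖ ^ 2 ≤ ∫ x in C, ‖P2.gradAt x w‖ ^ 2 :=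
    setIntegral_mono_set (hint hcomp) (Filter.Eventually.of_forall fun x => by positivity)
      (LE.le.eventuallyLE hsub)
  rw [hvol] at h1
  linarith

/-- The variation of a quadratic polynomial over a short distance. -/
theorem abs_val_sub_le (h : IsBary T l g) (hT : T.card = 4) (hs : IsSized T g σ H) {w : P2}
    {K : ℝ} (hK : ∀ a ∈ T, ‖P2.gradAt a w‖ ≤ K) {ε : ℝ} (hε : σ * ε ≤ 1)
    {G P : E3} (hG : G ∈ convexHull ℝ (T : Set E3)) (hP : dist G P ≤ ε * H) :
    |w.val P - w.val G| ≤ 8 * (ε * H * K) := by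
  rw [w.sub_eq_inner]
  refine (abs_real_inner_le_norm _ _).trans ?_
  have hε0 : 0 ≤ ε := by
    by_contra! hneg
    have := mul_neg_of_neg_of_pos hneg hs.pos
    linarith [dist_nonneg (x := G) (y := P)]
  -- The mid-point may leave `T`, but only so far that each coordinate changes by at most 1; with
  -- four vertices this gives the factor 8.
  have h1 : ∀ a ∈ T, |l a (midpoint ℝ P G)| ≤ 2 := by
    intro a ha
    have e1 := h.mem_hull.1 hG a ha
    have e2 := h.le_one hG ha
    have e3 : |inner ℝ (g a) (midpoint ℝ P G - G)| ≤ 1 := by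
      refine (abs_real_inner_le_norm _ _).trans ?_
      have : ‖midpoint ℝ P G - G‖ ≤ ε * H := by
        rw [← dist_eq_norm, dist_midpoint_right, dist_comm]
        norm_num
        linarith [dist_nonneg (x := G) (y := P)]
      calc ‖g a‖ * ‖midpoint ℝ P G - G‖ ≤ ‖g a‖ * (ε * H) :=
            mul_le_mul_of_nonneg_left this (norm_nonneg _)
        _ = ε * (‖g a‖ * H) := by ring
        _ ≤ ε * σ := mul_le_mul_of_nonneg_left (hs.grad a ha) hε0
        _ ≤ 1 := by linarith
    rw [h.eq_add a _ G, abs_le]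
    rw [abs_le] at e3
    constructor <;> linarith [e3.1, e3.2]
  have h2 : ‖P2.gradAt (midpoint ℝ P G) w‖ ≤ 8 * K := by
    rw [P2.gradAt_eq_sum h]
    calc ‖∑ a ∈ T, l a (midpoint ℝ P G) • P2.gradAt a w‖ ≤ ∑ a ∈ T, 2 * K :=
          norm_sum_le_of_le _ fun a ha => by
            rw [norm_smul, Real.norm_eq_abs]
            exact mul_le_mul (h1 a ha) (hK a ha) (norm_nonneg _) (by norm_num)
      _ = 8 * K := by rw [Finset.sum_const, hT, nsmul_eq_mul]; push_cast; ring
  rw [dist_comm, dist_eq_norm] at hP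
  calc _ ≤ 8 * K * (ε * H) := mul_le_mul h2 hP (norm_nonneg _) ((norm_nonneg _).trans h2)
    _ = _ := by ring

/-- Perturbing the degrees of freedom a little does not destroy coercivity. -/
theorem coercive (h : IsBary T l g) (hT : T.card = 4) (hs : IsSized T g σ H) (hσ : 1 ≤ σ) {w : P2}
    {K : ℝ} (hK : ∀ a ∈ T, ‖P2.gradAt a w‖ ≤ K) {a₁ : E3} (ha₁ : a₁ ∈ T)
    (hK₁ : ‖P2.gradAt a₁ w‖ = K) {d : Finset E3 → ℝ}
    (hd : ∀ S ⊆ T, |d S| ≤ 8 * (1 / (10 ^ 7 * σ) * H * K)) :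
    volume.real (convexHull ℝ (T : Set E3)) * (K ^ 2 / 512) ≤
      ∫ x in convexHull ℝ (T : Set E3),
        inner ℝ (P2.gradAt x w) (P2.gradAt x (w + interp T l g d)) := by
  have hK0 : 0 ≤ K := hK₁ ▸ norm_nonneg _
  have hσ0 : 0 < σ := by linarith
  set C := convexHull ℝ (T : Set E3) with hC
  have hcomp : IsCompact C := T.isCompact_hull
  have hg : ∀ a ∈ T, ‖g a‖ ≤ σ / H := fun a ha => (le_div_iff₀ hs.pos).2 (hs.grad a ha)
  -- The tolerance `1 / (10 ^ 7 * σ)` cancels `σ / H`, leaving 9600 / 10⁷ < 1/512. The perturbation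
  -- thus consumes at most half of the bound with 1/256 from `integral_norm_sq_ge`.
  have hI : ∀ x ∈ C, ‖P2.gradAt x (interp T l g d)‖ ≤ K / 512 := fun x hx => by
    refine (h.norm_gradAt_interp_le hT hg hx hd).trans ?_
    have : 1200 * (σ / H * (8 * (1 / (10 ^ 7 * σ) * H * K))) = 9600 / 10 ^ 7 * K := by
      have := hs.pos
      field_simp
      norm_num
      ring
    rw [this]
    linarith
  have hpt : ∀ x ∈ C, ‖P2.gradAt x w‖ ^ 2 - K ^ 2 / 512 ≤
      inner ℝ (P2.gradAt x w) (P2.gradAt x (w + interp T l g d)) := fun x hx => by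
    rw [map_add, inner_add_right, real_inner_self_eq_norm_sq]
    have h1 := abs_real_inner_le_norm (P2.gradAt x w) (P2.gradAt x (interp T l g d))
    have h2 := mul_le_mul (h.norm_gradAt_le hK hx) (hI x hx) (norm_nonneg _) hK0
    have h3 := neg_abs_le (inner ℝ (P2.gradAt x w) (P2.gradAt x (interp T l g d)) : ℝ)
    linarith
  have i1 : IntegrableOn (fun x => ‖P2.gradAt x w‖ ^ 2) C volume :=
    ((w.continuous_gradAt.norm.pow 2).continuousOn).integrableOn_compact hcomp
  have i2 : IntegrableOn (fun _ => K ^ 2 / 512) C volume :=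
    integrableOn_const hcomp.measure_ne_top
  have i3 : IntegrableOn (fun x => inner ℝ (P2.gradAt x w) (P2.gradAt x (w + interp T l g d))) C
      volume :=
    ((w.continuous_gradAt.inner (P2.continuous_gradAt _)).continuousOn).integrableOn_compact hcomp
  have h1 := setIntegral_mono_on (i1.sub i2) i3 hcomp.measurableSet hpt
  have h2 := h.integral_norm_sq_ge hK ha₁ hK₁
  simp only [Pi.sub_apply] at h1
  rw [integral_sub i1 i2, setIntegral_const, smul_eq_mul] at h1
  linarith

end IsBary

/-! ### Transfer from nodes on Γ to centroids and mid-points -/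

namespace TetMesh

variable {M : TetMesh}

open Classical in
/-- The difference between the degrees of freedom at the nodes `P`, `Q` and the original ones. -/
def defect (M : TetMesh) (P Q : Finset E3 → E3) : P2 →ₗ[ℝ] (Finset E3 → ℝ) :=
  LinearMap.pi fun S =>
    if M.IsBdryFace S then P2.evalAt (P S) - P2.evalAt (S.centroid ℝ id)
    else if M.IsBdryEdge S then P2.edgeMeanAt S (Q S) - P2.edgeMeanAt S (S.centroid ℝ id)
    else 0

theorem defect_face {P Q : Finset E3 → E3} {F : Finset E3} (hF : M.IsBdryFace F) (w : P2) :
    M.defect P Q w F = w.val (P F) - w.mu F := by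
  simp only [defect, LinearMap.pi_apply, if_pos hF]; rfl

theorem defect_edge {P Q : Finset E3 → E3} {e : Finset E3} (he : M.IsBdryEdge e) (w : P2) :
    M.defect P Q w e = w.edgeMean e (Q e) - w.nu e := by
  have : ¬ M.IsBdryFace e := fun h => by have := h.1.1; have := he.1.1; omega
  simp only [defect, LinearMap.pi_apply, if_neg this, if_pos he]; rfl

theorem defect_inner {P Q : Finset E3 → E3} {S : Finset E3} (hF : ¬ M.IsBdryFace S)
    (he : ¬ M.IsBdryEdge S) (w : P2) : M.defect P Q w S = 0 := by
  simp only [defect, LinearMap.pi_apply, if_neg hF, if_neg he]; rfl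

/-- The polynomial whose unperturbed degrees of freedom are the perturbed ones of `w`. -/
def transfer (M : TetMesh) (P Q : Finset E3 → E3) (T : Finset E3) (l : E3 → E3 → ℝ) (g : E3 → E3) :
    P2 →ₗ[ℝ] P2 := LinearMap.id + (interp T l g).comp (M.defect P Q)

theorem transfer_apply (P Q : Finset E3 → E3) (T : Finset E3) (l : E3 → E3 → ℝ) (g : E3 → E3)
    (w : P2) : M.transfer P Q T l g w = w + interp T l g (M.defect P Q w) := rfl

variable {T : Finset E3} {l : E3 → E3 → ℝ} {g : E3 → E3} {P Q : Finset E3 → E3}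

theorem mu_transfer (hT : T ∈ M.elems) (h : IsBary T l g) {F : Finset E3} (hFT : F ⊆ T)
    (h3 : F.card = 3) (w : P2) : (M.transfer P Q T l g w).mu F = w.mu F + M.defect P Q w F := by
  rw [← h.mu_interp (M.card_eq T hT) (M.defect P Q w) hFT h3]
  exact P2.val_add _ _ _

theorem nu_transfer (h : IsBary T l g) {e : Finset E3} (heT : e ⊆ T)
    (h2 : e.card = 2) (w : P2) : (M.transfer P Q T l g w).nu e = w.nu e + M.defect P Q w e := by
  rw [← h.nu_interp (M.defect P Q w) heT h2]
  exact P2.edgeMean_add _ _ _ _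

/-- Coercivity of the local form between a polynomial and its transfer. -/
theorem local_coercive {σ : ℝ} (hσ : 1 ≤ σ) (hreg : M.ShapeRegular σ)
    (hP : ∀ F, M.IsBdryFace F →
      dist (F.centroid ℝ id) (P F) ≤ 1 / (10 ^ 7 * σ) * Metric.diam (F : Set E3))
    (hQ : ∀ e, M.IsBdryEdge e →
      dist (e.centroid ℝ id) (Q e) ≤ 1 / (10 ^ 7 * σ) * Metric.diam (e : Set E3))
    (hT : T ∈ M.elems) (h : IsBary T l g) (w : P2) :
    0 ≤ ∫ x in convexHull ℝ (T : Set E3),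
        inner ℝ (P2.gradAt x w) (P2.gradAt x (M.transfer P Q T l g w)) ∧
    (∫ x in convexHull ℝ (T : Set E3),
        inner ℝ (P2.gradAt x w) (P2.gradAt x (M.transfer P Q T l g w)) ≤ 0 →
      ∀ x y, w.val x = w.val y) := by
  have hσ0 : 0 < σ := by linarith
  have hs := hreg.isSized hT h
  set H := Metric.diam (convexHull ℝ (T : Set E3)) with hH
  obtain ⟨a₁, ha₁, hmax⟩ := T.exists_max_image (fun a => ‖P2.gradAt a w‖)
    (Finset.card_pos.1 (by rw [M.card_eq T hT]; norm_num))
  set K := ‖P2.gradAt a₁ w‖ with hK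
  have hK0 : 0 ≤ K := norm_nonneg _
  have hεσ : σ * (1 / (10 ^ 7 * σ)) ≤ 1 := by
    have : σ * (1 / (10 ^ 7 * σ)) = 1 / 10 ^ 7 := by field_simp
    rw [this]; norm_num
  have hvar : ∀ {S : Finset E3} {X : E3}, S ⊆ T → S.Nonempty →
      dist (S.centroid ℝ id) X ≤ 1 / (10 ^ 7 * σ) * Metric.diam (S : Set E3) →
      |w.val X - w.val (S.centroid ℝ id)| ≤ 8 * (1 / (10 ^ 7 * σ) * H * K) := by
    intro S X hS hne hd
    exact h.abs_val_sub_le (M.card_eq T hT) hs hmax hεσ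
      (convexHull_mono (by exact_mod_cast hS) (h.centroid_mem hS hne))
      (hd.trans (mul_le_mul_of_nonneg_left (diam_le_diam_hull hS) (by positivity)))
  have hd : ∀ S ⊆ T, |M.defect P Q w S| ≤ 8 * (1 / (10 ^ 7 * σ) * H * K) := by
    intro S hS
    by_cases hF : M.IsBdryFace S
    · rw [defect_face hF]
      exact hvar hS (Finset.card_pos.1 (by rw [hF.1.1]; norm_num)) (hP S hF)
    by_cases he : M.IsBdryEdge S
    · rw [defect_edge he]
      have h1 := hvar hS (Finset.card_pos.1 (by rw [he.1.1]; norm_num)) (hQ S he)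
      have h2 : w.edgeMean S (Q S) - w.nu S
          = 2 / 5 * (w.val (Q S) - w.val (S.centroid ℝ id)) := by
        rw [P2.nu, P2.edgeMean, P2.edgeMean]; ring
      rw [h2, abs_mul, abs_of_pos (by norm_num)]
      linarith [abs_nonneg (w.val (Q S) - w.val (S.centroid ℝ id))]
    · rw [defect_inner hF he, abs_zero]
      have := hs.pos
      positivity
  have hc := h.coercive (M.card_eq T hT) hs hσ hmax ha₁ rfl hd
  have hv := h.volume_pos
  refine ⟨le_trans (by positivity) hc, fun hle => ?_⟩
  -- The lower bound is a positive multiple of `K ^ 2`; so all vertex gradients vanish, and with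
  -- them the gradient everywhere.
  have hK00 : K = 0 := by
    by_contra hne
    have : 0 < K := lt_of_le_of_ne hK0 (Ne.symm hne)
    have h1 : 0 < volume.real (convexHull ℝ (T : Set E3)) * (K ^ 2 / 512) := by positivity
    exact absurd (h1.trans_le (hc.trans hle)) (lt_irrefl _)
  have hg0 : ∀ x, P2.gradAt x w = 0 := fun x => by
    rw [P2.gradAt_eq_sum h w x]
    refine Finset.sum_eq_zero fun a ha => ?_
    have : ‖P2.gradAt a w‖ ≤ 0 := hK00 ▸ hmax a ha
    rw [norm_le_zero_iff.1 this, smul_zero]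
  intro x y
  have := w.sub_eq_inner x y
  rw [hg0, inner_zero_left] at this
  linarith

end TetMesh

/-! ### Well-posedness of the discrete problem -/

/-- Nondegeneracy on one side suffices, as a finite-dimensional space and its dual have equal
dimension. -/
theorem LinearMap.exists_eq_of_nondegenerate {V : Type*} [AddCommGroup V] [Module ℝ V]
    [FiniteDimensional ℝ V] (B : V →ₗ[ℝ] V →ₗ[ℝ] ℝ) (hB : ∀ z, B z = 0 → z = 0)
    (L : V →ₗ[ℝ] ℝ) : ∃ z, B z = L :=
  (LinearMap.injective_iff_surjective_of_finrank_eq_finrank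
    (Subspace.dual_finrank_eq (K := ℝ) (V := V)).symm).1
    ((injective_iff_map_eq_zero B).2 hB) L

namespace TetMesh

variable {M : TetMesh} {P Q : Finset E3 → E3}

theorem integrableOn_inner_gradAt (p q : P2) (T : Finset E3) :
    IntegrableOn (fun x => inner ℝ (P2.gradAt x p) (P2.gradAt x q)) (convexHull ℝ (T : Set E3))
      volume :=
  ((p.continuous_gradAt.inner q.continuous_gradAt).continuousOn).integrableOn_compact
    T.isCompact_hull

theorem form_eq (w v : M.Broken) : M.form w v = ∑ T : M.elems,
    ∫ x in convexHull ℝ (T.1 : Set E3), inner ℝ (P2.gradAt x (w T)) (P2.gradAt x (v T)) := rfl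

/-- The form as a bilinear map. -/
def bilin (M : TetMesh) : M.Broken →ₗ[ℝ] M.Broken →ₗ[ℝ] ℝ :=
  LinearMap.mk₂ ℝ M.form
    (fun w w' v => by
      simp only [form_eq, ← Finset.sum_add_distrib, Pi.add_apply, map_add, inner_add_left]
      exact Finset.sum_congr rfl fun T _ =>
        integral_add (integrableOn_inner_gradAt _ _ _) (integrableOn_inner_gradAt _ _ _))
    (fun c w v => by
      simp only [form_eq, Finset.smul_sum, Pi.smul_apply, map_smul, real_inner_smul_left]
      exact Finset.sum_congr rfl fun T _ => integral_const_mul _ _)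
    (fun w v v' => by
      simp only [form_eq, ← Finset.sum_add_distrib, Pi.add_apply, map_add, inner_add_right]
      exact Finset.sum_congr rfl fun T _ =>
        integral_add (integrableOn_inner_gradAt _ _ _) (integrableOn_inner_gradAt _ _ _))
    (fun c w v => by
      simp only [form_eq, Finset.smul_sum, Pi.smul_apply, map_smul, inner_smul_right]
      exact Finset.sum_congr rfl fun T _ => integral_const_mul _ _)

theorem integrableOn_load {Ω : Set E3} (hΩ : IsOpen Ω) (hb : Bornology.IsBounded Ω) {f : E3 → ℝ}
    (hf : MemLp f 2 (volume.restrict Ω)) (p : P2) (T : Finset E3) :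
    IntegrableOn (fun x => Ω.indicator f x * p.val x) (convexHull ℝ (T : Set E3)) volume := by
  have : IsFiniteMeasure (volume.restrict Ω) := ⟨by
    rw [Measure.restrict_apply_univ]; exact hb.measure_lt_top⟩
  have h1 : IntegrableOn f Ω volume := hf.integrable (by norm_num)
  have h2 : Integrable (Ω.indicator f) volume := h1.integrable_indicator hΩ.measurableSet
  exact h2.integrableOn.mul_continuousOn p.continuous_val.continuousOn T.isCompact_hull

/-- The load as a linear map. -/
def loadMap (M : TetMesh) {Ω : Set E3} (hΩ : IsOpen Ω) (hb : Bornology.IsBounded Ω) {f : E3 → ℝ}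
    (hf : MemLp f 2 (volume.restrict Ω)) : M.Broken →ₗ[ℝ] ℝ where
  toFun v := M.load Ω f v
  map_add' v v' := by
    simp only [load, ← Finset.sum_add_distrib, Pi.add_apply, P2.val_add, mul_add]
    exact Finset.sum_congr rfl fun T _ =>
      integral_add (integrableOn_load hΩ hb hf _ _) (integrableOn_load hΩ hb hf _ _)
  map_smul' c v := by
    simp only [load, smul_eq_mul, Finset.mul_sum, Pi.smul_apply, P2.val_smul, RingHom.id_apply]
    refine Finset.sum_congr rfl fun T _ => ?_
    rw [← integral_const_mul]
    exact integral_congr_ae (Filter.Eventually.of_forall fun x => by ring)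

/-- A piecewise constant function of the trial space vanishes. -/
theorem eq_zero_of_const {w : M.Broken} (hw : w ∈ M.trialSpace P Q)
    (hc : ∀ T x y, (w T).val x = (w T).val y) : w = 0 := by
  classical
  obtain ⟨⟨hin, _⟩, hF, _⟩ := hw
  by_contra hne
  obtain ⟨T₀, hT₀⟩ := Function.ne_iff.1 hne
  set c := (w T₀).val 0 with hcdef
  have hc0 : c ≠ 0 := fun h0 => hT₀ (P2.ext_val fun x => by
    rw [hc T₀ x 0, ← hcdef, h0]; simp)
  -- The elements with the constant `c`. A face unshared within this family is unshared in the mesh,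
  -- since matching at an inner face would bring its neighbour into the family; so it is a boundary
  -- face, and the node condition gives `c = 0`.
  set E : Finset (Finset E3) :=
    M.elems.filter (fun T => ∃ h : T ∈ M.elems, (w ⟨T, h⟩).val 0 = c) with hE
  obtain ⟨T, hT, F, hFT, h3, huniq⟩ := exists_unshared (M := M) (E := E)
    (Finset.filter_subset _ _) ⟨T₀.1, Finset.mem_filter.2 ⟨T₀.2, T₀.2, rfl⟩⟩
  obtain ⟨hTM, _, hTc⟩ := Finset.mem_filter.1 hT
  by_cases hFb : M.IsBdryFace F
  · apply hc0
    rw [← hTc, hc ⟨T, hTM⟩ 0 (P F)]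
    exact hF F hFb ⟨T, hTM⟩ hFT
  · refine hFb (isBdryFace_of_unshared hTM hFT h3 fun T' hT' hFT' => ?_)
    refine huniq T' (Finset.mem_filter.2 ⟨hT', hT', ?_⟩) hFT'
    have hmu := hin F ⟨h3, T, hTM, hFT⟩ hFb ⟨T, hTM⟩ ⟨T', hT'⟩ hFT hFT'
    rw [P2.mu, P2.mu, hc ⟨T, hTM⟩ _ 0, hc ⟨T', hT'⟩ _ 0] at hmu
    rw [← hmu, hTc]

theorem defect_eq_zero_of_const {w : P2} (hc : ∀ x y, w.val x = w.val y) :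
    M.defect P Q w = 0 := by
  funext S
  by_cases hF : M.IsBdryFace S
  · rw [defect_face hF, P2.mu, hc (P S) (S.centroid ℝ id), sub_self]; rfl
  by_cases he : M.IsBdryEdge S
  · rw [defect_edge he, P2.nu, P2.edgeMean, P2.edgeMean, hc (Q S) (S.centroid ℝ id), sub_self]; rfl
  · rw [defect_inner hF he]; rfl

/-- The problem is well posed when the nodes are close enough to centroids and mid-points. -/
theorem existsUnique_solution {σ : ℝ} (hσ : 1 ≤ σ) (hreg : M.ShapeRegular σ)
    (hP : ∀ F, M.IsBdryFace F →
      dist (F.centroid ℝ id) (P F) ≤ 1 / (10 ^ 7 * σ) * Metric.diam (F : Set E3))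
    (hQ : ∀ e, M.IsBdryEdge e →
      dist (e.centroid ℝ id) (Q e) ≤ 1 / (10 ^ 7 * σ) * Metric.diam (e : Set E3))
    (L : M.Broken →ₗ[ℝ] ℝ) :
    ∃! u : M.Broken, u ∈ M.trialSpace P Q ∧ ∀ v ∈ M.testSpace, M.form u v = L v := by
  choose l g hb using fun T : M.elems => exists_bary T.2
  set Φ : M.Broken →ₗ[ℝ] M.Broken :=
    LinearMap.pi fun T => (M.transfer P Q T.1 (l T) (g T)).comp (LinearMap.proj T) with hΦ
  have hΦapp : ∀ w T, Φ w T = M.transfer P Q T.1 (l T) (g T) (w T) := fun _ _ => rfl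
  have hloc := fun (T : M.elems) (w : P2) => local_coercive hσ hreg hP hQ T.2 (hb T) w
  -- If the transfer of `w T` is 0, the local form vanishes and `w T` is constant; constants have no
  -- defect, so the transfer is `w T` itself.
  have hinj : Function.Injective Φ := by
    rw [← LinearMap.ker_eq_bot, LinearMap.ker_eq_bot']
    intro w hw
    funext T
    have h0 : M.transfer P Q T.1 (l T) (g T) (w T) = 0 := by rw [← hΦapp, hw]; rfl
    have hc := (hloc T (w T)).2 (by rw [h0]; simp)
    rw [transfer_apply, defect_eq_zero_of_const hc, map_zero, add_zero] at h0
    exact h0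
  have hmu : ∀ (w : M.Broken) (T : M.elems) (F : Finset E3), F ⊆ T.1 → F.card = 3 →
      (Φ w T).mu F = (w T).mu F + M.defect P Q (w T) F := fun w T F hF h3 =>
    mu_transfer T.2 (hb T) hF h3 (w T)
  have hnu : ∀ (w : M.Broken) (T : M.elems) (e : Finset E3), e ⊆ T.1 → e.card = 2 →
      (Φ w T).nu e = (w T).nu e + M.defect P Q (w T) e := fun w T e he h2 =>
    nu_transfer (hb T) he h2 (w T)
  have hmu_in : ∀ (w : M.Broken) (T : M.elems) (F : Finset E3), F ⊆ T.1 → M.IsFace F →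
      ¬ M.IsBdryFace F → (Φ w T).mu F = (w T).mu F := fun w T F hF hf hnb => by
    rw [hmu w T F hF hf.1, defect_inner hnb (fun he => by
      have := he.1.1; have := hf.1; omega), add_zero]
  have hnu_in : ∀ (w : M.Broken) (T : M.elems) (e : Finset E3), e ⊆ T.1 → M.IsEdge e →
      ¬ M.IsBdryEdge e → (Φ w T).nu e = (w T).nu e := fun w T e he hf hnb => by
    rw [hnu w T e he hf.1, defect_inner (fun hF => by
      have := hF.1.1; have := hf.1; omega) hnb, add_zero]
  have hmu_bd : ∀ (w : M.Broken) (T : M.elems) (F : Finset E3), F ⊆ T.1 → M.IsBdryFace F →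
      (Φ w T).val (F.centroid ℝ id) = (w T).val (P F) := fun w T F hF hf => by
    have := hmu w T F hF hf.1.1
    rw [defect_face hf, add_sub_cancel] at this
    exact this
  have hnu_bd : ∀ (w : M.Broken) (T : M.elems) (e : Finset E3), e ⊆ T.1 → M.IsBdryEdge e →
      (Φ w T).edgeMean e (e.centroid ℝ id) = (w T).edgeMean e (Q e) := fun w T e he hf => by
    have := hnu w T e he hf.1.1
    rw [defect_edge hf, add_sub_cancel] at this
    exact this
  have hmem : ∀ w, Φ w ∈ M.testSpace ↔ w ∈ M.trialSpace P Q := by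
    intro w
    constructor
    · rintro ⟨⟨h1, h2⟩, h3, h4⟩
      refine ⟨⟨fun F hF hn T T' hT hT' => ?_, fun e he hn T T' hT hT' => ?_⟩,
        fun F hF T hT => ?_, fun e he T hT => ?_⟩
      · rw [← hmu_in w T F hT hF hn, ← hmu_in w T' F hT' hF hn]; exact h1 F hF hn T T' hT hT'
      · rw [← hnu_in w T e hT he hn, ← hnu_in w T' e hT' he hn]; exact h2 e he hn T T' hT hT'
      · rw [← hmu_bd w T F hT hF]; exact h3 F hF T hT
      · rw [← hnu_bd w T e hT he]; exact h4 e he T hT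
    · rintro ⟨⟨h1, h2⟩, h3, h4⟩
      refine ⟨⟨fun F hF hn T T' hT hT' => ?_, fun e he hn T T' hT hT' => ?_⟩,
        fun F hF T hT => ?_, fun e he T hT => ?_⟩
      · rw [hmu_in w T F hT hF hn, hmu_in w T' F hT' hF hn]; exact h1 F hF hn T T' hT hT'
      · rw [hnu_in w T e hT he hn, hnu_in w T' e hT' he hn]; exact h2 e he hn T T' hT hT'
      · rw [hmu_bd w T F hT hF]; exact h3 F hF T hT
      · rw [hnu_bd w T e hT he]; exact h4 e he T hT
  have hpos : ∀ w ∈ M.trialSpace P Q, M.form w (Φ w) = 0 → w = 0 := by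
    intro w hw h0
    refine eq_zero_of_const hw fun T => (hloc T (w T)).2 (le_of_eq ?_)
    rw [form_eq] at h0
    rw [Finset.sum_eq_zero_iff_of_nonneg fun T _ => by exact (hloc T (w T)).1] at h0
    exact h0 T (Finset.mem_univ T)
  let Ψ : M.Broken ≃ₗ[ℝ] M.Broken := LinearEquiv.ofInjectiveEndo Φ hinj
  have hΨ : ∀ w, Ψ w = Φ w := fun _ => rfl
  have hΨs : ∀ z, Φ (Ψ.symm z) = z := fun z => Ψ.apply_symm_apply z
  -- Pulling the trial function back through Φ puts both arguments in the test space; testing with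
  -- `v = z` yields a(w, Φw) and hence nondegeneracy.
  let A : M.testSpace →ₗ[ℝ] M.testSpace →ₗ[ℝ] ℝ :=
    (M.bilin.compl₁₂ Ψ.symm.toLinearMap LinearMap.id).domRestrict₁₂ M.testSpace M.testSpace
  have hA : ∀ z v : M.testSpace, A z v = M.form (Ψ.symm z) v := fun _ _ => rfl
  have hA0 : ∀ z, A z = 0 → z = 0 := by
    intro z hz
    have h1 : Ψ.symm z ∈ M.trialSpace P Q := (hmem _).1 (by rw [hΨs]; exact z.2)
    have h2 : M.form (Ψ.symm z) (Φ (Ψ.symm z)) = 0 := by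
      rw [hΨs, ← hA, hz]; rfl
    have h3 := hpos _ h1 h2
    exact Subtype.ext ((LinearEquiv.map_eq_zero_iff _).1 h3)
  obtain ⟨z, hz⟩ := LinearMap.exists_eq_of_nondegenerate (V := M.testSpace) A hA0 (L.domRestrict M.testSpace)
  refine ⟨Ψ.symm z, ⟨(hmem _).1 (by rw [hΨs]; exact z.2), fun v hv => ?_⟩, ?_⟩
  · have := LinearMap.congr_fun hz ⟨v, hv⟩
    rwa [hA] at this
  · rintro u ⟨hu, huL⟩
    have hzu : (⟨Φ u, (hmem u).2 hu⟩ : M.testSpace) = z := by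
      rw [← sub_eq_zero]
      apply hA0
      rw [map_sub, sub_eq_zero, hz]
      ext v
      rw [hA]
      change M.form (Ψ.symm (Ψ u)) v = L v
      rw [Ψ.symm_apply_apply]
      exact huL v v.2
    rw [← hzu]
    exact (Ψ.symm_apply_apply u).symm

theorem ShapeRegular.mono {σ σ' : ℝ} (hreg : M.ShapeRegular σ) (h : σ ≤ σ') :
    M.ShapeRegular σ' := by
  intro T hT
  obtain ⟨c, r, hr, hball, hd⟩ := hreg T hT
  exact ⟨c, r, hr, hball, hd.trans (mul_le_mul_of_nonneg_right h (by linarith))⟩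

end TetMesh

/-! ### Nearest nodes and the main theorem -/

theorem exists_isNearest {Γ S : Set E3} (hΓ : IsCompact Γ) (hS : IsClosed S)
    (hne : (Γ ∩ S).Nonempty) (c : E3) : ∃ P, IsNearest (Γ ∩ S) c P := by
  obtain ⟨P, hP, hmin⟩ := (hΓ.inter_right hS).exists_isMinOn hne
    (continuous_const.dist continuous_id : Continuous fun x => dist c x).continuousOn
  exact ⟨P, hP, fun Q hQ => hmin hQ⟩

theorem isClosed_faceLine (F : Finset E3) : IsClosed (faceLine F) := by
  simp only [faceLine, Set.ofPred_forall]
  refine isClosed_iInter fun a => isClosed_iInter fun _ => isClosed_iInter fun b =>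
    isClosed_iInter fun _ => isClosed_eq (by fun_prop) continuous_const

theorem isClosed_edgeLine (e : Finset E3) (n : E3) : IsClosed (edgeLine e n) := by
  have : edgeLine e n = faceLine e ∩ {x | inner ℝ n (x - e.centroid ℝ id) = 0} := rfl
  rw [this]
  exact (isClosed_faceLine e).inter (isClosed_eq (by fun_prop) continuous_const)

end

theorem mainTheorem12 (Ω : Set E3) (hΩ : IsC1Domain Ω) (σ : ℝ)
    (θ : ℝ) (hθ : θ ∈ Set.Ico 0 (Real.pi / 2)) :
    ∃ h₀ : ℝ, 0 < h₀ ∧ ∀ M : TetMesh, M.Fits Ω → M.ShapeRegular σ → M.AtMostOneFaceOrEdge →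
      M.meshSize ≤ h₀ → ∀ n : Finset E3 → E3, M.IsSkinFamily θ n →
        (∃ P Q : Finset E3 → E3, M.IsNodes (frontier Ω) n P Q) ∧
        ∀ P Q : Finset E3 → E3, M.IsNodes (frontier Ω) n P Q →
          ∀ f : E3 → ℝ, MemLp f 2 (volume.restrict Ω) →
            ∃! u : M.Broken, u ∈ M.trialSpace P Q ∧
              ∀ v ∈ M.testSpace, M.form u v = M.load Ω f v := by
  classical
  -- The estimates use σ ≥ 1, and enlarging σ only weakens shape regularity.
  set σ' := max σ 1 with hσ'
  have hσ1 : 1 ≤ σ' := le_max_right _ _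
  have hσ0 : 0 < σ' := by linarith
  have hε1 : 1 / (10 ^ 7 * σ') ≤ 1 := by
    rw [div_le_one (by positivity)]
    linarith
  obtain ⟨h₀, hh₀, hmain⟩ := hΩ.exists_nodes_close (ε := 1 / (10 ^ 7 * σ')) hσ1 hθ
    (by positivity) hε1
  refine ⟨h₀, hh₀, fun M hfit hreg hone hsize n hskin => ?_⟩
  have hreg' : M.ShapeRegular σ' := hreg.mono (le_max_left _ _)
  obtain ⟨hF, he⟩ := hmain M hfit hreg' hone hsize n hskin
  constructor
  · have hP : ∀ F, ∃ x, M.IsBdryFace F →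
        IsNearest (frontier Ω ∩ faceLine F) (F.centroid ℝ id) x := fun F => by
      by_cases hb : M.IsBdryFace F
      · obtain ⟨y, hy, _⟩ := hF F hb
        obtain ⟨x, hx⟩ := exists_isNearest hΩ.isCompact_frontier (isClosed_faceLine F) ⟨y, hy⟩
          (F.centroid ℝ id)
        exact ⟨x, fun _ => hx⟩
      · exact ⟨0, fun h => absurd h hb⟩
    have hQ : ∀ e, ∃ x, M.IsBdryEdge e →
        IsNearest (frontier Ω ∩ edgeLine e (n e)) (e.centroid ℝ id) x := fun e => by
      by_cases hb : M.IsBdryEdge e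
      · obtain ⟨y, hy, _⟩ := he e hb
        obtain ⟨x, hx⟩ := exists_isNearest hΩ.isCompact_frontier (isClosed_edgeLine e (n e)) ⟨y, hy⟩
          (e.centroid ℝ id)
        exact ⟨x, fun _ => hx⟩
      · exact ⟨0, fun h => absurd h hb⟩
    choose P hP using hP
    choose Q hQ using hQ
    exact ⟨P, Q, hP, hQ⟩
  · intro P Q hPQ f hf
    refine TetMesh.existsUnique_solution hσ1 hreg' (fun F hb => ?_) (fun e hb => ?_)
      (M.loadMap hΩ.isOpen hΩ.isBounded hf)
    -- A nearest intersection is at most as far as the crossing point already found; this is where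
    -- "nearest" enters.
    · obtain ⟨y, hy, hd⟩ := hF F hb
      exact ((hPQ.1 F hb).2 y hy).trans hd
    · obtain ⟨y, hy, hd⟩ := he e hb
      exact ((hPQ.2 e hb).2 y hy).trans hd
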